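/- Let $n\ge 2$ and let ${\bf P}=(p_{i,j})_{1\le i\ne j\le n}$ be real numbers. Say that ${\bf P}$ \emph{has league structure} if there is a proper rooted binary tree $T$ with $n$ leaves, labelled $1,\dots,n$ from left to right, each of whose internal nodes $v$ carries a label $q_v\in[\frac12,1]$, such that for all $i<j$, $p_{i,j}=q_{i\vee j}$, where $i\vee j$ is the lowest common ancestor in $T$ of the leaves $i$ and $j$, and $p_{j,i}=1-p_{i,j}$. Say that ${\bf P}$ is \emph{weakly monotone} if $p_{i,j}\ge\frac12$ for all $i<j$ and at least one of the following holds: (a) $p_{i,j+1}\ge p_{i,j}$ for all $1\le i<j\le n-1$; (b) $p_{i-1,j}\ge p_{i,j}$ for all $2\le i<j\le n$. Let $\mathcal{M}_{nn}$ be the Markov chain on the permutations $\sigma=(\sigma(1),\dots,\sigma(n))$ of $\{1,\dots,n\}$ which in each step chooses $i\in\{1,\dots,n-1\}$ uniformly at random and exchanges $\sigma(i)$ and $\sigma(i+1)$ with probability $p_{\sigma(i+1),\sigma(i)}$, and does nothing with the remaining probability $p_{\sigma(i),\sigma(i+1)}$. With $\mathcal{P}$ its transition matrix and $\pi(\sigma)=\frac1Z\prod_{i<j}p_{\sigma(i),\sigma(j)}$,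 where $Z=\sum_{\rho}\prod_{i<j}p_{\rho(i),\rho(j)}$, its mixing time is $$\tau_{nn}(\epsilon)=\min\Big\{t:\ \max_{\sigma}\tfrac12\sum_{\beta}\big|\mathcal{P}^{t'}(\sigma,\beta)-\pi(\beta)\big|\le\epsilon\ \text{ for all } t'\ge t\Big\}.$$ \textbf{Theorem.} For every constant $p_{\max}<1$ there is a constant $C>0$, depending only on $p_{\max}$, such that for every $n\ge2$ and every ${\bf P}$ that has league structure, is weakly monotone, and satisfies $p_{i,j}\le p_{\max}$ for all $i\ne j$, the distribution $\pi$ is stationary for $\mathcal{M}_{nn}$ and, for every $0<\epsilon<1$, the mixing time is finite and satisfies $$\tau_{nn}(\epsilon)\le C\,n^9\log(n/\epsilon).$$ -/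

import Mathlib

namespace BiasedPerm

/-- A proper rooted binary tree (every internal node has exactly two children, a left and a right
one), with leaves labelled by elements of `α` and internal nodes labelled by real numbers. -/
inductive LeagueTree (α : Type) : Type where
  | leaf (a : α) : LeagueTree α
  | node (q : ℝ) (l r : LeagueTree α) : LeagueTree α

namespace LeagueTree

/-- The leaf labels, read from left to right. -/
def leaves {α : Type} : LeagueTree α → List α
  | leaf a => [a]
  | node _ l r => l.leaves ++ r.leaves

/-- Every internal node `v` has a label `1 / 2 ≤ q_v ≤ 1`. -/
def LabelsValid {α : Type} : LeagueTree α → Prop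
  | leaf _ => True
  | node q l r => (1 / 2 ≤ q ∧ q ≤ 1) ∧ l.LabelsValid ∧ r.LabelsValid

/-- The label of the lowest common ancestor of the leaves `i ≠ j` of the tree: one descends from
the root as long as both leaves lie below the same child. (The value at a leaf is never used when
`i ≠ j` both occur in a tree with distinct leaf labels.) -/
noncomputable def lcaLabel {α : Type} [DecidableEq α] : LeagueTree α → α → α → ℝ
  | leaf _, _, _ => 0
  | node q l r, i, j =>
      if i ∈ l.leaves ∧ j ∈ l.leaves then l.lcaLabel i j
      else if i ∈ r.leaves ∧ j ∈ r.leaves then r.lcaLabel i j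
      else q

end LeagueTree

/-- `p` has league structure `T`: the leaves of `T` are the `n` elements in sorted order, the labels
of the internal nodes lie in `[1/2, 1]`, and for `i < j` the probability `p i j` is the label
of the lowest common ancestor of `i` and `j`, with `p j i = 1 - p i j`. -/
def HasLeagueStructure {n : ℕ} (p : Fin n → Fin n → ℝ) (T : LeagueTree (Fin n)) : Prop :=
  T.leaves = List.finRange n ∧ T.LabelsValid ∧
    ∀ i j : Fin n, i < j → p i j = T.lcaLabel i j ∧ p j i = 1 - p i j

/-- Weak monotonicity: `p i j ≥ 1/2` for `i < j`, and either `p i (j+1) ≥ p i j` for all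
`i < j` or `p (i-1) j ≥ p i j` for all `i < j` (whenever the indices are in range). -/
def WeaklyMonotone {n : ℕ} (p : Fin n → Fin n → ℝ) : Prop :=
  (∀ i j : Fin n, i < j → 1 / 2 ≤ p i j) ∧
    ((∀ i j j' : Fin n, i < j → j'.val = j.val + 1 → p i j ≤ p i j') ∨
      (∀ i i' j : Fin n, i < j → i'.val + 1 = i.val → p i j ≤ p i' j))

/-- The position `i` among the `n - 1` positions that have a right neighbour. -/
def pos {n : ℕ} (i : Fin (n - 1)) : Fin n := ⟨i.val, by omega⟩

/-- The position just to the right of `pos i`. -/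
def posSucc {n : ℕ} (i : Fin (n - 1)) : Fin n := ⟨i.val + 1, by omega⟩

/-- The permutation obtained from `σ` (`σ k` is the element at position `k`) by exchanging
the elements at the adjacent positions `pos i` and `posSucc i`. -/
def swapAt {n : ℕ} (σ : Equiv.Perm (Fin n)) (i : Fin (n - 1)) : Equiv.Perm (Fin n) :=
  σ * Equiv.swap (pos i) (posSucc i)

/-- The transition matrix of the nearest neighbour chain: choose one of the `n - 1` adjacent
pairs of positions uniformly; with `a`, `b` the elements there (from left to right), exchange them
with probability `p b a`, and do nothing with probability `p a b`. -/
noncomputable def nnMatrix {n : ℕ} (p : Fin n → Fin n → ℝ) :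
    Matrix (Equiv.Perm (Fin n)) (Equiv.Perm (Fin n)) ℝ :=
  Matrix.of fun σ τ => ∑ i : Fin (n - 1), 1 / ((n : ℝ) - 1) *
    ((if τ = swapAt σ i then p (σ (posSucc i)) (σ (pos i)) else 0) +
      (if τ = σ then p (σ (pos i)) (σ (posSucc i)) else 0))

/-- The weight `∏_{i < j} p_{σ(i), σ(j)}` of a permutation. -/
noncomputable def weight {n : ℕ} (p : Fin n → Fin n → ℝ) (σ : Equiv.Perm (Fin n)) : ℝ :=
  ∏ i : Fin n, ∏ j ∈ Finset.Ioi i, p (σ i) (σ j)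

/-- The distribution proportional to the weights. -/
noncomputable def nnDist {n : ℕ} (p : Fin n → Fin n → ℝ) (σ : Equiv.Perm (Fin n)) : ℝ :=
  weight p σ / ∑ τ : Equiv.Perm (Fin n), weight p τ

/-- `π` is a stationary probability distribution of the chain with transition matrix `P`. -/
def IsStationary {Ω : Type} [Fintype Ω] (P : Matrix Ω Ω ℝ) (π : Ω → ℝ) : Prop :=
  (∀ x, 0 ≤ π x) ∧ ∑ x, π x = 1 ∧ ∀ y, ∑ x, π x * P x y = π y

/-- The total variation distance to `π` after `t` steps, from the worst starting state:
`max_x (1/2) ∑_y |P^t(x,y) - π(y)|`. -/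
noncomputable def tvDist {Ω : Type} [Fintype Ω] [DecidableEq Ω] (P : Matrix Ω Ω ℝ) (π : Ω → ℝ)
    (t : ℕ) : ℝ :=
  ⨆ x : Ω, (1 / 2) * ∑ y : Ω, |(P ^ t) x y - π y|

/-- `τ` is the mixing time `τ(ε)`: the least `t` such that the total variation distance is at most
`ε` at all times `t' ≥ t`. -/
def IsMixingTime {Ω : Type} [Fintype Ω] [DecidableEq Ω] (P : Matrix Ω Ω ℝ) (π : Ω → ℝ)
    (ε : ℝ) (τ : ℕ) : Prop :=
  IsLeast {t : ℕ | ∀ t' : ℕ, t ≤ t' → tvDist P π t' ≤ ε} τ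

end BiasedPerm

/-! ### The nodes of a league tree as a laminar family of bipartitions -/

namespace BiasedPerm

/-! The chain is compared with a second dynamics that has the same reversible weights and in which
every tree node `v` acts on its own. Call `x` below the left child and `y` below the right child of
`v` consecutive in `σ` if no other leaf below `v` stands between them; the node dynamics exchanges
such pairs, jumping over whatever else lies between. By the league structure an element that is not
below `v` compares in the same way with `x` and with `y`, so the jump changes a single factor of the
weight (`weight_mul_swap_of_flat`), and the rates `q v` and `1 - q v` are reversible
(`NodeFamily.nodeReversible`).

The gap of the node dynamics comes from path coupling in dual form. An edge of `v` gets the length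
`edgeLen`: a power of `q v / (1 - q v)`, which balances the two directions of motion, times a
concave quadratic function of the place of the edge among the leaves below `v`. Moves at other nodes
can be matched without changing this length, because the nodes are laminar (`nodeGen_sub_of_ne`);
moves at `v` itself give a relative gain of `1 / n ^ 2` (`nodeGen_sub_self`). So the Lipschitz
seminorm contracts (`isLip_treeStep`), which `quadratic_form_le_of_contraction` turns into a
variance bound: variance at most `n ^ 2 * treeForm` (`NodeFamily.poincare`).

To compare Dirichlet forms, the exchange of consecutive `x` and `y` at positions `a < b` is routed
through adjacent exchanges. What lies between them precedes all leaves below `v` ("small") or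
follows them all ("large"). First every small element is moved one place to the left past an element
that is not small; then `y` travels left until it meets `x`. Moving `y` past small elements costs
weight, but monotone rows make the gains of the first sweep pay for it (`weight_sweepRight`,
`weight_sweepLeft`). The other end of the exchange follows the same route with `x` and `y` renamed,
and the two routes meet across one adjacent exchange (`SweepData.routeLeft_flip`). No moving
arrangement on a route weighs less than its start, and the start can be decoded from the arrangement
and the time, so there is no congestion. This gives `treeForm_le`. Monotone columns are reduced to
monotone rows by reversing positions and elements.

Together these give `nn_poincare`. The transition matrix is an average of heat bath updates, so it
contracts mean-zero functions in square mean by the factor `1 - 1 / (54 * n ^ 7)`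
(`nnMatrix_contraction`). The bound `pmax` enters quantitatively only through the smallest
stationary probability, at least `exp (-(1 + A) * n ^ 2)` with `A` depending on `pmax`; its
logarithm supplies the last factor `n ^ 2`. -/

/-- The internal nodes of a tree, each given by the sets of leaves below its left and right child. -/
def LeagueTree.nodes {α : Type} [DecidableEq α] : LeagueTree α → Finset (Finset α × Finset α)
  | .leaf _ => ∅
  | .node _ l r => insert (l.leaves.toFinset, r.leaves.toFinset) (l.nodes ∪ r.nodes)

/-- All leaves below a node. -/
def span {α : Type} [DecidableEq α] (v : Finset α × Finset α) : Finset α := v.1 ∪ v.2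

lemma mem_span {α : Type} [DecidableEq α] {v : Finset α × Finset α} {x : α} :
    x ∈ span v ↔ x ∈ v.1 ∨ x ∈ v.2 := Finset.mem_union

/-- The leaves below `u` lie below a single child of `v`, or none of them lies below `v`. -/
def Below {α : Type} [DecidableEq α] (u v : Finset α × Finset α) : Prop :=
  span u ⊆ v.1 ∨ span u ⊆ v.2 ∨ Disjoint (span u) (span v)

/-- The properties of the set of nodes of a league structure that are used below. -/
structure NodeFamily {n : ℕ} (p : Fin n → Fin n → ℝ)
    (N : Finset (Finset (Fin n) × Finset (Fin n))) : Prop where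
  lt : ∀ v ∈ N, ∀ x ∈ v.1, ∀ y ∈ v.2, x < y
  sep : ∀ x y, x < y → ∃ v ∈ N, x ∈ v.1 ∧ y ∈ v.2
  laminar : ∀ u ∈ N, ∀ v ∈ N, u ≠ v → Below u v ∨ Below v u
  label : ∀ v ∈ N, ∃ q : ℝ, ∀ x ∈ v.1, ∀ y ∈ v.2, p x y = q
  convex : ∀ v ∈ N, ∀ x ∈ span v, ∀ y ∈ span v, ∀ z, x < z → z < y → z ∈ span v

namespace LeagueTree

variable {α : Type} [DecidableEq α]

lemma span_subset_leaves (T : LeagueTree α) :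
    ∀ v ∈ T.nodes, ∀ x ∈ span v, x ∈ T.leaves := by
  induction T with
  | leaf a => simp [nodes]
  | node q l r ihl ihr =>
    intro v hv x hx
    simp only [nodes, Finset.mem_insert, Finset.mem_union] at hv
    simp only [leaves, List.mem_append]
    rcases hv with rfl | hv | hv
    · simpa [mem_span] using hx
    · exact Or.inl (ihl v hv x hx)
    · exact Or.inr (ihr v hv x hx)

variable [LinearOrder α]

lemma nodes_lt (T : LeagueTree α) (hT : T.leaves.Pairwise (· < ·)) :
    ∀ v ∈ T.nodes, ∀ x ∈ v.1, ∀ y ∈ v.2, x < y := by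
  induction T with
  | leaf a => simp [nodes]
  | node q l r ihl ihr =>
    intro v hv
    simp only [leaves, List.pairwise_append] at hT
    simp only [nodes, Finset.mem_insert, Finset.mem_union] at hv
    rcases hv with rfl | hv | hv
    · intro x hx y hy
      exact hT.2.2 x (by simpa using hx) y (by simpa using hy)
    · exact ihl hT.1 v hv
    · exact ihr hT.2.1 v hv

lemma nodes_sep (T : LeagueTree α) (hT : T.leaves.Pairwise (· < ·)) :
    ∀ x ∈ T.leaves, ∀ y ∈ T.leaves, x < y → ∃ v ∈ T.nodes, x ∈ v.1 ∧ y ∈ v.2 := by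
  induction T with
  | leaf a =>
    intro x hx y hy h
    simp only [leaves, List.mem_singleton] at hx hy
    subst hx hy
    exact absurd h (lt_irrefl _)
  | node q l r ihl ihr =>
    intro x hx y hy h
    simp only [leaves, List.pairwise_append] at hT
    simp only [leaves, List.mem_append] at hx hy
    simp only [nodes, Finset.mem_insert, Finset.mem_union]
    rcases hx with hx | hx <;> rcases hy with hy | hy
    · obtain ⟨v, hv, h⟩ := ihl hT.1 x hx y hy h
      exact ⟨v, Or.inr (Or.inl hv), h⟩
    · exact ⟨_, Or.inl rfl, by simpa using hx, by simpa using hy⟩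
    · exact absurd (hT.2.2 y hy x hx) h.not_gt
    · obtain ⟨v, hv, h⟩ := ihr hT.2.1 x hx y hy h
      exact ⟨v, Or.inr (Or.inr hv), h⟩

lemma nodes_laminar (T : LeagueTree α) (hT : T.leaves.Pairwise (· < ·)) :
    ∀ u ∈ T.nodes, ∀ v ∈ T.nodes, u ≠ v → Below u v ∨ Below v u := by
  induction T with
  | leaf a => simp [nodes]
  | node q l r ihl ihr =>
    intro u hu v hv huv
    simp only [leaves, List.pairwise_append] at hT
    simp only [nodes, Finset.mem_insert, Finset.mem_union] at hu hv
    have hl : ∀ w ∈ l.nodes, Below w (l.leaves.toFinset, r.leaves.toFinset) := fun w hw =>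
      Or.inl fun x hx => by simpa using span_subset_leaves l w hw x hx
    have hr : ∀ w ∈ r.nodes, Below w (l.leaves.toFinset, r.leaves.toFinset) := fun w hw =>
      Or.inr (Or.inl fun x hx => by simpa using span_subset_leaves r w hw x hx)
    have hd : ∀ w ∈ l.nodes, ∀ w' ∈ r.nodes, Disjoint (span w) (span w') := fun w hw w' hw' =>
      Finset.disjoint_left.2 fun x hx hx' => lt_irrefl _ (hT.2.2 x
        (span_subset_leaves l w hw x hx) x (span_subset_leaves r w' hw' x hx'))
    rcases hu with rfl | hu | hu <;> rcases hv with rfl | hv | hv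
    · exact absurd rfl huv
    · exact Or.inr (hl v hv)
    · exact Or.inr (hr v hv)
    · exact Or.inl (hl u hu)
    · exact ihl hT.1 u hu v hv huv
    · exact Or.inl (Or.inr (Or.inr (hd u hu v hv)))
    · exact Or.inl (hr u hu)
    · exact Or.inr (Or.inr (Or.inr (hd v hv u hu)))
    · exact ihr hT.2.1 u hu v hv huv

lemma nodes_label (T : LeagueTree α) (hT : T.leaves.Pairwise (· < ·)) :
    ∀ v ∈ T.nodes, ∃ q, ∀ x ∈ v.1, ∀ y ∈ v.2, T.lcaLabel x y = q := by
  induction T with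
  | leaf a => simp [nodes]
  | node q l r ihl ihr =>
    intro v hv
    simp only [leaves, List.pairwise_append] at hT
    have hd : ∀ x, x ∈ l.leaves → x ∉ r.leaves := fun x hx hx' =>
      lt_irrefl _ (hT.2.2 x hx x hx')
    simp only [nodes, Finset.mem_insert, Finset.mem_union] at hv
    rcases hv with rfl | hv | hv
    · refine ⟨q, fun x hx y hy => ?_⟩
      simp only [List.mem_toFinset] at hx hy
      have := hd x hx
      have : y ∉ l.leaves := fun h => hd y h hy
      simp [lcaLabel, *]
    · obtain ⟨q', hq'⟩ := ihl hT.1 v hv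
      refine ⟨q', fun x hx y hy => ?_⟩
      rw [lcaLabel, if_pos, hq' x hx y hy]
      exact ⟨span_subset_leaves l v hv x (mem_span.2 (Or.inl hx)),
        span_subset_leaves l v hv y (mem_span.2 (Or.inr hy))⟩
    · obtain ⟨q', hq'⟩ := ihr hT.2.1 v hv
      refine ⟨q', fun x hx y hy => ?_⟩
      have hx' := span_subset_leaves r v hv x (mem_span.2 (Or.inl hx))
      rw [lcaLabel, if_neg, if_pos, hq' x hx y hy]
      · exact ⟨hx', span_subset_leaves r v hv y (mem_span.2 (Or.inr hy))⟩
      · exact fun h => hd x h.1 hx'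

lemma nodes_convex (T : LeagueTree α) (hT : T.leaves.Pairwise (· < ·)) :
    ∀ v ∈ T.nodes, ∀ x ∈ span v, ∀ y ∈ span v, ∀ z ∈ T.leaves, x < z → z < y → z ∈ span v := by
  induction T with
  | leaf a => simp [nodes]
  | node q l r ihl ihr =>
    intro v hv x hx y hy z hz hxz hzy
    simp only [leaves, List.pairwise_append] at hT
    simp only [leaves, List.mem_append] at hz
    simp only [nodes, Finset.mem_insert, Finset.mem_union] at hv
    rcases hv with rfl | hv | hv
    · simpa [mem_span] using hz
    · rcases hz with hz | hz
      · exact ihl hT.1 v hv x hx y hy z hz hxz hzy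
      · exact absurd (hT.2.2 y (span_subset_leaves l v hv y hy) z hz) hzy.not_gt
    · rcases hz with hz | hz
      · exact absurd (hT.2.2 z hz x (span_subset_leaves r v hv x hx)) hxz.not_gt
      · exact ihr hT.2.1 v hv x hx y hy z hz hxz hzy

end LeagueTree

/-- Apart from `p j i = 1 - p i j`, this is all that the proof takes from the tree. -/
lemma HasLeagueStructure.nodeFamily {n : ℕ} {p : Fin n → Fin n → ℝ} {T : LeagueTree (Fin n)}
    (h : HasLeagueStructure p T) : NodeFamily p T.nodes := by
  obtain ⟨hl, -, hp⟩ := h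
  have hT : T.leaves.Pairwise (· < ·) := by
    rw [hl]; exact List.pairwise_lt_finRange n
  have hm : ∀ x, x ∈ T.leaves := fun x => by rw [hl]; exact List.mem_finRange x
  refine ⟨T.nodes_lt hT, fun x y => T.nodes_sep hT x (hm x) y (hm y), T.nodes_laminar hT, ?_,
    fun v hv x hx y hy z => T.nodes_convex hT v hv x hx y hy z (hm z)⟩
  intro v hv
  obtain ⟨q, hq⟩ := T.nodes_label hT v hv
  exact ⟨q, fun x hx y hy => by rw [(hp x y (T.nodes_lt hT v hv x hx y hy)).1, hq x hx y hy]⟩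

end BiasedPerm

/-! ### From contraction of a seminorm to a bound on a quadratic form -/

namespace BiasedPerm

section Gap

variable {X : Type} [Fintype X]

lemma weighted_cauchy_schwarz {W : X → ℝ} (hW : ∀ x, 0 < W x) (f g : X → ℝ) :
    (∑ x, W x * (f x * g x)) ^ 2 ≤ (∑ x, W x * f x ^ 2) * ∑ x, W x * g x ^ 2 :=
  Finset.sum_sq_le_sum_mul_sum_of_sq_le_mul _
    (fun x _ => mul_nonneg (hW x).le (sq_nonneg _)) (fun x _ => mul_nonneg (hW x).le (sq_nonneg _))
    fun x _ => le_of_eq (by ring)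

/-- A log-convex sequence that decays at the rate `s` has first ratio at most `s`. -/
lemma le_mul_of_logConvex_of_decay {a : ℕ → ℝ} (ha : ∀ t, 0 ≤ a t)
    (hc : ∀ t, a (t + 1) ^ 2 ≤ a t * a (t + 2)) {s B : ℝ} (hs : 0 < s)
    (hB : ∀ t, a t ≤ B * s ^ t) : a 1 ≤ s * a 0 := by
  rcases (ha 0).eq_or_lt with h0 | h0
  · have := hc 0
    rw [← h0, zero_mul] at this
    have : a 1 = 0 := by simpa using le_antisymm this (sq_nonneg _)
    simp [this, ← h0]
  by_contra! hlt
  set r := a 1 / a 0 with hr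
  have hsr : s < r := by rw [hr, lt_div_iff₀ h0]; exact hlt
  have hr0 : 0 < r := hs.trans hsr
  -- The ratios of a log-convex sequence do not decrease, so a first ratio `r > s` would force
  -- growth like `r ^ t`, against the decay.
  have key : ∀ t, 0 < a t ∧ r * a t ≤ a (t + 1) := by
    intro t
    induction t with
    | zero => exact ⟨h0, by rw [hr, div_mul_cancel₀ _ h0.ne']⟩
    | succ t ih =>
      have h1 : 0 < a (t + 1) := (mul_pos hr0 ih.1).trans_le ih.2
      refine ⟨h1, ?_⟩
      have h2 : a t * (r * a (t + 1)) ≤ a t * a (t + 2) := by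
        calc a t * (r * a (t + 1)) = (r * a t) * a (t + 1) := by ring
          _ ≤ a (t + 1) * a (t + 1) := mul_le_mul_of_nonneg_right ih.2 h1.le
          _ = a (t + 1) ^ 2 := (sq _).symm
          _ ≤ _ := hc t
      exact le_of_mul_le_mul_left h2 ih.1
  have hpow : ∀ t, a 0 * r ^ t ≤ a t := by
    intro t
    induction t with
    | zero => simp
    | succ t ih =>
      calc a 0 * r ^ (t + 1) = r * (a 0 * r ^ t) := by ring
        _ ≤ r * a t := mul_le_mul_of_nonneg_left ih hr0.le
        _ ≤ _ := (key t).2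
  obtain ⟨t, ht⟩ := pow_unbounded_of_one_lt (B / a 0) ((one_lt_div hs).2 hsr)
  have := (hpow t).trans (hB t)
  rw [div_pow, lt_div_iff₀ (pow_pos hs t), div_mul_eq_mul_div, div_lt_iff₀ h0] at ht
  linarith

/-- If a self-adjoint averaging operator contracts a Lipschitz-type seminorm by the factor `θ`,
then its quadratic form on functions of mean zero is at most `θ`. -/
lemma quadratic_form_le_of_contraction {W : X → ℝ} (hW : ∀ x, 0 < W x)
    (P : (X → ℝ) → X → ℝ)
    (hsymm : ∀ f g, ∑ x, W x * (P f x * g x) = ∑ x, W x * (f x * P g x))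
    (hone : ∀ f, ∑ x, W x * P f x = ∑ x, W x * f x)
    (Lip : (X → ℝ) → ℝ → Prop) {θ C : ℝ} (hθ : 0 < θ)
    (hex : ∀ f, ∃ R, Lip f R) (hP : ∀ f R, Lip f R → Lip (P f) (θ * R))
    (hC : ∀ f R, Lip f R → ∀ x y, |f x - f y| ≤ C * R)
    (f : X → ℝ) (hf : ∑ x, W x * f x = 0) :
    ∑ x, W x * (f x * P f x) ≤ θ * ∑ x, W x * f x ^ 2 := by
  set g : ℕ → X → ℝ := fun t => P^[t] f with hg
  have hgs : ∀ t, g (t + 1) = P (g t) := fun t => Function.iterate_succ_apply' P t f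
  set a : ℕ → ℝ := fun t => ∑ x, W x * g t x ^ 2 with ha
  have ha0 : ∀ t, 0 ≤ a t := fun t =>
    Finset.sum_nonneg fun x _ => mul_nonneg (hW x).le (sq_nonneg _)
  have hmean : ∀ t, ∑ x, W x * g t x = 0 := by
    intro t
    induction t with
    | zero => exact hf
    | succ t ih => rw [hgs, hone, ih]
  obtain ⟨R, hR⟩ := hex f
  have hLip : ∀ t, Lip (g t) (θ ^ t * R) := by
    intro t
    induction t with
    | zero => rw [pow_zero, one_mul]; exact hR
    | succ t ih =>
      rw [hgs, pow_succ', mul_assoc]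
      exact hP _ _ ih
  have hWs : 0 ≤ ∑ x, W x := Finset.sum_nonneg fun x _ => (hW x).le
  -- A value of a function of mean zero is an average of differences of values, so the seminorm
  -- controls the supremum.
  have hsup : ∀ t x, g t x ^ 2 ≤ (C * (θ ^ t * R)) ^ 2 := by
    intro t x
    have hWp : 0 < ∑ x, W x := Finset.sum_pos (fun x _ => hW x) ⟨x, Finset.mem_univ x⟩
    have h1 : (∑ y, W y) * g t x = ∑ y, W y * (g t x - g t y) := by
      simp_rw [mul_sub, Finset.sum_sub_distrib, hmean t, sub_zero, Finset.sum_mul]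
    have h2 : |(∑ y, W y) * g t x| ≤ (∑ y, W y) * (C * (θ ^ t * R)) := by
      rw [h1, Finset.sum_mul]
      refine (Finset.abs_sum_le_sum_abs _ _).trans (Finset.sum_le_sum fun y _ => ?_)
      rw [abs_mul, abs_of_pos (hW y)]
      exact mul_le_mul_of_nonneg_left (hC _ _ (hLip t) x y) (hW y).le
    rw [abs_mul, abs_of_pos hWp] at h2
    have h3 : |g t x| ≤ C * (θ ^ t * R) := le_of_mul_le_mul_left h2 hWp
    rw [← sq_abs]
    exact pow_le_pow_left₀ (abs_nonneg _) h3 2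
  -- By self-adjointness `a (t + 1)` is the pairing of `g t` with `g (t + 2)`, and Cauchy–Schwarz
  -- makes `a` log-convex. This takes the place of the spectral theorem.
  have hconv : ∀ t, a (t + 1) ^ 2 ≤ a t * a (t + 2) := by
    intro t
    have : a (t + 1) = ∑ x, W x * (g t x * g (t + 2) x) := by
      rw [hgs (t + 1), ← hsymm, ← hgs]
      exact Finset.sum_congr rfl fun x _ => by rw [sq]
    rw [this]
    exact weighted_cauchy_schwarz hW _ _
  -- Only the rate `θ ^ 2` matters: log-convexity removes the constant in front, however large it
  -- is.
  have hdecay : ∀ t, a t ≤ ((∑ x, W x) * (C * R) ^ 2) * (θ ^ 2) ^ t := by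
    intro t
    calc a t ≤ ∑ x, W x * (C * (θ ^ t * R)) ^ 2 :=
          Finset.sum_le_sum fun x _ => mul_le_mul_of_nonneg_left (hsup t x) (hW x).le
      _ = _ := by rw [← Finset.sum_mul]; ring
  have h1 : a 1 ≤ θ ^ 2 * a 0 :=
    le_mul_of_logConvex_of_decay ha0 hconv (by positivity) hdecay
  have h2 := weighted_cauchy_schwarz hW f (P f)
  have e1 : a 1 = ∑ x, W x * P f x ^ 2 := by simp only [ha]; rw [hgs 0]; rfl
  have e0 : a 0 = ∑ x, W x * f x ^ 2 := rfl
  rw [← e1, ← e0] at h2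
  rw [← e0]
  have h3 : (∑ x, W x * (f x * P f x)) ^ 2 ≤ (θ * a 0) ^ 2 :=
    h2.trans (by nlinarith [ha0 0])
  exact (abs_le_of_sq_le_sq' h3 (mul_nonneg hθ.le (ha0 0))).2

end Gap

end BiasedPerm

/-! ### The order of the elements below a node, and how exchanges affect it -/

namespace BiasedPerm

open Equiv

variable {n : ℕ}

/-- No element of `D` lies strictly between `x` and `y` in the arrangement `σ`. -/
def Consec (D : Finset (Fin n)) (σ : Perm (Fin n)) (x y : Fin n) : Prop :=
  ∀ z ∈ D, ¬(σ⁻¹ x < σ⁻¹ z ∧ σ⁻¹ z < σ⁻¹ y) ∧ ¬(σ⁻¹ y < σ⁻¹ z ∧ σ⁻¹ z < σ⁻¹ x)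

/-- The number of elements of `S` to the left of position `k`. -/
def countLeft (S : Finset (Fin n)) (σ : Perm (Fin n)) (k : Fin n) : ℕ :=
  (S.filter fun z => σ⁻¹ z < k).card

lemma inv_mul_apply (s σ : Perm (Fin n)) (z : Fin n) : (s * σ)⁻¹ z = σ⁻¹ (s⁻¹ z) := by
  rw [mul_inv_rev, Perm.mul_apply]

lemma inv_swap_mul (x y : Fin n) (σ : Perm (Fin n)) (z : Fin n) :
    (swap x y * σ)⁻¹ z = σ⁻¹ (swap x y z) := by
  rw [inv_mul_apply, swap_inv]

lemma Consec.symm {D : Finset (Fin n)} {σ : Perm (Fin n)} {x y : Fin n} (h : Consec D σ x y) :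
    Consec D σ y x := fun z hz => (h z hz).symm

lemma consec_relabel {D : Finset (Fin n)} {s : Perm (Fin n)} (hs : ∀ z, s z ∈ D ↔ z ∈ D)
    (σ : Perm (Fin n)) (x y : Fin n) : Consec D (s * σ) (s x) (s y) ↔ Consec D σ x y := by
  unfold Consec
  constructor
  · intro h z hz
    have := h (s z) ((hs z).2 hz)
    simpa [inv_mul_apply] using this
  · intro h z hz
    have := h (s⁻¹ z) ((hs _).1 (by simpa using hz))
    simpa [inv_mul_apply] using this

lemma countLeft_relabel {S : Finset (Fin n)} {s : Perm (Fin n)} (hs : ∀ z, s z ∈ S ↔ z ∈ S)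
    (σ : Perm (Fin n)) (k : Fin n) : countLeft S (s * σ) k = countLeft S σ k := by
  unfold countLeft
  symm
  refine Finset.card_equiv s fun z => ?_
  simp [hs]

lemma countLeft_swap {S : Finset (Fin n)} {σ : Perm (Fin n)} {x y k : Fin n}
    (h : σ⁻¹ x < k ↔ σ⁻¹ y < k) : countLeft S (swap x y * σ) k = countLeft S σ k := by
  unfold countLeft
  congr 1
  refine Finset.filter_congr fun z _ => ?_
  rw [inv_swap_mul]
  rcases eq_or_ne z x with rfl | hx
  · rw [swap_apply_left, h]
  rcases eq_or_ne z y with rfl | hy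
  · rw [swap_apply_right, h]
  rw [swap_apply_of_ne_of_ne hx hy]

/-- When `z` lies in `D`, the hypotheses make it the last element of `D` before `k`, so between its
position and `k` the count can gain only `z` itself. -/
lemma countLeft_step {D S : Finset (Fin n)} (hSD : S ⊆ D) {σ : Perm (Fin n)} {z k : Fin n}
    (hz : σ⁻¹ z < k) (hgap : ∀ c ∈ D, ¬(σ⁻¹ z < σ⁻¹ c ∧ σ⁻¹ c < k)) :
    countLeft S σ k = countLeft S σ (σ⁻¹ z) + if z ∈ S then 1 else 0 := by
  unfold countLeft
  have key : ∀ c ∈ S, (σ⁻¹ c < k ↔ σ⁻¹ c < σ⁻¹ z ∨ c = z) := by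
    intro c hc
    constructor
    · intro h
      rcases lt_trichotomy (σ⁻¹ c) (σ⁻¹ z) with h' | h' | h'
      · exact Or.inl h'
      · exact Or.inr (σ⁻¹.injective h')
      · exact absurd ⟨h', h⟩ (hgap c (hSD hc))
    · rintro (h | rfl)
      · exact h.trans hz
      · exact hz
  rw [Finset.filter_congr key, Finset.filter_or, Finset.card_union_of_disjoint]
  · congr 1
    split_ifs with h
    · rw [Finset.filter_eq' S z, if_pos h, Finset.card_singleton]
    · rw [Finset.filter_eq' S z, if_neg h, Finset.card_empty]
  · refine Finset.disjoint_filter.2 fun c _ h h' => ?_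
    rw [h'] at h
    exact lt_irrefl _ h

lemma countLeft_le (S : Finset (Fin n)) (σ : Perm (Fin n)) (k : Fin n) :
    countLeft S σ k ≤ k := by
  unfold countLeft
  rw [← Fin.card_Iio k]
  refine Finset.card_le_card_of_injOn (fun z => σ⁻¹ z) ?_ σ⁻¹.injective.injOn
  intro z hz
  simpa using (Finset.mem_filter.1 hz).2

/-- Two arrangements order the elements of `D` in the same way. -/
def SameOrder (D : Finset (Fin n)) (σ σ' : Perm (Fin n)) : Prop :=
  ∀ z ∈ D, ∀ z' ∈ D, (σ'⁻¹ z < σ'⁻¹ z' ↔ σ⁻¹ z < σ⁻¹ z')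

lemma SameOrder.consec_iff {D : Finset (Fin n)} {σ σ' : Perm (Fin n)} (h : SameOrder D σ σ')
    {x y : Fin n} (hx : x ∈ D) (hy : y ∈ D) : Consec D σ' x y ↔ Consec D σ x y := by
  unfold Consec
  refine forall₂_congr fun z hz => ?_
  rw [h x hx z hz, h z hz y hy, h y hy z hz, h z hz x hx]

lemma SameOrder.countLeft_eq {D S : Finset (Fin n)} (hSD : S ⊆ D) {σ σ' : Perm (Fin n)}
    (h : SameOrder D σ σ') {x : Fin n} (hx : x ∈ D) :
    countLeft S σ' (σ'⁻¹ x) = countLeft S σ (σ⁻¹ x) := by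
  unfold countLeft
  congr 1
  exact Finset.filter_congr fun z hz => h z (hSD hz) x hx

section Nodes

variable {p : Fin n → Fin n → ℝ} {N : Finset (Finset (Fin n) × Finset (Fin n))}

lemma NodeFamily.disjoint (hN : NodeFamily p N) {v : Finset (Fin n) × Finset (Fin n)}
    (hv : v ∈ N) {x : Fin n} (h1 : x ∈ v.1) (h2 : x ∈ v.2) : False :=
  lt_irrefl _ (hN.lt v hv x h1 x h2)

/-- A move at a node `u` keeps the order of the elements below `v` if `v` lies below a child
of `u` or is disjoint from `u`. -/
lemma NodeFamily.sameOrder_of_below (hN : NodeFamily p N)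
    {u v : Finset (Fin n) × Finset (Fin n)} (hu : u ∈ N) (hvu : Below v u) {σ : Perm (Fin n)}
    {x y : Fin n} (hx : x ∈ u.1) (hy : y ∈ u.2) (hc : Consec (span u) σ x y) :
    SameOrder (span v) σ (swap x y * σ) := by
  have hxy : x ≠ y := fun h => hN.disjoint hu hx (h ▸ hy)
  have hxu : x ∈ span u := mem_span.2 (Or.inl hx)
  have hyu : y ∈ span u := mem_span.2 (Or.inr hy)
  -- Since `x` and `y` are consecutive below `u`, any other leaf below `u` lies on the same side of
  -- both.
  have side : ∀ z ∈ span u, z ≠ x → z ≠ y →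
      ((σ⁻¹ z < σ⁻¹ x ↔ σ⁻¹ z < σ⁻¹ y) ∧ (σ⁻¹ x < σ⁻¹ z ↔ σ⁻¹ y < σ⁻¹ z)) := by
    intro z hz hzx hzy
    have h1 := hc z hz
    have h2 : σ⁻¹ z ≠ σ⁻¹ x := fun h => hzx (σ⁻¹.injective h)
    have h3 : σ⁻¹ z ≠ σ⁻¹ y := fun h => hzy (σ⁻¹.injective h)
    grind
  intro z hz z' hz'
  rw [inv_swap_mul, inv_swap_mul]
  -- At most one of `x` and `y` lies below `v`, and the exchange moves it only across elements that
  -- are not below `v`.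
  rcases hvu with h | h | h
  · have ne : ∀ c ∈ span v, c ≠ y := fun c hc' e => hN.disjoint hu (h hc') (e ▸ hy)
    have hin : ∀ c ∈ span v, c ∈ span u := fun c hc' => mem_span.2 (Or.inl (h hc'))
    rcases eq_or_ne z x with rfl | hzx
    · rcases eq_or_ne z' z with rfl | hz'x
      · simp
      · rw [swap_apply_left, swap_apply_of_ne_of_ne hz'x (ne z' hz')]
        exact (side z' (hin z' hz') hz'x (ne z' hz')).2.symm
    · rw [swap_apply_of_ne_of_ne hzx (ne z hz)]
      rcases eq_or_ne z' x with rfl | hz'x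
      · rw [swap_apply_left]
        exact (side z (hin z hz) hzx (ne z hz)).1.symm
      · rw [swap_apply_of_ne_of_ne hz'x (ne z' hz')]
  · have ne : ∀ c ∈ span v, c ≠ x := fun c hc' e => hN.disjoint hu hx (e ▸ (h hc'))
    have hin : ∀ c ∈ span v, c ∈ span u := fun c hc' => mem_span.2 (Or.inr (h hc'))
    rcases eq_or_ne z y with rfl | hzy
    · rcases eq_or_ne z' z with rfl | hz'y
      · simp
      · rw [swap_apply_right, swap_apply_of_ne_of_ne (ne z' hz') hz'y]
        exact (side z' (hin z' hz') (ne z' hz') hz'y).2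
    · rw [swap_apply_of_ne_of_ne (ne z hz) hzy]
      rcases eq_or_ne z' y with rfl | hz'y
      · rw [swap_apply_right]
        exact (side z (hin z hz) (ne z hz) hzy).1
      · rw [swap_apply_of_ne_of_ne (ne z' hz') hz'y]
  · have hne : ∀ c ∈ span v, c ≠ x ∧ c ≠ y := fun c hc' =>
      ⟨fun e => Finset.disjoint_left.1 h hc' (e ▸ hxu),
        fun e => Finset.disjoint_left.1 h hc' (e ▸ hyu)⟩
    rw [swap_apply_of_ne_of_ne (hne z hz).1 (hne z hz).2,
      swap_apply_of_ne_of_ne (hne z' hz').1 (hne z' hz').2]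

lemma swap_mem_iff {S : Finset (Fin n)} {x y : Fin n} (h : x ∈ S ↔ y ∈ S) (z : Fin n) :
    swap x y z ∈ S ↔ z ∈ S := by
  rcases eq_or_ne z x with rfl | hx
  · rw [swap_apply_left, h]
  rcases eq_or_ne z y with rfl | hy
  · rw [swap_apply_right, h]
  rw [swap_apply_of_ne_of_ne hx hy]

/-- Exchanging two elements below `u` preserves both sides of `v` if `u` lies below a child
of `v` or is disjoint from `v`. -/
lemma NodeFamily.swap_mem_iff_of_below (hN : NodeFamily p N)
    {u v : Finset (Fin n) × Finset (Fin n)} (hv : v ∈ N) (huv : Below u v) {x y : Fin n}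
    (hx : x ∈ span u) (hy : y ∈ span u) :
    (∀ z, swap x y z ∈ v.1 ↔ z ∈ v.1) ∧ (∀ z, swap x y z ∈ v.2 ↔ z ∈ v.2) := by
  have : (x ∈ v.1 ↔ y ∈ v.1) ∧ (x ∈ v.2 ↔ y ∈ v.2) := by
    rcases huv with h | h | h
    · exact ⟨⟨fun _ => h hy, fun _ => h hx⟩,
        ⟨fun h' => (hN.disjoint hv (h hx) h').elim, fun h' => (hN.disjoint hv (h hy) h').elim⟩⟩
    · exact ⟨⟨fun h' => (hN.disjoint hv h' (h hx)).elim,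
        fun h' => (hN.disjoint hv h' (h hy)).elim⟩, ⟨fun _ => h hy, fun _ => h hx⟩⟩
    · have h1 := Finset.disjoint_left.1 h hx
      have h2 := Finset.disjoint_left.1 h hy
      rw [mem_span] at h1 h2
      tauto
  exact ⟨swap_mem_iff this.1, swap_mem_iff this.2⟩

end Nodes

lemma span_mem_iff {v : Finset (Fin n) × Finset (Fin n)} {s : Perm (Fin n)}
    (h1 : ∀ z, s z ∈ v.1 ↔ z ∈ v.1) (h2 : ∀ z, s z ∈ v.2 ↔ z ∈ v.2) (z : Fin n) :
    s z ∈ span v ↔ z ∈ span v := by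
  rw [mem_span, mem_span, h1, h2]

end BiasedPerm

/-! ### The dynamics of the nodes, and the interaction of different nodes -/

namespace BiasedPerm

open Equiv

variable {n : ℕ}

instance (D : Finset (Fin n)) (σ : Perm (Fin n)) (x y : Fin n) : Decidable (Consec D σ x y) := by
  unfold Consec; infer_instance

/-- The rate of exchanging the elements `x` (left of `v`) and `y` (right of `v`). -/
noncomputable def nodeRate (q : Finset (Fin n) × Finset (Fin n) → ℝ)
    (v : Finset (Fin n) × Finset (Fin n)) (σ : Perm (Fin n)) (x y : Fin n) : ℝ :=
  if σ⁻¹ x < σ⁻¹ y then 1 - q v else q v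

/-- The contribution of one pair of elements to the generator at the node `v`. -/
noncomputable def nodeTerm (q : Finset (Fin n) × Finset (Fin n) → ℝ) (f : Perm (Fin n) → ℝ)
    (v : Finset (Fin n) × Finset (Fin n)) (σ : Perm (Fin n)) (z : Fin n × Fin n) : ℝ :=
  if Consec (span v) σ z.1 z.2 then
    nodeRate q v σ z.1 z.2 * (f (swap z.1 z.2 * σ) - f σ) else 0

/-- The generator of the exclusion process at the node `v`. -/
noncomputable def nodeGen (q : Finset (Fin n) × Finset (Fin n) → ℝ) (f : Perm (Fin n) → ℝ)
    (v : Finset (Fin n) × Finset (Fin n)) (σ : Perm (Fin n)) : ℝ :=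
  ∑ z ∈ v.1 ×ˢ v.2, nodeTerm q f v σ z

/-- The length of the edge between `σ` and `swap x y * σ`, where `x`, lying to the left of `v`,
and `y`, lying to the right of `v`, are consecutive below `v`, and `x` comes first. -/
noncomputable def edgeLen (q : Finset (Fin n) × Finset (Fin n) → ℝ)
    (v : Finset (Fin n) × Finset (Fin n)) (σ : Perm (Fin n)) (x : Fin n) : ℝ :=
  ((n : ℝ) ^ 2 - ((countLeft (span v) σ (σ⁻¹ x) : ℝ) + 1) ^ 2) *
    (q v / (1 - q v)) ^ countLeft v.2 σ (σ⁻¹ x)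

/-- `f` changes by at most `R` times the length along every edge. -/
def IsLip (q : Finset (Fin n) × Finset (Fin n) → ℝ)
    (N : Finset (Finset (Fin n) × Finset (Fin n))) (f : Perm (Fin n) → ℝ) (R : ℝ) : Prop :=
  ∀ v ∈ N, ∀ x ∈ v.1, ∀ y ∈ v.2, ∀ σ : Perm (Fin n), σ⁻¹ x < σ⁻¹ y → Consec (span v) σ x y →
    |f (swap x y * σ) - f σ| ≤ R * edgeLen q v σ x

/-- A coupling in summed form. Matched moves at rate `r` at the two ends of an edge with difference
`a` lead to an edge with difference `e`, which changes the difference at the rate `r * (e - a)`. The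
total matched rate `c` stays on the left, to be absorbed later into `1 - δ * c`. -/
lemma abs_sum_add_le {ι : Type*} (s : Finset ι) (A B : ι → ℝ) {a E : ℝ}
    (h : ∀ i ∈ s, ∃ r e : ℝ, 0 ≤ r ∧ r ≤ 1 ∧ A i - B i = r * (e - a) ∧ |e| ≤ E) :
    ∃ c : ℝ, 0 ≤ c ∧ c ≤ s.card ∧ |∑ i ∈ s, A i - ∑ i ∈ s, B i + c * a| ≤ c * E := by
  classical
  induction s using Finset.induction_on with
  | empty => exact ⟨0, le_rfl, by simp, by simp⟩
  | insert i s hi ih =>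
    obtain ⟨c, hc0, hc1, hc⟩ := ih fun j hj => h j (Finset.mem_insert_of_mem hj)
    obtain ⟨r, e, hr0, hr1, hAB, he⟩ := h i (Finset.mem_insert_self i s)
    refine ⟨c + r, by positivity, ?_, ?_⟩
    · rw [Finset.card_insert_of_notMem hi]; push_cast; linarith
    · rw [Finset.sum_insert hi, Finset.sum_insert hi]
      have e1 : A i + ∑ j ∈ s, A j - (B i + ∑ j ∈ s, B j) + (c + r) * a
          = (∑ j ∈ s, A j - ∑ j ∈ s, B j + c * a) + r * e := by linear_combination hAB
      rw [e1]
      refine (abs_add_le _ _).trans ?_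
      rw [abs_mul, abs_of_nonneg hr0]
      nlinarith

lemma abs_sum_le_of_unique {ι : Type*} (s : Finset ι) (h : ι → ℝ) {b : ℝ} (hb : 0 ≤ b)
    (hle : ∀ i ∈ s, |h i| ≤ b) (hu : ∀ i ∈ s, ∀ j ∈ s, h i ≠ 0 → h j ≠ 0 → i = j) :
    |∑ i ∈ s, h i| ≤ b := by
  by_cases hz : ∃ i ∈ s, h i ≠ 0
  · obtain ⟨i, hi, hne⟩ := hz
    rw [Finset.sum_eq_single_of_mem i hi]
    · exact hle i hi
    · intro j hj hji
      by_contra h0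
      exact hji (hu j hj i hi h0 hne)
  · push Not at hz
    rw [Finset.sum_eq_zero hz]
    simpa using hb

section Contraction

variable {p : Fin n → Fin n → ℝ} {N : Finset (Finset (Fin n) × Finset (Fin n))}
  {q : Finset (Fin n) × Finset (Fin n) → ℝ} {f : Perm (Fin n) → ℝ} {R : ℝ}

lemma nodeRate_mem {v : Finset (Fin n) × Finset (Fin n)} (h0 : 1 / 2 ≤ q v) (h1 : q v < 1)
    (σ : Perm (Fin n)) (x y : Fin n) : 0 ≤ nodeRate q v σ x y ∧ nodeRate q v σ x y ≤ 1 := by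
  unfold nodeRate
  split_ifs <;> constructor <;> linarith

/-- Matching the moves at a node `u ≠ v` from the two ends of an edge of the node `v`. -/
lemma nodeGen_sub_of_ne (hN : NodeFamily p N) (hq0 : ∀ v ∈ N, 1 / 2 ≤ q v)
    (hq1 : ∀ v ∈ N, q v < 1) (hf : IsLip q N f R) {u v : Finset (Fin n) × Finset (Fin n)}
    (hu : u ∈ N) (hv : v ∈ N) (huv : u ≠ v) {X Y : Fin n} (hX : X ∈ v.1) (hY : Y ∈ v.2)
    {σ : Perm (Fin n)} (hXY : σ⁻¹ X < σ⁻¹ Y) (hc : Consec (span v) σ X Y) :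
    ∃ c : ℝ, 0 ≤ c ∧ c ≤ (u.1 ×ˢ u.2).card ∧
      |nodeGen q f u (swap X Y * σ) - nodeGen q f u σ + c * (f (swap X Y * σ) - f σ)|
        ≤ c * (R * edgeLen q v σ X) := by
  have hXv : X ∈ span v := mem_span.2 (Or.inl hX)
  have hYv : Y ∈ span v := mem_span.2 (Or.inr hY)
  unfold nodeGen
  -- If `u` is below a child of `v` or disjoint from it, the same exchange is made at both ends and
  -- carries the edge to an edge of `v` of equal length, with possibly relabelled ends.
  rcases hN.laminar u hu v hv huv with h | h
  · refine abs_sum_add_le _ _ _ fun z hz => ?_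
    obtain ⟨x, y⟩ := z
    obtain ⟨hx, hy⟩ := Finset.mem_product.1 hz
    have hxu : x ∈ span u := mem_span.2 (Or.inl hx)
    have hyu : y ∈ span u := mem_span.2 (Or.inr hy)
    have hso := hN.sameOrder_of_below hv h hX hY hc
    have hcons := hso.consec_iff hxu hyu
    have hrate : nodeRate q u (swap X Y * σ) x y = nodeRate q u σ x y := by
      unfold nodeRate; simp only [hso x hxu y hyu]
    simp only [nodeTerm, hcons, hrate]
    by_cases hxy : Consec (span u) σ x y
    · obtain ⟨s1, s2⟩ := hN.swap_mem_iff_of_below hv h hxu hyu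
      refine ⟨nodeRate q u σ x y, f (swap x y * (swap X Y * σ)) - f (swap x y * σ),
        (nodeRate_mem (hq0 u hu) (hq1 u hu) σ x y).1,
        (nodeRate_mem (hq0 u hu) (hq1 u hu) σ x y).2, by rw [if_pos hxy, if_pos hxy]; ring, ?_⟩
      have e1 : swap x y * (swap X Y * σ)
          = swap (swap x y X) (swap x y Y) * (swap x y * σ) := by
        rw [← mul_assoc, ← mul_assoc, mul_swap_eq_swap_mul]
      have hl := hf v hv (swap x y X) ((s1 X).2 hX) (swap x y Y) ((s2 Y).2 hY) (swap x y * σ)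
        (by rw [inv_swap_mul, inv_swap_mul, swap_apply_self, swap_apply_self]; exact hXY)
        ((consec_relabel (span_mem_iff s1 s2) σ X Y).2 hc)
      rw [e1]
      refine hl.trans_eq ?_
      unfold edgeLen
      rw [countLeft_relabel s2, countLeft_relabel (span_mem_iff s1 s2), inv_swap_mul,
        swap_apply_self]
    · exact ⟨0, 0, le_rfl, zero_le_one, by simp [hxy], by
        have := (abs_nonneg _).trans (hf v hv X hX Y hY σ hXY hc)
        simpa using this⟩
  · obtain ⟨s1, s2⟩ := hN.swap_mem_iff_of_below hu h hXv hYv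
    -- If instead `v` is below a child of `u` or disjoint from it, the two ends differ by a
    -- relabelling `w` that respects both sides of `u`; the move of `x, y` at one end is matched
    -- with that of `w x, w y` at the other. Moves at `u` keep the order below `v`, hence the
    -- length.
    set w := swap X Y with hw
    have hre : ∑ z ∈ u.1 ×ˢ u.2, nodeTerm q f u (w * σ) z
        = ∑ z ∈ u.1 ×ˢ u.2, nodeTerm q f u (w * σ) (w z.1, w z.2) := by
      refine (Finset.sum_equiv (Equiv.prodCongr w w) (fun z => ?_) fun z _ => rfl).symm
      simp [Finset.mem_product, s1, s2]
    rw [hre]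
    refine abs_sum_add_le _ _ _ fun z hz => ?_
    obtain ⟨x, y⟩ := z
    obtain ⟨hx, hy⟩ := Finset.mem_product.1 hz
    have hcons := consec_relabel (span_mem_iff s1 s2) σ x y
    have hrate : nodeRate q u (w * σ) (w x) (w y) = nodeRate q u σ x y := by
      unfold nodeRate
      simp
    simp only [nodeTerm, hcons, hrate]
    by_cases hxy : Consec (span u) σ x y
    · refine ⟨nodeRate q u σ x y, f (swap (w x) (w y) * (w * σ)) - f (swap x y * σ),
        (nodeRate_mem (hq0 u hu) (hq1 u hu) σ x y).1,
        (nodeRate_mem (hq0 u hu) (hq1 u hu) σ x y).2, by rw [if_pos hxy, if_pos hxy]; ring, ?_⟩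
      have e1 : swap (w x) (w y) * (w * σ) = w * (swap x y * σ) := by
        rw [← mul_assoc, ← mul_assoc, mul_swap_eq_swap_mul w x y]
      have hso := hN.sameOrder_of_below hu h hx hy hxy
      have hl := hf v hv X hX Y hY (swap x y * σ) ((hso X hXv Y hYv).2 hXY)
        ((hso.consec_iff hXv hYv).2 hc)
      rw [e1]
      refine hl.trans_eq ?_
      unfold edgeLen
      rw [hso.countLeft_eq subset_rfl hXv, hso.countLeft_eq Finset.subset_union_right hXv]
    · exact ⟨0, 0, le_rfl, zero_le_one, by simp [hxy], by
        have := (abs_nonneg _).trans (hf v hv X hX Y hY σ hXY hc)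
        simpa using this⟩

end Contraction

end BiasedPerm

/-! ### Neighbouring moves at the node of the edge -/

namespace BiasedPerm

open Equiv

variable {n : ℕ}

section Contraction

variable {p : Fin n → Fin n → ℝ} {N : Finset (Finset (Fin n) × Finset (Fin n))}
  {q : Finset (Fin n) × Finset (Fin n) → ℝ} {f : Perm (Fin n) → ℝ} {R : ℝ}

lemma consec_swap_self {D : Finset (Fin n)} {σ : Perm (Fin n)} {x y : Fin n} (hx : x ∈ D)
    (hy : y ∈ D) (h : Consec D σ x y) : Consec D (swap x y * σ) x y := by
  have := (consec_relabel (swap_mem_iff (S := D) (x := x) (y := y) (iff_of_true hx hy)) σ x y).2 h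
  rw [swap_apply_left, swap_apply_right] at this
  exact this.symm

/-- `z` is the last element of `D` before position `k`. -/
def IsPred (D : Finset (Fin n)) (σ : Perm (Fin n)) (k z : Fin n) : Prop :=
  σ⁻¹ z < k ∧ ∀ c ∈ D, ¬(σ⁻¹ z < σ⁻¹ c ∧ σ⁻¹ c < k)

/-- `z` is the first element of `D` after position `k`. -/
def IsSucc (D : Finset (Fin n)) (σ : Perm (Fin n)) (k z : Fin n) : Prop :=
  k < σ⁻¹ z ∧ ∀ c ∈ D, ¬(k < σ⁻¹ c ∧ σ⁻¹ c < σ⁻¹ z)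

lemma IsPred.unique {D : Finset (Fin n)} {σ : Perm (Fin n)} {k z z' : Fin n}
    (h : IsPred D σ k z) (h' : IsPred D σ k z') (hz : z ∈ D) (hz' : z' ∈ D) : z = z' := by
  apply σ⁻¹.injective
  have h1 := h.2 z' hz'
  have h2 := h'.2 z hz
  have := h.1
  have := h'.1
  grind

lemma IsSucc.unique {D : Finset (Fin n)} {σ : Perm (Fin n)} {k z z' : Fin n}
    (h : IsSucc D σ k z) (h' : IsSucc D σ k z') (hz : z ∈ D) (hz' : z' ∈ D) : z = z' := by
  apply σ⁻¹.injective
  have h1 := h.2 z' hz'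
  have h2 := h'.2 z hz
  have := h.1
  have := h'.1
  grind

lemma inv_swap_mul_of_ne {x y z : Fin n} (hx : z ≠ x) (hy : z ≠ y) (σ : Perm (Fin n)) :
    (swap x y * σ)⁻¹ z = σ⁻¹ z := by
  rw [inv_swap_mul, swap_apply_of_ne_of_ne hx hy]

lemma inv_swap_mul_left (x y : Fin n) (σ : Perm (Fin n)) : (swap x y * σ)⁻¹ x = σ⁻¹ y := by
  rw [inv_swap_mul, swap_apply_left]

lemma inv_swap_mul_right (x y : Fin n) (σ : Perm (Fin n)) : (swap x y * σ)⁻¹ y = σ⁻¹ x := by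
  rw [inv_swap_mul, swap_apply_right]

lemma isPred_of_consec {D : Finset (Fin n)} {σ : Perm (Fin n)} {X Y z : Fin n} (hY : Y ∈ D)
    (hz : z ∈ D) (hXY : σ⁻¹ X < σ⁻¹ Y) (hc : Consec D σ X Y) (hzX : z ≠ X) (hzY : z ≠ Y)
    (h : Consec D σ X z) : IsPred D σ (σ⁻¹ X) z := by
  have h1 : σ⁻¹ z ≠ σ⁻¹ X := fun e => hzX (σ⁻¹.injective e)
  have h2 : σ⁻¹ z ≠ σ⁻¹ Y := fun e => hzY (σ⁻¹.injective e)
  have h3 := hc z hz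
  have h4 := h Y hY
  refine ⟨by grind, fun c hc' => (h c hc').2⟩

lemma isSucc_of_consec {D : Finset (Fin n)} {σ : Perm (Fin n)} {X Y z : Fin n} (hX : X ∈ D)
    (hz : z ∈ D) (hXY : σ⁻¹ X < σ⁻¹ Y) (hc : Consec D σ X Y) (hzX : z ≠ X) (hzY : z ≠ Y)
    (h : Consec D σ z Y) : IsSucc D σ (σ⁻¹ Y) z := by
  have h1 : σ⁻¹ z ≠ σ⁻¹ X := fun e => hzX (σ⁻¹.injective e)
  have h2 : σ⁻¹ z ≠ σ⁻¹ Y := fun e => hzY (σ⁻¹.injective e)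
  have h3 := hc z hz
  have h4 := h X hX
  refine ⟨by grind, fun c hc' => (h c hc').2⟩

lemma IsPred.of_swap {D : Finset (Fin n)} {σ : Perm (Fin n)} {X Y z : Fin n} (hX : X ∈ D)
    (hY : Y ∈ D) (hzX : z ≠ X) (hzY : z ≠ Y)
    (h : IsPred D (swap X Y * σ) (σ⁻¹ X) z) : IsPred D σ (σ⁻¹ X) z := by
  refine ⟨by have := h.1; rwa [inv_swap_mul_of_ne hzX hzY] at this, fun c hc => ?_⟩
  have := h.2 (swap X Y c) ((swap_mem_iff (iff_of_true hX hY) c).2 hc)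
  rwa [inv_swap_mul_of_ne hzX hzY, inv_swap_mul, swap_apply_self] at this

lemma IsSucc.of_swap {D : Finset (Fin n)} {σ : Perm (Fin n)} {X Y z : Fin n} (hX : X ∈ D)
    (hY : Y ∈ D) (hzX : z ≠ X) (hzY : z ≠ Y)
    (h : IsSucc D (swap X Y * σ) (σ⁻¹ Y) z) : IsSucc D σ (σ⁻¹ Y) z := by
  refine ⟨by have := h.1; rwa [inv_swap_mul_of_ne hzX hzY] at this, fun c hc => ?_⟩
  have := h.2 (swap X Y c) ((swap_mem_iff (iff_of_true hX hY) c).2 hc)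
  rwa [inv_swap_mul_of_ne hzX hzY, inv_swap_mul, swap_apply_self] at this

lemma nodeTerm_ne_zero {v : Finset (Fin n) × Finset (Fin n)} {σ : Perm (Fin n)}
    {z : Fin n × Fin n} (h : nodeTerm q f v σ z ≠ 0) : Consec (span v) σ z.1 z.2 := by
  by_contra hc
  exact h (if_neg hc)

lemma abs_nodeTerm_good {v : Finset (Fin n) × Finset (Fin n)} (hv : v ∈ N) (hq1 : q v < 1)
    (hf : IsLip q N f R) {σ : Perm (Fin n)} {x y : Fin n} (hx : x ∈ v.1) (hy : y ∈ v.2)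
    (hxy : σ⁻¹ x < σ⁻¹ y) (hc : Consec (span v) σ x y) :
    |nodeTerm q f v σ (x, y)| ≤ (1 - q v) * (R * edgeLen q v σ x) := by
  rw [nodeTerm, if_pos hc, nodeRate, if_pos hxy, abs_mul, abs_of_pos (by linarith)]
  exact mul_le_mul_of_nonneg_left (hf v hv x hx y hy σ hxy hc) (by linarith)

lemma abs_nodeTerm_bad {v : Finset (Fin n) × Finset (Fin n)} (hv : v ∈ N) (hq0 : 1 / 2 ≤ q v)
    (hf : IsLip q N f R) {σ : Perm (Fin n)} {x y : Fin n} (hx : x ∈ v.1) (hy : y ∈ v.2)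
    (hxy : σ⁻¹ y < σ⁻¹ x) (hc : Consec (span v) σ x y) :
    |nodeTerm q f v σ (x, y)| ≤ q v * (R * edgeLen q v (swap x y * σ) x) := by
  rw [nodeTerm, if_pos hc, nodeRate, if_neg hxy.not_gt, abs_mul, abs_of_nonneg (by linarith)]
  have h1 := hf v hv x hx y hy (swap x y * σ)
    (by rwa [inv_swap_mul_left, inv_swap_mul_right])
    (consec_swap_self (mem_span.2 (Or.inl hx)) (mem_span.2 (Or.inr hy)) hc)
  rw [← mul_assoc, swap_mul_self, one_mul, abs_sub_comm] at h1
  exact mul_le_mul_of_nonneg_left h1 (by linarith)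

/-- The predicate `Q` ("is the neighbour of the edge") holds for at most one element, so at most one
term of the two sums is nonzero and `b` is paid only once. -/
lemma abs_sum_sub_le_of_unique {ι : Type*} [DecidableEq ι] {s t : Finset ι} (hst : Disjoint s t)
    (A B : ι → ℝ) (Q : ι → Prop) {b : ℝ} (hb : 0 ≤ b) (hA : ∀ i ∈ s, A i ≠ 0 → Q i ∧ |A i| ≤ b)
    (hB : ∀ i ∈ t, B i ≠ 0 → Q i ∧ |B i| ≤ b)
    (hQ : ∀ i ∈ s ∪ t, ∀ j ∈ s ∪ t, Q i → Q j → i = j) :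
    |∑ i ∈ s, A i - ∑ i ∈ t, B i| ≤ b := by
  set h : ι → ℝ := fun i => if i ∈ s then A i else - B i with hh
  have hs : ∀ i ∈ s, h i = A i := fun i hi => if_pos hi
  have ht : ∀ i ∈ t, h i = - B i := fun i hi => if_neg fun hi' => Finset.disjoint_left.1 hst hi' hi
  have e : ∑ i ∈ s, A i - ∑ i ∈ t, B i = ∑ i ∈ s ∪ t, h i := by
    rw [Finset.sum_union hst, Finset.sum_congr rfl hs, Finset.sum_congr rfl ht,
      Finset.sum_neg_distrib, sub_eq_add_neg]
  have key : ∀ i ∈ s ∪ t, h i ≠ 0 → Q i ∧ |h i| ≤ b := by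
    intro i hi hne
    rcases Finset.mem_union.1 hi with hi | hi
    · rw [hs i hi] at hne ⊢
      exact hA i hi hne
    · rw [ht i hi] at hne ⊢
      rw [abs_neg]
      exact hB i hi (neg_ne_zero.1 hne)
  rw [e]
  refine abs_sum_le_of_unique _ _ hb (fun i hi => ?_) fun i hi j hj hi0 hj0 =>
    hQ i hi j hj (key i hi hi0).1 (key j hj hj0).1
  by_cases h0 : h i = 0
  · rw [h0, abs_zero]; exact hb
  · exact (key i hi h0).2

/-- The moves of the element preceding an edge, seen from the two ends of the edge. -/
lemma abs_pred_le (hN : NodeFamily p N) (hq0 : ∀ v ∈ N, 1 / 2 ≤ q v)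
    (hq1 : ∀ v ∈ N, q v < 1) (hf : IsLip q N f R) (hR : 0 ≤ R)
    {v : Finset (Fin n) × Finset (Fin n)}
    (hv : v ∈ N) {X Y : Fin n} (hX : X ∈ v.1) (hY : Y ∈ v.2)
    {σ : Perm (Fin n)} (hXY : σ⁻¹ X < σ⁻¹ Y) (hc : Consec (span v) σ X Y) :
    |∑ x ∈ v.1.erase X, nodeTerm q f v (swap X Y * σ) (x, Y)
        - ∑ y ∈ v.2.erase Y, nodeTerm q f v σ (X, y)|
      ≤ (1 - q v) * (R * (((n : ℝ) ^ 2 - (countLeft (span v) σ (σ⁻¹ X) : ℝ) ^ 2) *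
          (q v / (1 - q v)) ^ countLeft v.2 σ (σ⁻¹ X))) := by
  have hq := hq1 v hv
  have hq' := hq0 v hv
  have h1q : 0 < 1 - q v := by linarith
  have hρ : 0 < q v / (1 - q v) := div_pos (by linarith) h1q
  have hρq : q v / (1 - q v) * (1 - q v) = q v := div_mul_cancel₀ _ h1q.ne'
  have hXv : X ∈ span v := mem_span.2 (Or.inl hX)
  have hYv : Y ∈ span v := mem_span.2 (Or.inr hY)
  have hcn : (countLeft (span v) σ (σ⁻¹ X) : ℝ) ≤ n := by
    exact_mod_cast (countLeft_le _ _ _).trans (σ⁻¹ X).2.le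
  have hkne : ∀ k S, k ≤ σ⁻¹ X → countLeft S (swap X Y * σ) k = countLeft S σ k := fun k S hk =>
    countLeft_swap (iff_of_false hk.not_gt (hk.trans hXY.le).not_gt)
  -- At most one leaf below `v` stands directly before the edge. If it is on the left of `v` it can
  -- be exchanged only with `Y`, at the end where `Y` comes first; if it is on the right, only with
  -- `X`, at the other end. Rate times length is the same in both cases.
  refine abs_sum_sub_le_of_unique (Finset.disjoint_left.2 fun z hz hz' =>
    hN.disjoint hv (Finset.mem_of_mem_erase hz) (Finset.mem_of_mem_erase hz')) _ _
    (IsPred (span v) σ (σ⁻¹ X)) ?_ ?_ ?_ ?_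
  · have : 0 ≤ (n : ℝ) ^ 2 - (countLeft (span v) σ (σ⁻¹ X) : ℝ) ^ 2 := by
      nlinarith [Nat.cast_nonneg (α := ℝ) (countLeft (span v) σ (σ⁻¹ X))]
    positivity
  · intro z hz hne
    obtain ⟨hzX, hz⟩ := Finset.mem_erase.1 hz
    have hzY : z ≠ Y := fun e => hN.disjoint hv hz (e ▸ hY)
    have hzv : z ∈ span v := mem_span.2 (Or.inl hz)
    have hcz := nodeTerm_ne_zero hne
    have hp : IsPred (span v) σ (σ⁻¹ X) z := by
      refine IsPred.of_swap hXv hYv hzX hzY ?_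
      have := isPred_of_consec hXv hzv
        (by rwa [inv_swap_mul_left, inv_swap_mul_right]) (consec_swap_self hXv hYv hc).symm
        hzY hzX hcz.symm
      rwa [inv_swap_mul_right] at this
    refine ⟨hp, ?_⟩
    have hpos : (swap X Y * σ)⁻¹ z = σ⁻¹ z := inv_swap_mul_of_ne hzX hzY σ
    refine (abs_nodeTerm_good hv hq hf hz hY
      (by rw [hpos, inv_swap_mul_right]; exact hp.1) hcz).trans_eq ?_
    rw [edgeLen, hpos, hkne _ _ hp.1.le, hkne _ _ hp.1.le,
      countLeft_step subset_rfl hp.1 hp.2, countLeft_step Finset.subset_union_right hp.1 hp.2,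
      if_pos hzv, if_neg (fun h => hN.disjoint hv hz h)]
    push_cast
    ring
  · intro z hz hne
    obtain ⟨hzY, hz⟩ := Finset.mem_erase.1 hz
    have hzX : z ≠ X := fun e => hN.disjoint hv hX (e ▸ hz)
    have hzv : z ∈ span v := mem_span.2 (Or.inr hz)
    have hcz := nodeTerm_ne_zero hne
    have hp : IsPred (span v) σ (σ⁻¹ X) z := isPred_of_consec hYv hzv hXY hc hzX hzY hcz
    refine ⟨hp, (abs_nodeTerm_bad hv hq' hf hX hz hp.1 hcz).trans_eq ?_⟩
    have e : ∀ S, countLeft S (swap X z * σ) (σ⁻¹ z) = countLeft S σ (σ⁻¹ z) := fun S =>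
      countLeft_swap (iff_of_false hp.1.not_gt (lt_irrefl _))
    rw [edgeLen, inv_swap_mul_left, e, e,
      countLeft_step subset_rfl hp.1 hp.2, countLeft_step Finset.subset_union_right hp.1 hp.2,
      if_pos hzv, if_pos hz, pow_succ]
    push_cast
    -- This is `q ρ ^ (m - 1) = (1 - q) ρ ^ m` with `ρ = q / (1 - q)`: the larger rate makes up for
    -- the right leaf `z` that is no longer counted.
    linear_combination (-(R * ((n : ℝ) ^ 2 - (countLeft (span v) σ (σ⁻¹ z) + 1) ^ 2) *
      (q v / (1 - q v)) ^ countLeft v.2 σ (σ⁻¹ z))) * hρq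
  · intro z hz z' hz' h h'
    refine h.unique h' ?_ ?_
    · rcases Finset.mem_union.1 hz with hz | hz
      · exact mem_span.2 (Or.inl (Finset.mem_of_mem_erase hz))
      · exact mem_span.2 (Or.inr (Finset.mem_of_mem_erase hz))
    · rcases Finset.mem_union.1 hz' with hz | hz
      · exact mem_span.2 (Or.inl (Finset.mem_of_mem_erase hz))
      · exact mem_span.2 (Or.inr (Finset.mem_of_mem_erase hz))

/-- The moves of the element following an edge, seen from the two ends of the edge. -/
lemma abs_succ_le (hN : NodeFamily p N) (hq0 : ∀ v ∈ N, 1 / 2 ≤ q v)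
    (hq1 : ∀ v ∈ N, q v < 1) (hf : IsLip q N f R) (hR : 0 ≤ R)
    {v : Finset (Fin n) × Finset (Fin n)}
    (hv : v ∈ N) {X Y : Fin n} (hX : X ∈ v.1) (hY : Y ∈ v.2)
    {σ : Perm (Fin n)} (hXY : σ⁻¹ X < σ⁻¹ Y) (hc : Consec (span v) σ X Y) :
    |∑ y ∈ v.2.erase Y, nodeTerm q f v (swap X Y * σ) (X, y)
        - ∑ x ∈ v.1.erase X, nodeTerm q f v σ (x, Y)|
      ≤ q v * (R * (((n : ℝ) ^ 2 - ((countLeft (span v) σ (σ⁻¹ X) : ℝ) + 2) ^ 2) *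
          (q v / (1 - q v)) ^ countLeft v.2 σ (σ⁻¹ X))) := by
  have hq := hq1 v hv
  have hq' := hq0 v hv
  have h1q : 0 < 1 - q v := by linarith
  have hρ : 0 < q v / (1 - q v) := div_pos (by linarith) h1q
  have hρq : q v / (1 - q v) * (1 - q v) = q v := div_mul_cancel₀ _ h1q.ne'
  have hXv : X ∈ span v := mem_span.2 (Or.inl hX)
  have hYv : Y ∈ span v := mem_span.2 (Or.inr hY)
  have hcn : (countLeft (span v) σ (σ⁻¹ X) : ℝ) + 2 ≤ n := by
    have h1 := countLeft_le (span v) σ (σ⁻¹ X)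
    have h2 : (σ⁻¹ X : ℕ) < (σ⁻¹ Y : ℕ) := hXY
    have h3 := (σ⁻¹ Y).2
    exact_mod_cast (by omega : countLeft (span v) σ (σ⁻¹ X) + 2 ≤ n)
  have hstep : ∀ S ⊆ span v, countLeft S σ (σ⁻¹ Y)
      = countLeft S σ (σ⁻¹ X) + if X ∈ S then 1 else 0 := fun S hS =>
    countLeft_step hS hXY fun c hc' => (hc c hc').1
  have hstep' : ∀ S ⊆ span v, countLeft S (swap X Y * σ) (σ⁻¹ Y)
      = countLeft S σ (σ⁻¹ X) + if Y ∈ S then 1 else 0 := by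
    intro S hS
    have h1 := countLeft_step (σ := swap X Y * σ) (z := Y) (k := σ⁻¹ Y) hS
      (by rw [inv_swap_mul_right]; exact hXY)
      (fun c hc' => by
        have := ((consec_swap_self hXv hYv hc) c hc').2
        rwa [inv_swap_mul_left] at this)
    rw [h1, inv_swap_mul_right, countLeft_swap (iff_of_false (lt_irrefl _) hXY.not_gt)]
  refine abs_sum_sub_le_of_unique (Finset.disjoint_left.2 fun z hz hz' =>
    hN.disjoint hv (Finset.mem_of_mem_erase hz') (Finset.mem_of_mem_erase hz)) _ _
    (IsSucc (span v) σ (σ⁻¹ Y)) ?_ ?_ ?_ ?_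
  · have : 0 ≤ (n : ℝ) ^ 2 - ((countLeft (span v) σ (σ⁻¹ X) : ℝ) + 2) ^ 2 := by
      nlinarith [Nat.cast_nonneg (α := ℝ) (countLeft (span v) σ (σ⁻¹ X))]
    positivity
  · intro z hz hne
    obtain ⟨hzY, hz⟩ := Finset.mem_erase.1 hz
    have hzX : z ≠ X := fun e => hN.disjoint hv hX (e ▸ hz)
    have hzv : z ∈ span v := mem_span.2 (Or.inr hz)
    have hcz := nodeTerm_ne_zero hne
    have hp : IsSucc (span v) σ (σ⁻¹ Y) z := by
      refine IsSucc.of_swap hXv hYv hzX hzY ?_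
      have := isSucc_of_consec hYv hzv
        (by rwa [inv_swap_mul_left, inv_swap_mul_right]) (consec_swap_self hXv hYv hc).symm
        hzY hzX hcz.symm
      rwa [inv_swap_mul_left] at this
    refine ⟨hp, ?_⟩
    have hpos : (swap X Y * σ)⁻¹ z = σ⁻¹ z := inv_swap_mul_of_ne hzX hzY σ
    refine (abs_nodeTerm_good hv hq hf hX hz
      (by rw [hpos, inv_swap_mul_left]; exact hp.1) hcz).trans_eq ?_
    rw [edgeLen, inv_swap_mul_left, hstep' _ subset_rfl, hstep' _ Finset.subset_union_right,
      if_pos hYv, if_pos hY, pow_succ]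
    push_cast
    -- This is `(1 - q) ρ ^ (m + 1) = q ρ ^ m`: now `Y` stands to the left of `X` and is counted,
    -- while the rate is the smaller one.
    linear_combination (R * ((n : ℝ) ^ 2 - (countLeft (span v) σ (σ⁻¹ X) + 2) ^ 2) *
      (q v / (1 - q v)) ^ countLeft v.2 σ (σ⁻¹ X)) * hρq
  · intro z hz hne
    obtain ⟨hzX, hz⟩ := Finset.mem_erase.1 hz
    have hzY : z ≠ Y := fun e => hN.disjoint hv hz (e ▸ hY)
    have hzv : z ∈ span v := mem_span.2 (Or.inl hz)
    have hcz := nodeTerm_ne_zero hne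
    have hp : IsSucc (span v) σ (σ⁻¹ Y) z := isSucc_of_consec hXv hzv hXY hc hzX hzY hcz
    refine ⟨hp, (abs_nodeTerm_bad hv hq' hf hz hY hp.1 hcz).trans_eq ?_⟩
    have e : ∀ S, countLeft S (swap z Y * σ) (σ⁻¹ Y) = countLeft S σ (σ⁻¹ Y) := fun S =>
      countLeft_swap (iff_of_false hp.1.not_gt (lt_irrefl _))
    rw [edgeLen, inv_swap_mul_left, e, e, hstep _ subset_rfl, hstep _ Finset.subset_union_right,
      if_pos hXv, if_neg (fun h => hN.disjoint hv hX h)]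
    push_cast
    ring
  · intro z hz z' hz' h h'
    refine h.unique h' ?_ ?_
    · rcases Finset.mem_union.1 hz with hz | hz
      · exact mem_span.2 (Or.inr (Finset.mem_of_mem_erase hz))
      · exact mem_span.2 (Or.inl (Finset.mem_of_mem_erase hz))
    · rcases Finset.mem_union.1 hz' with hz | hz
      · exact mem_span.2 (Or.inr (Finset.mem_of_mem_erase hz))
      · exact mem_span.2 (Or.inl (Finset.mem_of_mem_erase hz))

end Contraction

end BiasedPerm

/-! ### Contraction of the Lipschitz seminorm -/

namespace BiasedPerm

open Equiv

variable {n : ℕ}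

section Contraction

variable {p : Fin n → Fin n → ℝ} {N : Finset (Finset (Fin n) × Finset (Fin n))}
  {q : Finset (Fin n) × Finset (Fin n) → ℝ} {f : Perm (Fin n) → ℝ} {R : ℝ}

lemma sum_product_split {α β : Type*} [DecidableEq α] [DecidableEq β] {s : Finset α}
    {t : Finset β} {a : α} {b : β} (ha : a ∈ s) (hb : b ∈ t) (g : α × β → ℝ) :
    ∑ z ∈ s ×ˢ t, g z = g (a, b) + ∑ y ∈ t.erase b, g (a, y) + ∑ x ∈ s.erase a, g (x, b)
      + ∑ z ∈ s.erase a ×ˢ t.erase b, g z := by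
  rw [Finset.sum_product, Finset.sum_product, ← Finset.add_sum_erase s _ ha,
    ← Finset.add_sum_erase t _ hb, add_assoc (g (a, b) + _), ← Finset.sum_add_distrib]
  congr 1
  exact Finset.sum_congr rfl fun x _ => (Finset.add_sum_erase t _ hb).symm

lemma countLeft_add_two_le {D : Finset (Fin n)} {σ : Perm (Fin n)} {i j : Fin n} (h : i < j) :
    (countLeft D σ i : ℝ) + 2 ≤ n := by
  have h1 := countLeft_le D σ i
  have h2 : (i : ℕ) < j := h
  have h3 := j.2
  exact_mod_cast (by omega : countLeft D σ i + 2 ≤ n)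

lemma edgeLen_pos {v : Finset (Fin n) × Finset (Fin n)} (h0 : 1 / 2 ≤ q v) (h1 : q v < 1)
    {σ : Perm (Fin n)} {X Y : Fin n} (hXY : σ⁻¹ X < σ⁻¹ Y) : 0 < edgeLen q v σ X := by
  have h2 := countLeft_add_two_le (D := span v) (σ := σ) hXY
  have h3 : 0 < q v / (1 - q v) := div_pos (by linarith) (by linarith)
  have h4 : (0 : ℝ) ≤ countLeft (span v) σ (σ⁻¹ X) := Nat.cast_nonneg _
  exact mul_pos (by nlinarith) (pow_pos h3 _)

/-- Matching the moves at the node `v` from the two ends of an edge of `v`. -/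
lemma nodeGen_sub_self (hN : NodeFamily p N) (hq0 : ∀ v ∈ N, 1 / 2 ≤ q v)
    (hq1 : ∀ v ∈ N, q v < 1) (hf : IsLip q N f R) (hR : 0 ≤ R)
    {v : Finset (Fin n) × Finset (Fin n)} (hv : v ∈ N) {X Y : Fin n} (hX : X ∈ v.1)
    (hY : Y ∈ v.2) {σ : Perm (Fin n)} (hXY : σ⁻¹ X < σ⁻¹ Y) (hc : Consec (span v) σ X Y) :
    ∃ c : ℝ, 0 ≤ c ∧ c ≤ (v.1 ×ˢ v.2).card ∧
      |nodeGen q f v (swap X Y * σ) - nodeGen q f v σ + c * (f (swap X Y * σ) - f σ)|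
        ≤ (c - 1 / (n : ℝ) ^ 2) * (R * edgeLen q v σ X) := by
  have hq := hq1 v hv
  have hq' := hq0 v hv
  have hXv : X ∈ span v := mem_span.2 (Or.inl hX)
  have hYv : Y ∈ span v := mem_span.2 (Or.inr hY)
  have hpred := abs_pred_le hN hq0 hq1 hf hR hv hX hY hXY hc
  have hsucc := abs_succ_le hN hq0 hq1 hf hR hv hX hY hXY hc
  have hmain : ∃ c : ℝ, 0 ≤ c ∧ c ≤ (v.1.erase X ×ˢ v.2.erase Y).card ∧
      |∑ z ∈ v.1.erase X ×ˢ v.2.erase Y, nodeTerm q f v (swap X Y * σ) z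
        - ∑ z ∈ v.1.erase X ×ˢ v.2.erase Y, nodeTerm q f v σ z
        + c * (f (swap X Y * σ) - f σ)| ≤ c * (R * edgeLen q v σ X) := by
    refine abs_sum_add_le _ _ _ fun z hz => ?_
    obtain ⟨x, y⟩ := z
    obtain ⟨hx, hy⟩ := Finset.mem_product.1 hz
    obtain ⟨hxX, hx⟩ := Finset.mem_erase.1 hx
    obtain ⟨hyY, hy⟩ := Finset.mem_erase.1 hy
    have hxv : x ∈ span v := mem_span.2 (Or.inl hx)
    have hyv : y ∈ span v := mem_span.2 (Or.inr hy)
    have hxY : x ≠ Y := fun e => hN.disjoint hv hx (e ▸ hY)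
    have hyX : y ≠ X := fun e => hN.disjoint hv hX (e ▸ hy)
    have hcons := consec_relabel (swap_mem_iff (iff_of_true hXv hYv)) σ x y
    rw [swap_apply_of_ne_of_ne hxX hxY, swap_apply_of_ne_of_ne hyX hyY] at hcons
    have hrate : nodeRate q v (swap X Y * σ) x y = nodeRate q v σ x y := by
      unfold nodeRate
      rw [inv_swap_mul_of_ne hxX hxY, inv_swap_mul_of_ne hyX hyY]
    simp only [nodeTerm, hcons, hrate]
    by_cases hxy : Consec (span v) σ x y
    · refine ⟨nodeRate q v σ x y, f (swap x y * (swap X Y * σ)) - f (swap x y * σ),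
        (nodeRate_mem hq' hq σ x y).1, (nodeRate_mem hq' hq σ x y).2,
        by rw [if_pos hxy, if_pos hxy]; ring, ?_⟩
      have e1 : swap x y * (swap X Y * σ) = swap X Y * (swap x y * σ) := by
        rw [← mul_assoc, ← mul_assoc, mul_swap_eq_swap_mul,
          swap_apply_of_ne_of_ne hxX.symm hyX.symm, swap_apply_of_ne_of_ne hxY.symm hyY.symm]
      have hs := swap_mem_iff (S := span v) (iff_of_true hxv hyv)
      have hcs := (consec_relabel hs σ X Y).2 hc
      rw [swap_apply_of_ne_of_ne hxX.symm hyX.symm,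
        swap_apply_of_ne_of_ne hxY.symm hyY.symm] at hcs
      have hl := hf v hv X hX Y hY (swap x y * σ)
        (by rwa [inv_swap_mul_of_ne hxX.symm hyX.symm, inv_swap_mul_of_ne hxY.symm hyY.symm]) hcs
      rw [e1]
      refine hl.trans_eq ?_
      -- `X` is a leaf below `v` different from the consecutive `x` and `y`, so both lie on one side
      -- of it and their exchange does not change the counts to the left of `X`.
      have hside : σ⁻¹ x < σ⁻¹ X ↔ σ⁻¹ y < σ⁻¹ X := by
        have h1 := hxy X hXv
        have h2 : σ⁻¹ x ≠ σ⁻¹ X := fun h => hxX (σ⁻¹.injective h)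
        have h3 : σ⁻¹ y ≠ σ⁻¹ X := fun h => hyX (σ⁻¹.injective h)
        grind
      unfold edgeLen
      rw [inv_swap_mul_of_ne hxX.symm hyX.symm, countLeft_swap hside, countLeft_swap hside]
    · exact ⟨0, 0, le_rfl, zero_le_one, by simp [hxy], by
        have := (abs_nonneg _).trans (hf v hv X hX Y hY σ hXY hc)
        simpa using this⟩
  obtain ⟨c, hc0, hc1, hcm⟩ := hmain
  refine ⟨c + 1, by positivity, ?_, ?_⟩
  · have h1 := Finset.card_pos.2 ⟨X, hX⟩
    have h2 := Finset.card_pos.2 ⟨Y, hY⟩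
    rw [Finset.card_product, Finset.card_erase_of_mem hX, Finset.card_erase_of_mem hY] at hc1
    rw [Finset.card_product]
    obtain ⟨k, hk⟩ := Nat.exists_eq_add_of_lt h1
    obtain ⟨m, hm⟩ := Nat.exists_eq_add_of_lt h2
    rw [hk, hm] at hc1 ⊢
    simp only [zero_add, Nat.add_sub_cancel] at hc1 ⊢
    push_cast at hc1 ⊢
    nlinarith [Nat.cast_nonneg (α := ℝ) k, Nat.cast_nonneg (α := ℝ) m]
  · have hself : nodeTerm q f v (swap X Y * σ) (X, Y) - nodeTerm q f v σ (X, Y)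
        = -(f (swap X Y * σ) - f σ) := by
      rw [nodeTerm, if_pos (consec_swap_self hXv hYv hc), nodeTerm, if_pos hc, nodeRate,
        if_neg (by rw [inv_swap_mul_left, inv_swap_mul_right]; exact hXY.not_gt), nodeRate,
        if_pos hXY, ← mul_assoc, swap_mul_self, one_mul]
      ring
    unfold nodeGen
    rw [sum_product_split hX hY, sum_product_split hX hY]
    set S1 := ∑ x ∈ v.1.erase X, nodeTerm q f v (swap X Y * σ) (x, Y)
    set S2 := ∑ y ∈ v.2.erase Y, nodeTerm q f v σ (X, y)
    set S3 := ∑ y ∈ v.2.erase Y, nodeTerm q f v (swap X Y * σ) (X, y)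
    set S4 := ∑ x ∈ v.1.erase X, nodeTerm q f v σ (x, Y)
    set S5 := ∑ z ∈ v.1.erase X ×ˢ v.2.erase Y, nodeTerm q f v (swap X Y * σ) z
    set S6 := ∑ z ∈ v.1.erase X ×ˢ v.2.erase Y, nodeTerm q f v σ z
    set a := f (swap X Y * σ) - f σ
    have e1 : nodeTerm q f v (swap X Y * σ) (X, Y) + S3 + S1 + S5
        - (nodeTerm q f v σ (X, Y) + S2 + S4 + S6) + (c + 1) * a
        = (S1 - S2) + (S3 - S4) + (S5 - S6 + c * a) := by linear_combination hself
    rw [e1]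
    refine (abs_add_le _ _).trans ?_
    refine (add_le_add ((abs_add_le _ _).trans (add_le_add hpred hsucc)) hcm).trans ?_
    have h2 := countLeft_add_two_le (D := span v) (σ := σ) hXY
    have hρ : 0 < q v / (1 - q v) := div_pos (by linarith) (by linarith)
    unfold edgeLen
    set k : ℝ := ((countLeft (span v) σ (σ⁻¹ X) : ℕ) : ℝ) with hk
    have hk0 : 0 ≤ k := Nat.cast_nonneg _
    set M := (q v / (1 - q v)) ^ countLeft v.2 σ (σ⁻¹ X)
    have hM : 0 < M := pow_pos hρ _
    have hn : (0 : ℝ) < (n : ℝ) ^ 2 := by nlinarith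
    -- For `q v ≥ 1 / 2` one has `(1 - q v) * k ^ 2 + q v * (k + 2) ^ 2 ≥ (k + 1) ^ 2 + 1`, an
    -- absolute gain of one; the quadratic factor of the length is at most `n ^ 2`, so the relative
    -- gain is at least `1 / n ^ 2`.
    have hkey : (1 - q v) * ((n : ℝ) ^ 2 - k ^ 2) + q v * ((n : ℝ) ^ 2 - (k + 2) ^ 2)
        ≤ (1 - 1 / (n : ℝ) ^ 2) * ((n : ℝ) ^ 2 - (k + 1) ^ 2) := by
      have h5 : 1 / (n : ℝ) ^ 2 * ((n : ℝ) ^ 2 - (k + 1) ^ 2) ≤ 1 := by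
        rw [one_div, inv_mul_le_iff₀ hn]
        nlinarith
      nlinarith
    have := mul_le_mul_of_nonneg_left hkey (mul_nonneg hR hM.le)
    linarith

/-- One step of the (lazy) dynamics of all nodes. -/
noncomputable def treeStep (q : Finset (Fin n) × Finset (Fin n) → ℝ)
    (N : Finset (Finset (Fin n) × Finset (Fin n))) (δ : ℝ) (f : Perm (Fin n) → ℝ)
    (σ : Perm (Fin n)) : ℝ :=
  f σ + δ * ∑ v ∈ N, nodeGen q f v σ

/-- Path coupling in dual form: with `C` the total matched rate, the edge keeps the part `1 - δ * C`
of its difference and receives at most `δ * (C - 1 / n ^ 2)` times `R` times its length. The bound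
on `δ` makes the first coefficient nonnegative. -/
lemma isLip_treeStep (hN : NodeFamily p N) (hq0 : ∀ v ∈ N, 1 / 2 ≤ q v)
    (hq1 : ∀ v ∈ N, q v < 1) (hf : IsLip q N f R) {δ : ℝ} (hδ : 0 ≤ δ)
    (hδ1 : δ * ∑ v ∈ N, ((v.1 ×ˢ v.2).card : ℝ) ≤ 1) :
    IsLip q N (treeStep q N δ f) ((1 - δ / (n : ℝ) ^ 2) * R) := by
  intro v hv X hX Y hY σ hXY hc
  have hl := hf v hv X hX Y hY σ hXY hc
  have hd := edgeLen_pos (hq0 v hv) (hq1 v hv) hXY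
  have hR : 0 ≤ R := nonneg_of_mul_nonneg_left ((abs_nonneg _).trans hl) hd
  have hex : ∀ u ∈ N, ∃ c : ℝ, 0 ≤ c ∧ c ≤ (u.1 ×ˢ u.2).card ∧
      |nodeGen q f u (swap X Y * σ) - nodeGen q f u σ + c * (f (swap X Y * σ) - f σ)|
        ≤ (c - if u = v then 1 / (n : ℝ) ^ 2 else 0) * (R * edgeLen q v σ X) := by
    intro u hu
    by_cases huv : u = v
    · subst huv
      rw [if_pos rfl]
      exact nodeGen_sub_self hN hq0 hq1 hf hR hv hX hY hXY hc
    · rw [if_neg huv]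
      simp only [sub_zero]
      exact nodeGen_sub_of_ne hN hq0 hq1 hf hu hv huv hX hY hXY hc
  choose! c hc0 hc1 hcm using hex
  set a := f (swap X Y * σ) - f σ with ha
  set E := R * edgeLen q v σ X with hE
  set C := ∑ u ∈ N, c u with hC
  have hC0 : 0 ≤ C := Finset.sum_nonneg hc0
  have hC1 : δ * C ≤ 1 :=
    (mul_le_mul_of_nonneg_left (Finset.sum_le_sum hc1) hδ).trans hδ1
  have hsum : |∑ u ∈ N, nodeGen q f u (swap X Y * σ) - ∑ u ∈ N, nodeGen q f u σ + C * a|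
      ≤ (C - 1 / (n : ℝ) ^ 2) * E := by
    rw [hC, Finset.sum_mul, ← Finset.sum_sub_distrib, ← Finset.sum_add_distrib]
    refine (Finset.abs_sum_le_sum_abs _ _).trans ((Finset.sum_le_sum hcm).trans_eq ?_)
    rw [← Finset.sum_mul, Finset.sum_sub_distrib, Finset.sum_ite_eq' N v, if_pos hv]
  have e1 : treeStep q N δ f (swap X Y * σ) - treeStep q N δ f σ = (1 - δ * C) * a
      + δ * (∑ u ∈ N, nodeGen q f u (swap X Y * σ) - ∑ u ∈ N, nodeGen q f u σ + C * a) := by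
    unfold treeStep
    rw [ha]
    ring
  rw [e1]
  refine (abs_add_le _ _).trans ?_
  rw [abs_mul, abs_mul, abs_of_nonneg hδ, abs_of_nonneg (by linarith : 0 ≤ 1 - δ * C)]
  calc (1 - δ * C) * |a| + δ * _ ≤ (1 - δ * C) * E + δ * ((C - 1 / (n : ℝ) ^ 2) * E) :=
        add_le_add (mul_le_mul_of_nonneg_left hl (by linarith))
          (mul_le_mul_of_nonneg_left hsum hδ)
    _ = _ := by rw [hE]; ring

end Contraction

end BiasedPerm

/-! ### Dirichlet form and Poincaré inequality of the node dynamics -/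

namespace BiasedPerm

open Equiv

variable {n : ℕ}

section Poincare

variable {p : Fin n → Fin n → ℝ} {N : Finset (Finset (Fin n) × Finset (Fin n))}
  {q : Finset (Fin n) × Finset (Fin n) → ℝ} {W : Perm (Fin n) → ℝ}

lemma sum_mul_sub_eq_neg_half (s : Perm (Fin n)) (hs : s * s = 1) (w f g : Perm (Fin n) → ℝ)
    (hw : ∀ σ, w (s * σ) = w σ) :
    ∑ σ, w σ * (g σ * (f (s * σ) - f σ))
      = -(1 / 2) * ∑ σ, w σ * ((g (s * σ) - g σ) * (f (s * σ) - f σ)) := by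
  have h1 : ∑ σ, w σ * (g σ * (f (s * σ) - f σ))
      = ∑ σ, w σ * (g (s * σ) * (f σ - f (s * σ))) := by
    rw [← Equiv.sum_comp (Equiv.mulLeft s)]
    refine Finset.sum_congr rfl fun σ _ => ?_
    simp only [Equiv.coe_mulLeft, ← mul_assoc, hs, one_mul, hw]
  have h2 : ∑ σ, w σ * ((g (s * σ) - g σ) * (f (s * σ) - f σ))
      = -∑ σ, w σ * (g (s * σ) * (f σ - f (s * σ))) - ∑ σ, w σ * (g σ * (f (s * σ) - f σ)) := by
    rw [← Finset.sum_neg_distrib, ← Finset.sum_sub_distrib]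
    exact Finset.sum_congr rfl fun σ _ => by ring
  rw [h2, ← h1]
  ring

/-- The weights are reversible for the moves at all nodes. -/
def NodeReversible (q : Finset (Fin n) × Finset (Fin n) → ℝ)
    (N : Finset (Finset (Fin n) × Finset (Fin n))) (W : Perm (Fin n) → ℝ) : Prop :=
  ∀ v ∈ N, ∀ x ∈ v.1, ∀ y ∈ v.2, ∀ σ : Perm (Fin n), Consec (span v) σ x y →
    W (swap x y * σ) * nodeRate q v (swap x y * σ) x y = W σ * nodeRate q v σ x y

/-- The conductance of the move exchanging `z.1` and `z.2` at the node `v`. -/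
noncomputable def conductance (q : Finset (Fin n) × Finset (Fin n) → ℝ) (W : Perm (Fin n) → ℝ)
    (v : Finset (Fin n) × Finset (Fin n)) (z : Fin n × Fin n) (σ : Perm (Fin n)) : ℝ :=
  if Consec (span v) σ z.1 z.2 then W σ * nodeRate q v σ z.1 z.2 else 0

/-- The Dirichlet form of the dynamics of all nodes. -/
noncomputable def treeForm (q : Finset (Fin n) × Finset (Fin n) → ℝ)
    (N : Finset (Finset (Fin n) × Finset (Fin n))) (W f g : Perm (Fin n) → ℝ) : ℝ :=
  1 / 2 * ∑ v ∈ N, ∑ z ∈ v.1 ×ˢ v.2, ∑ σ, conductance q W v z σ *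
    ((g (swap z.1 z.2 * σ) - g σ) * (f (swap z.1 z.2 * σ) - f σ))

lemma treeForm_comm (f g : Perm (Fin n) → ℝ) : treeForm q N W f g = treeForm q N W g f := by
  unfold treeForm
  simp only [mul_comm]

lemma conductance_swap (hW : NodeReversible q N W) {v : Finset (Fin n) × Finset (Fin n)}
    (hv : v ∈ N) {z : Fin n × Fin n} (hz : z ∈ v.1 ×ˢ v.2) (σ : Perm (Fin n)) :
    conductance q W v z (swap z.1 z.2 * σ) = conductance q W v z σ := by
  obtain ⟨h1, h2⟩ := Finset.mem_product.1 hz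
  have hi : Consec (span v) (swap z.1 z.2 * σ) z.1 z.2 ↔ Consec (span v) σ z.1 z.2 := by
    refine ⟨fun h => ?_, consec_swap_self (mem_span.2 (Or.inl h1)) (mem_span.2 (Or.inr h2))⟩
    have := consec_swap_self (mem_span.2 (Or.inl h1)) (mem_span.2 (Or.inr h2)) h
    rwa [← mul_assoc, swap_mul_self, one_mul] at this
  unfold conductance
  simp only [hi]
  split_ifs with h
  · exact hW v hv z.1 h1 z.2 h2 σ h
  · rfl

lemma sum_mul_nodeGen (hW : NodeReversible q N W) (f g : Perm (Fin n) → ℝ) :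
    ∑ σ, W σ * (g σ * ∑ v ∈ N, nodeGen q f v σ) = -treeForm q N W f g := by
  have h1 : ∑ σ, W σ * (g σ * ∑ v ∈ N, nodeGen q f v σ)
      = ∑ v ∈ N, ∑ z ∈ v.1 ×ˢ v.2, ∑ σ, conductance q W v z σ *
          (g σ * (f (swap z.1 z.2 * σ) - f σ)) := by
    simp only [nodeGen, Finset.mul_sum]
    rw [Finset.sum_comm]
    refine Finset.sum_congr rfl fun v _ => ?_
    rw [Finset.sum_comm]
    refine Finset.sum_congr rfl fun z _ => Finset.sum_congr rfl fun σ _ => ?_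
    unfold nodeTerm conductance
    split_ifs
    · ring
    · simp
  rw [h1, treeForm, ← neg_mul, Finset.mul_sum]
  refine Finset.sum_congr rfl fun v hv => ?_
  rw [Finset.mul_sum]
  refine Finset.sum_congr rfl fun z hz => ?_
  exact sum_mul_sub_eq_neg_half _ (swap_mul_self _ _) _ _ _ (conductance_swap hW hv hz)

lemma sum_mul_treeStep (hW : NodeReversible q N W) (δ : ℝ) (f g : Perm (Fin n) → ℝ) :
    ∑ σ, W σ * (g σ * treeStep q N δ f σ)
      = ∑ σ, W σ * (g σ * f σ) - δ * treeForm q N W f g := by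
  have h := sum_mul_nodeGen hW f g
  have : δ * treeForm q N W f g = -∑ σ, δ * (W σ * (g σ * ∑ v ∈ N, nodeGen q f v σ)) := by
    rw [← Finset.mul_sum, h]; ring
  rw [this, sub_neg_eq_add, ← Finset.sum_add_distrib]
  refine Finset.sum_congr rfl fun σ _ => ?_
  unfold treeStep
  ring

lemma exists_isLip (hq0 : ∀ v ∈ N, 1 / 2 ≤ q v) (hq1 : ∀ v ∈ N, q v < 1)
    (f : Perm (Fin n) → ℝ) : ∃ R, 0 ≤ R ∧ IsLip q N f R := by
  obtain ⟨R, hR⟩ := (Set.finite_range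
    fun t : (Finset (Fin n) × Finset (Fin n)) × Fin n × Fin n × Perm (Fin n) =>
      |f (swap t.2.1 t.2.2.1 * t.2.2.2) - f t.2.2.2| / edgeLen q t.1 t.2.2.2 t.2.1).bddAbove
  refine ⟨max R 0, le_max_right _ _, fun v hv x _ y _ σ hxy _ => ?_⟩
  have hd := edgeLen_pos (hq0 v hv) (hq1 v hv) hxy
  rw [← div_le_iff₀ hd]
  exact (hR ⟨(v, x, y, σ), rfl⟩).trans (le_max_left _ _)

/-- Values at `σ` and `τ` differ by at most a constant times the Lipschitz constant. -/
def LipConnected (q : Finset (Fin n) × Finset (Fin n) → ℝ)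
    (N : Finset (Finset (Fin n) × Finset (Fin n))) (σ τ : Perm (Fin n)) : Prop :=
  ∃ C : ℝ, ∀ f R, IsLip q N f R → |f σ - f τ| ≤ C * R

lemma LipConnected.trans {σ τ υ : Perm (Fin n)} (h : LipConnected q N σ τ)
    (h' : LipConnected q N τ υ) : LipConnected q N σ υ := by
  obtain ⟨C, hC⟩ := h
  obtain ⟨C', hC'⟩ := h'
  refine ⟨C + C', fun f R hf => ?_⟩
  rw [add_mul]
  exact (abs_sub_le _ _ _).trans (add_le_add (hC f R hf) (hC' f R hf))

lemma NodeFamily.lipConnected_swap (hN : NodeFamily p N) {σ : Perm (Fin n)} {a b : Fin n}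
    (hab : (b : ℕ) = a + 1) : LipConnected q N σ (swap (σ a) (σ b) * σ) := by
  have hc : ∀ D, Consec D σ (σ a) (σ b) := by
    intro D z _
    simp only [Perm.inv_def, symm_apply_apply, Fin.lt_def]
    omega
  have hlt : a < b := by rw [Fin.lt_def]; omega
  rcases lt_trichotomy (σ a) (σ b) with h | h | h
  · obtain ⟨v, hv, h1, h2⟩ := hN.sep _ _ h
    refine ⟨edgeLen q v σ (σ a), fun f R hf => ?_⟩
    rw [abs_sub_comm, mul_comm]
    exact hf v hv _ h1 _ h2 σ (by simpa using hlt) (hc _)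
  · exact absurd (σ.injective h) hlt.ne
  · obtain ⟨v, hv, h1, h2⟩ := hN.sep _ _ h
    refine ⟨edgeLen q v (swap (σ b) (σ a) * σ) (σ b), fun f R hf => ?_⟩
    have := hf v hv _ h1 _ h2 (swap (σ b) (σ a) * σ)
      (by rw [inv_swap_mul_left, inv_swap_mul_right]; simpa using hlt)
      (consec_swap_self (mem_span.2 (Or.inl h1)) (mem_span.2 (Or.inr h2)) (hc _).symm)
    rw [← mul_assoc, swap_mul_self, one_mul, mul_comm R] at this
    rwa [swap_comm]

/-- Adjacent transpositions generate the symmetric group, and exchanging two neighbours is an edge,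
in one direction or the other, of the node that separates them. -/
lemma NodeFamily.lipConnected (hN : NodeFamily p N) (σ τ : Perm (Fin n)) :
    LipConnected q N σ τ := by
  suffices h : ∀ π : Perm (Fin n), ∀ σ, LipConnected q N σ (σ * π) by
    simpa using h (σ⁻¹ * τ) σ
  cases n with
  | zero => intro π σ; rw [Subsingleton.elim π 1, mul_one]; exact ⟨0, by simp⟩
  | succ m =>
    intro π
    have hπ : π ∈ Submonoid.closure (Set.range fun i : Fin m => swap i.castSucc i.succ) := by
      rw [Perm.mclosure_swap_castSucc_succ]; trivial
    induction hπ using Submonoid.closure_induction with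
    | mem x hx =>
      obtain ⟨i, rfl⟩ := hx
      intro σ
      have := hN.lipConnected_swap (q := q) (σ := σ) (a := i.castSucc) (b := i.succ) (by simp)
      rwa [← mul_swap_eq_swap_mul] at this
    | one => intro σ; rw [mul_one]; exact ⟨0, by simp⟩
    | mul x y _ _ hx hy =>
      intro σ
      rw [← mul_assoc]
      exact (hx σ).trans (hy _)

lemma exists_small_step {M : ℝ} (hM : 0 ≤ M) : ∃ δ : ℝ, 0 < δ ∧ δ * M ≤ 1 ∧ δ ≤ 1 := by
  refine ⟨1 / (M + 1), by positivity, ?_, ?_⟩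
  · rw [one_div, inv_mul_le_iff₀ (by linarith)]; linarith
  · rw [div_le_one (by linarith)]; linarith

/-- The Poincaré inequality for the dynamics of all nodes. -/
lemma NodeFamily.poincare (hN : NodeFamily p N) (hn : 2 ≤ n) (hq0 : ∀ v ∈ N, 1 / 2 ≤ q v)
    (hq1 : ∀ v ∈ N, q v < 1) (hWpos : ∀ σ, 0 < W σ) (hW : NodeReversible q N W)
    (f : Perm (Fin n) → ℝ) (hf : ∑ σ, W σ * f σ = 0) :
    ∑ σ, W σ * f σ ^ 2 ≤ (n : ℝ) ^ 2 * treeForm q N W f f := by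
  -- Any `δ` small enough to make `isLip_treeStep` applicable will do: it cancels from the final
  -- inequality.
  obtain ⟨δ, hδ0, hδM, hδ1⟩ := exists_small_step
    (Finset.sum_nonneg fun v (_ : v ∈ N) => Nat.cast_nonneg (α := ℝ) (v.1 ×ˢ v.2).card)
  have hn2 : (2 : ℝ) ≤ n := by exact_mod_cast hn
  have hn4 : (1 : ℝ) < (n : ℝ) ^ 2 := by nlinarith
  have hθ : 0 < 1 - δ / (n : ℝ) ^ 2 := by
    rw [sub_pos, div_lt_one (by linarith)]; linarith
  choose C hC using fun t : Perm (Fin n) × Perm (Fin n) => hN.lipConnected (q := q) t.1 t.2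
  obtain ⟨B, hB⟩ := (Set.finite_range C).bddAbove
  have key := quadratic_form_le_of_contraction hWpos (treeStep q N δ)
    (fun f g => by
      have h1 := sum_mul_treeStep hW δ f g
      have h2 := sum_mul_treeStep hW δ g f
      rw [treeForm_comm] at h2
      have e1 : ∑ σ, W σ * (treeStep q N δ f σ * g σ) = ∑ σ, W σ * (g σ * treeStep q N δ f σ) :=
        Finset.sum_congr rfl fun σ _ => by ring
      have e2 : ∑ σ, W σ * (g σ * f σ) = ∑ σ, W σ * (f σ * g σ) :=
        Finset.sum_congr rfl fun σ _ => by ring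
      rw [e1, h1, h2, e2])
    (fun f => by
      have h1 := sum_mul_treeStep hW δ f (fun _ => 1)
      have h2 : treeForm q N W f (fun _ => 1) = 0 := by simp [treeForm]
      rw [h2, mul_zero, sub_zero] at h1
      simpa using h1)
    (fun f R => 0 ≤ R ∧ IsLip q N f R) hθ
    (fun f => exists_isLip hq0 hq1 f)
    (fun f R h => ⟨mul_nonneg hθ.le h.1, isLip_treeStep hN hq0 hq1 h.2 hδ0.le hδM⟩)
    (C := B)
    (fun f R h σ τ => (hC (σ, τ) f R h.2).trans
      (mul_le_mul_of_nonneg_right (hB ⟨_, rfl⟩) h.1))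
    f hf
  rw [sum_mul_treeStep hW δ f f] at key
  have e : ∑ σ, W σ * (f σ * f σ) = ∑ σ, W σ * f σ ^ 2 :=
    Finset.sum_congr rfl fun σ _ => by ring
  rw [e] at key
  have h3 : δ * ((∑ σ, W σ * f σ ^ 2) / (n : ℝ) ^ 2) ≤ δ * treeForm q N W f f := by
    have : δ * ((∑ σ, W σ * f σ ^ 2) / (n : ℝ) ^ 2)
        = δ / (n : ℝ) ^ 2 * ∑ σ, W σ * f σ ^ 2 := by ring
    rw [this]
    linarith
  have h4 := le_of_mul_le_mul_left h3 hδ0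
  rwa [div_le_iff₀ (by linarith), mul_comm] at h4

end Poincare

end BiasedPerm

/-! ### The weights under exchanges -/

namespace BiasedPerm

open Equiv

variable {n : ℕ}

section Weight

variable {p : Fin n → Fin n → ℝ}

lemma weight_eq_prod_filter (p : Fin n → Fin n → ℝ) (σ : Perm (Fin n)) :
    weight p σ = ∏ z ∈ (Finset.univ : Finset (Fin n × Fin n)).filter (fun z => z.1 < z.2),
      p (σ z.1) (σ z.2) := by
  unfold weight
  rw [Finset.prod_filter, ← Finset.univ_product_univ, Finset.prod_product]
  refine Finset.prod_congr rfl fun i _ => ?_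
  rw [← Finset.prod_filter]
  refine Finset.prod_congr ?_ fun _ _ => rfl
  ext j
  simp

lemma weight_pos (hp : ∀ i j, i ≠ j → 0 < p i j) (σ : Perm (Fin n)) : 0 < weight p σ := by
  rw [weight_eq_prod_filter]
  refine Finset.prod_pos fun z hz => hp _ _ fun h => ?_
  exact (Finset.mem_filter.1 hz).2.ne (σ.injective h)

lemma swap_lt_swap_of_adjacent {a b : Fin n} (hab : (b : ℕ) = a + 1) {i j : Fin n} (hij : i < j)
    (hne : ¬(i = a ∧ j = b)) : swap a b i < swap a b j := by
  simp only [swap_apply_def]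
  simp only [Fin.lt_def, Fin.ext_iff] at *
  split_ifs <;> omega

/-- Exchanging the elements at adjacent positions changes one factor of the weight. -/
lemma weight_mul_swap {a b : Fin n} (hab : (b : ℕ) = a + 1) (σ : Perm (Fin n)) :
    weight p (σ * swap a b) * p (σ a) (σ b) = weight p σ * p (σ b) (σ a) := by
  have hlt : a < b := by rw [Fin.lt_def]; omega
  have hmem : (a, b) ∈ (Finset.univ : Finset (Fin n × Fin n)).filter (fun z => z.1 < z.2) := by
    simpa using hlt
  rw [weight_eq_prod_filter, weight_eq_prod_filter, ← Finset.mul_prod_erase _ _ hmem,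
    ← Finset.mul_prod_erase _ _ hmem]
  -- Exchanging two adjacent positions permutes all the other ordered pairs of positions and
  -- reverses only `(a, b)`.
  have key : ∏ z ∈ ((Finset.univ : Finset (Fin n × Fin n)).filter (fun z => z.1 < z.2)).erase
        (a, b), p ((σ * swap a b) z.1) ((σ * swap a b) z.2)
      = ∏ z ∈ ((Finset.univ : Finset (Fin n × Fin n)).filter (fun z => z.1 < z.2)).erase
        (a, b), p (σ z.1) (σ z.2) := by
    have hmap : ∀ z ∈ ((Finset.univ : Finset (Fin n × Fin n)).filter
        (fun z => z.1 < z.2)).erase (a, b), (swap a b z.1, swap a b z.2) ∈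
        ((Finset.univ : Finset (Fin n × Fin n)).filter (fun z => z.1 < z.2)).erase (a, b) := by
      rintro ⟨i, j⟩ hz
      simp only [Finset.mem_erase, Finset.mem_filter, Finset.mem_univ, true_and, ne_eq,
        Prod.mk.injEq] at hz ⊢
      refine ⟨fun h => ?_, swap_lt_swap_of_adjacent hab hz.2 hz.1⟩
      have h1 : i = b := by rw [← swap_apply_self a b i, h.1, swap_apply_left]
      have h2 : j = a := by rw [← swap_apply_self a b j, h.2, swap_apply_right]
      rw [h1, h2] at hz
      exact hz.2.not_gt hlt
    refine Finset.prod_nbij' (fun z => (swap a b z.1, swap a b z.2))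
      (fun z => (swap a b z.1, swap a b z.2)) hmap hmap ?_ ?_ ?_ <;> simp
  rw [key]
  simp only [Perm.mul_apply, swap_apply_left, swap_apply_right]
  ring

/-- Exchanging two elements that compare in the same way with everything between them changes one
factor of the weight. -/
lemma weight_mul_swap_of_flat (hp : ∀ i j, i ≠ j → 0 < p i j) (d : ℕ) :
    ∀ (a b : Fin n), (b : ℕ) = a + 1 + d → ∀ σ : Perm (Fin n),
      (∀ c, a < c → c < b → p (σ a) (σ c) = p (σ b) (σ c) ∧ p (σ c) (σ a) = p (σ c) (σ b)) →
      weight p (σ * swap a b) * p (σ a) (σ b) = weight p σ * p (σ b) (σ a) := by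
  induction d with
  | zero => exact fun a b hab σ _ => weight_mul_swap hab σ
  | succ d ih =>
    intro a b hab σ hflat
    have hb' : (b : ℕ) - 1 < n := by omega
    set b' : Fin n := ⟨b - 1, hb'⟩ with hbdef
    have hbv : (b' : ℕ) = b - 1 := rfl
    have hab' : a < b' := by rw [Fin.lt_def]; omega
    have hb'b : b' < b := by rw [Fin.lt_def]; omega
    have hadj : (b : ℕ) = b' + 1 := by omega
    have hanb : a ≠ b := (hab'.trans hb'b).ne
    obtain ⟨hf1, hf2⟩ := hflat b' hab' hb'b
    have h1 := weight_mul_swap (p := p) hadj σ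
    have h2 := ih a b' (by omega) (σ * swap b' b) (fun c hac hcb => by
      have hcb' : c ≠ b := (hcb.trans hb'b).ne
      simp only [Perm.mul_apply, swap_apply_left, swap_apply_of_ne_of_ne hab'.ne hanb,
        swap_apply_of_ne_of_ne hcb.ne hcb']
      exact hflat c hac (hcb.trans hb'b))
    have h3 := weight_mul_swap (p := p) hadj (σ * swap b' b * swap a b')
    -- The exchange is a conjugate of the shorter one. The element at `b'` is passed once by `σ b`
    -- and once by `σ a`; since it compares alike with both, the two factors cancel.
    have e : σ * swap b' b * swap a b' * swap b' b = σ * swap a b := by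
      rw [mul_assoc, mul_assoc, ← mul_assoc (swap b' b),
        swap_mul_swap_mul_swap hab'.ne hanb, swap_comm]
    rw [e] at h3
    simp only [Perm.mul_apply, swap_apply_left, swap_apply_right,
      swap_apply_of_ne_of_ne hab'.ne hanb, swap_apply_of_ne_of_ne hanb.symm hb'b.ne'] at h2 h3
    have hz1 : 0 < p (σ a) (σ b') := hp _ _ fun h => hab'.ne (σ.injective h)
    have hz2 : 0 < p (σ b') (σ a) := hp _ _ fun h => hab'.ne' (σ.injective h)
    rw [← hf1, ← hf2] at h1
    refine mul_right_cancel₀ (mul_pos hz1 hz2).ne' ?_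
    calc weight p (σ * swap a b) * p (σ a) (σ b) * (p (σ a) (σ b') * p (σ b') (σ a))
        = weight p (σ * swap a b) * p (σ a) (σ b') * (p (σ a) (σ b) * p (σ b') (σ a)) := by ring
      _ = weight p (σ * swap b' b * swap a b') * p (σ a) (σ b) *
            (p (σ b') (σ a) * p (σ b') (σ a)) := by rw [h3]; ring
      _ = weight p (σ * swap b' b) * p (σ b') (σ a) * (p (σ b) (σ a) * p (σ b') (σ a)) := by
            rw [h2]; ring
      _ = _ := by rw [h1]; ring

end Weight

end BiasedPerm

/-! ### Sweeps of adjacent exchanges and their effect on the weight -/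

namespace BiasedPerm

open Equiv

variable {n : ℕ} [NeZero n]

/-- The exchange of the positions `r` and `r + 1`. -/
def adjSwap (n : ℕ) [NeZero n] (r : ℕ) : Perm (Fin n) := swap (Fin.ofNat n r) (Fin.ofNat n (r + 1))

/-- The element at position `r`. -/
def elt (σ : Perm (Fin n)) (r : ℕ) : Fin n := σ (Fin.ofNat n r)

/-- Positions are natural numbers read modulo `n`, so that `r + 1` always makes sense; bounds such
as `r + 1 < n` exclude wrapping around. -/
lemma ofNat_val {r : ℕ} (h : r < n) : (Fin.ofNat n r : ℕ) = r := Nat.mod_eq_of_lt h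

lemma ofNat_inj {i j : ℕ} (hi : i < n) (hj : j < n) (h : Fin.ofNat n i = Fin.ofNat n j) :
    i = j := by
  have := congrArg Fin.val h
  rwa [ofNat_val hi, ofNat_val hj] at this

lemma elt_inj {σ : Perm (Fin n)} {i j : ℕ} (hi : i < n) (hj : j < n) (h : elt σ i = elt σ j) :
    i = j := ofNat_inj hi hj (σ.injective h)

lemma elt_mul (w σ : Perm (Fin n)) (r : ℕ) : elt (w * σ) r = w (elt σ r) := rfl

lemma elt_adjSwap_left (σ : Perm (Fin n)) (r : ℕ) :
    elt (σ * adjSwap n r) r = elt σ (r + 1) := by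
  simp [elt, adjSwap]

lemma elt_adjSwap_right (σ : Perm (Fin n)) (r : ℕ) :
    elt (σ * adjSwap n r) (r + 1) = elt σ r := by
  simp [elt, adjSwap]

lemma elt_adjSwap_of_ne (σ : Perm (Fin n)) {r j : ℕ} (hr : r + 1 < n) (hj : j < n) (h1 : j ≠ r)
    (h2 : j ≠ r + 1) : elt (σ * adjSwap n r) j = elt σ j := by
  unfold elt adjSwap
  rw [Perm.mul_apply, swap_apply_of_ne_of_ne]
  · exact fun h => h1 (ofNat_inj hj (by omega) h)
  · exact fun h => h2 (ofNat_inj hj hr h)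

lemma adjSwap_mul_self (r : ℕ) : adjSwap n r * adjSwap n r = 1 := swap_mul_self _ _

lemma mul_adjSwap_cancel (σ : Perm (Fin n)) (r : ℕ) : σ * adjSwap n r * adjSwap n r = σ := by
  rw [mul_assoc, adjSwap_mul_self, mul_one]

/-- The elements at the positions from `lo` to `hi`. -/
def window (lo hi : ℕ) (σ : Perm (Fin n)) : Finset (Fin n) :=
  (Finset.Icc lo hi).image (elt σ)

lemma mem_window {lo hi : ℕ} {σ : Perm (Fin n)} {c : Fin n} :
    c ∈ window lo hi σ ↔ ∃ j, lo ≤ j ∧ j ≤ hi ∧ elt σ j = c := by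
  simp [window, and_assoc]

lemma window_adjSwap {lo hi r : ℕ} (h1 : lo ≤ r) (h2 : r + 1 ≤ hi) (h3 : hi < n)
    (σ : Perm (Fin n)) : window lo hi (σ * adjSwap n r) = window lo hi σ := by
  have key : ∀ τ : Perm (Fin n), window lo hi τ ⊆ window lo hi (τ * adjSwap n r) := by
    intro τ c hc
    obtain ⟨j, hj1, hj2, rfl⟩ := mem_window.1 hc
    by_cases hjr : j = r
    · exact mem_window.2 ⟨r + 1, by omega, h2, by rw [elt_adjSwap_right, hjr]⟩
    by_cases hjr' : j = r + 1
    · exact mem_window.2 ⟨r, h1, by omega, by rw [elt_adjSwap_left, hjr']⟩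
    · exact mem_window.2 ⟨j, hj1, hj2, elt_adjSwap_of_ne τ (by omega) (by omega) hjr hjr'⟩
  refine Finset.Subset.antisymm ?_ (key σ)
  have := key (σ * adjSwap n r)
  rwa [mul_adjSwap_cancel] at this

/-- Going from left to right through the positions `a, a + 1, …, a + k`, every element of `S`
is exchanged with its left neighbour. -/
def sweepRight (S : Finset (Fin n)) (a : ℕ) : ℕ → Perm (Fin n) → Perm (Fin n)
  | 0, σ => σ
  | k + 1, σ => if elt (sweepRight S a k σ) (a + k + 1) ∈ S then
      sweepRight S a k σ * adjSwap n (a + k) else sweepRight S a k σ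

section SweepRight

variable {S : Finset (Fin n)} {a k : ℕ} {σ : Perm (Fin n)}

lemma elt_sweepRight_of_gt (hk : a + k < n) {j : ℕ} (hj : j < n) (h : a + k < j) :
    elt (sweepRight S a k σ) j = elt σ j := by
  induction k with
  | zero => rfl
  | succ k ih =>
    rw [sweepRight]
    split_ifs
    · rw [elt_adjSwap_of_ne _ (by omega) hj (by omega) (by omega)]
      exact ih (by omega) (by omega)
    · exact ih (by omega) (by omega)

lemma window_sweepRight {lo hi : ℕ} (h1 : lo ≤ a) (h2 : a + k ≤ hi) (h3 : hi < n) :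
    window lo hi (sweepRight S a k σ) = window lo hi σ := by
  induction k with
  | zero => rfl
  | succ k ih =>
    rw [sweepRight]
    split_ifs
    · rw [window_adjSwap (by omega) (by omega) h3]
      exact ih (by omega)
    · exact ih (by omega)

/-- The element at the current position never belongs to `S`; hence each exchange of the sweep moves
an element of `S` past one outside `S`. -/
lemma elt_sweepRight_notMem (h : elt σ a ∉ S) :
    elt (sweepRight S a k σ) (a + k) ∉ S := by
  induction k with
  | zero => exact h
  | succ k ih =>
    rw [sweepRight]
    split_ifs with h'
    · rw [← add_assoc, elt_adjSwap_right]; exact ih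
    · exact h'

/-- Whether the last exchange took place can be read off from position `a + k`: the exchange leaves
an element of `S` there, its absence an element outside `S`. -/
lemma sweepRight_injective {σ' : Perm (Fin n)} (h : elt σ a ∉ S) (h' : elt σ' a ∉ S)
    (he : sweepRight S a k σ = sweepRight S a k σ') : σ = σ' := by
  induction k with
  | zero => exact he
  | succ k ih =>
    apply ih
    have e1 := elt_sweepRight_notMem (k := k) h
    have e2 := elt_sweepRight_notMem (k := k) h'
    rw [sweepRight, sweepRight] at he
    split_ifs at he with h1 h2 h2
    · exact mul_right_cancel he
    · rw [← he, elt_adjSwap_left] at e2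
      exact absurd h1 e2
    · rw [he, elt_adjSwap_left] at e1
      exact absurd h2 e1
    · exact he

lemma sweepRight_mul {w : Perm (Fin n)} (hw : ∀ c, w c ∈ S ↔ c ∈ S) :
    sweepRight S a k (w * σ) = w * sweepRight S a k σ := by
  induction k with
  | zero => rfl
  | succ k ih =>
    simp only [sweepRight, ih, elt_mul, hw]
    split_ifs
    · rw [mul_assoc]
    · rfl

end SweepRight

/-- The element `y` is moved to the left, starting at position `b`, until it meets `x`. -/
def sweepLeft (x y : Fin n) (b : ℕ) : ℕ → Perm (Fin n) → Perm (Fin n)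
  | 0, σ => σ
  | t + 1, σ => if elt (sweepLeft x y b t σ) (b - t) = y ∧ elt (sweepLeft x y b t σ) (b - t - 1) ≠ x
      then sweepLeft x y b t σ * adjSwap n (b - t - 1) else sweepLeft x y b t σ

section SweepLeft

variable {x y : Fin n} {b t : ℕ} {σ : Perm (Fin n)}

lemma elt_sweepLeft_of_lt (hb : b < n) {j : ℕ} (h : j + t < b) :
    elt (sweepLeft x y b t σ) j = elt σ j := by
  induction t with
  | zero => rfl
  | succ t ih =>
    rw [sweepLeft]
    split_ifs
    · rw [elt_adjSwap_of_ne _ (by omega) (by omega) (by omega) (by omega)]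
      exact ih (by omega)
    · exact ih (by omega)

lemma window_sweepLeft {lo hi : ℕ} (h1 : lo + t ≤ b) (h2 : b ≤ hi) (h3 : hi < n) :
    window lo hi (sweepLeft x y b t σ) = window lo hi σ := by
  induction t with
  | zero => rfl
  | succ t ih =>
    rw [sweepLeft]
    split_ifs
    · rw [window_adjSwap (by omega) (by omega) h3]
      exact ih (by omega)
    · exact ih (by omega)

lemma sweepLeft_succ_of_elt_eq (hb : b < n) (ht : t + 1 ≤ b) (hσ : elt σ b = y)
    (h : elt (sweepLeft x y b (t + 1) σ) (b - (t + 1)) = y) :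
    elt (sweepLeft x y b t σ) (b - t) = y ∧ elt σ (b - t - 1) ≠ x ∧
      sweepLeft x y b (t + 1) σ = sweepLeft x y b t σ * adjSwap n (b - t - 1) := by
  have hj : elt (sweepLeft x y b t σ) (b - t - 1) = elt σ (b - t - 1) :=
    elt_sweepLeft_of_lt hb (by omega)
  rw [sweepLeft] at h ⊢
  split_ifs at h ⊢ with hc
  · rw [hj] at hc
    exact ⟨hc.1, hc.2, rfl⟩
  · rw [← Nat.sub_sub, hj, ← hσ] at h
    exact absurd (elt_inj (by omega) hb h) (by omega)

/-- As `y` has reached `b - t`, every one of the `t` exchanges took place, at known positions, and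
can be undone. -/
lemma sweepLeft_injective {σ' : Perm (Fin n)} (hb : b < n) (ht : t ≤ b) (hσ : elt σ b = y)
    (hσ' : elt σ' b = y) (h : elt (sweepLeft x y b t σ) (b - t) = y)
    (he : sweepLeft x y b t σ = sweepLeft x y b t σ') : σ = σ' := by
  induction t with
  | zero => exact he
  | succ t ih =>
    have h1 := sweepLeft_succ_of_elt_eq hb ht hσ h
    have h2 := sweepLeft_succ_of_elt_eq hb ht hσ' (he ▸ h)
    rw [h1.2.2, h2.2.2] at he
    exact ih (by omega) h1.1 (mul_right_cancel he)

lemma sweepLeft_mul (w : Perm (Fin n)) :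
    sweepLeft (w x) (w y) b t (w * σ) = w * sweepLeft x y b t σ := by
  induction t with
  | zero => rfl
  | succ t ih =>
    simp only [sweepLeft, ih, elt_mul, w.injective.eq_iff, ne_eq]
    split_ifs
    · rw [mul_assoc]
    · rfl

/-- The element `y` keeps moving until it meets `x`. -/
lemma sweepLeft_running_or_stopped (hb : b < n) (hσ : elt σ b = y) (T : ℕ) (hT : T ≤ b) :
    elt (sweepLeft x y b T σ) (b - T) = y ∨ ∃ t < T,
      elt (sweepLeft x y b t σ) (b - t) = y ∧ elt (sweepLeft x y b t σ) (b - t - 1) = x ∧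
        sweepLeft x y b T σ = sweepLeft x y b t σ := by
  induction T with
  | zero => exact Or.inl hσ
  | succ T ih =>
    rcases ih (by omega) with h | ⟨t, htT, h1, h2, h3⟩
    · by_cases hx : elt (sweepLeft x y b T σ) (b - T - 1) = x
      · refine Or.inr ⟨T, by omega, h, hx, ?_⟩
        rw [sweepLeft, if_neg fun hc => hc.2 hx]
      · left
        rw [sweepLeft, if_pos ⟨h, hx⟩, ← Nat.sub_sub, elt_adjSwap_left,
          Nat.sub_add_cancel (by omega), h]
    · refine Or.inr ⟨t, by omega, h1, h2, ?_⟩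
      rw [sweepLeft, if_neg, h3]
      rintro ⟨hc, -⟩
      rw [h3] at hc
      have := elt_inj (by omega) (by omega) (hc.trans h1.symm)
      omega

lemma elt_sweepLeft_of_le (hb : b < n) (hσ : elt σ b = y) {T : ℕ} (hT : T ≤ b)
    (h : elt (sweepLeft x y b T σ) (b - T) = y) (ht : t ≤ T) :
    elt (sweepLeft x y b t σ) (b - t) = y := by
  induction T, ht using Nat.le_induction with
  | base => exact h
  | succ T _ ih => exact ih (by omega) (sweepLeft_succ_of_elt_eq hb hT hσ h).1

/-- The positions ahead of `y` are untouched, so `x` waits at `k` and `y` cannot run as far as `a`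
without meeting it. -/
lemma exists_sweepLeft_stopped (hb : b < n) (hσ : elt σ b = y) {a k : ℕ} (hak : a ≤ k)
    (hkb : k < b) (hk : elt σ k = x) : ∃ t < b - a,
      elt (sweepLeft x y b t σ) (b - t) = y ∧ elt (sweepLeft x y b t σ) (b - t - 1) = x ∧
        sweepLeft x y b (b - a) σ = sweepLeft x y b t σ := by
  rcases sweepLeft_running_or_stopped (x := x) hb hσ (b - a) (by omega) with h | h
  · have h1 := elt_sweepLeft_of_le hb hσ (by omega) h (t := b - k - 1 + 1) (by omega)
    have h2 := (sweepLeft_succ_of_elt_eq hb (by omega) hσ h1).2.1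
    rw [show b - (b - k - 1) - 1 = k by omega] at h2
    exact absurd hk h2
  · exact h

end SweepLeft

section Potential

variable {p : Fin n → Fin n → ℝ} {S : Finset (Fin n)} {x y : Fin n} {a b k t : ℕ}
  {σ : Perm (Fin n)}

/-- The gain that compensates moving `y` to the left of all elements of `S` at the positions
from `lo` to `hi - 1`. -/
noncomputable def potential (p : Fin n → Fin n → ℝ) (S : Finset (Fin n)) (y : Fin n) (lo hi : ℕ)
    (σ : Perm (Fin n)) : ℝ :=
  ∏ j ∈ Finset.Ico lo hi, if elt σ j ∈ S then p (elt σ j) y / p y (elt σ j) else 1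

lemma potential_succ {lo hi : ℕ} (h : lo ≤ hi) : potential p S y lo (hi + 1) σ
    = potential p S y lo hi σ * if elt σ hi ∈ S then p (elt σ hi) y / p y (elt σ hi) else 1 :=
  Finset.prod_Ico_succ_top h _

lemma potential_congr {lo hi : ℕ} {σ' : Perm (Fin n)}
    (h : ∀ j, lo ≤ j → j < hi → elt σ j = elt σ' j) :
    potential p S y lo hi σ = potential p S y lo hi σ' := by
  refine Finset.prod_congr rfl fun j hj => ?_
  rw [h j (Finset.mem_Ico.1 hj).1 (Finset.mem_Ico.1 hj).2]

lemma one_le_potential (hp : ∀ i j, i ≠ j → 0 < p i j) (hy : y ∉ S)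
    (hS : ∀ s ∈ S, p y s ≤ p s y) (lo hi : ℕ) : 1 ≤ potential p S y lo hi σ := by
  refine Finset.one_le_prod fun j _ => ?_
  split_ifs with h
  · have hne : y ≠ elt σ j := fun e => hy (e ▸ h)
    rw [one_le_div (hp _ _ hne)]
    exact hS _ h
  · exact le_rfl

lemma weight_adjSwap {r : ℕ} (hr : r + 1 < n) (σ : Perm (Fin n)) :
    weight p (σ * adjSwap n r) * p (elt σ r) (elt σ (r + 1))
      = weight p σ * p (elt σ (r + 1)) (elt σ r) :=
  weight_mul_swap (by rw [ofNat_val hr, ofNat_val (by omega)]) σ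

lemma elt_ne_elt_succ {r : ℕ} (hr : r + 1 < n) (σ : Perm (Fin n)) :
    elt σ r ≠ elt σ (r + 1) := fun h => by
  have := elt_inj (by omega) hr h
  omega

lemma weight_adjSwap_eq_div (hp : ∀ i j, i ≠ j → 0 < p i j) {r : ℕ} (hr : r + 1 < n)
    (σ : Perm (Fin n)) : weight p (σ * adjSwap n r)
      = weight p σ * (p (elt σ (r + 1)) (elt σ r) / p (elt σ r) (elt σ (r + 1))) := by
  rw [mul_div, eq_div_iff (hp _ _ (elt_ne_elt_succ hr σ)).ne', weight_adjSwap hr]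

/-- An exchange moves some `s ∈ S` left past some `c ∉ S` and multiplies the weight by `p s c / p c
s`. By `hS` this is at least `p s y / p y s`, with `y` the element at `b`: exactly what `y` will
lose when it passes `s`. -/
lemma weight_sweepRight (hp : ∀ i j, i ≠ j → 0 < p i j) (hb : b < n) (ha : elt σ a ∉ S)
    (hS : ∀ s ∈ S, ∀ c ∈ window a b σ, c ∉ S → c ≠ elt σ b →
      p s (elt σ b) / p (elt σ b) s ≤ p s c / p c s) (hy : elt σ b ∉ S) (hk : a + k < b) :
    weight p σ * potential p S (elt σ b) a (a + k) (sweepRight S a k σ)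
      ≤ weight p (sweepRight S a k σ) := by
  induction k with
  | zero => simp [potential, sweepRight]
  | succ k ih =>
    have ih := ih (by omega)
    have hcS := elt_sweepRight_notMem (k := k) ha
    by_cases h1 : elt (sweepRight S a k σ) (a + k + 1) ∈ S
    · have hsy : elt (sweepRight S a k σ) (a + k + 1) ≠ elt σ b := fun e => hy (e ▸ h1)
      rw [sweepRight, if_pos h1, ← add_assoc, potential_succ (by omega), elt_adjSwap_left,
        if_pos h1, weight_adjSwap_eq_div hp (by omega), ← mul_assoc]
      have hc : potential p S (elt σ b) a (a + k) (sweepRight S a k σ * adjSwap n (a + k))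
          = potential p S (elt σ b) a (a + k) (sweepRight S a k σ) :=
        potential_congr fun j _ hj =>
          elt_adjSwap_of_ne _ (by omega) (by omega) (by omega) (by omega)
      rw [hc]
      refine mul_le_mul ih ?_ (div_nonneg (hp _ _ hsy).le (hp _ _ hsy.symm).le)
        (weight_pos hp _).le
      refine hS _ h1 _ ?_ hcS fun e => ?_
      · rw [← window_sweepRight (S := S) (σ := σ) (a := a) (k := k) le_rfl (by omega) hb]
        exact mem_window.2 ⟨a + k, by omega, by omega, rfl⟩
      · rw [← elt_sweepRight_of_gt (S := S) (σ := σ) (a := a) (k := k) (by omega) hb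
          (by omega)] at e
        have := elt_inj (by omega) hb e
        omega
    · rw [sweepRight, if_neg h1, ← add_assoc, potential_succ (by omega), if_neg hcS, mul_one]
      exact ih

/-- When `y` passes an element of `S`, the weight loses the same factor as the potential; passing
any element outside `S` other than `x` does not lower the weight. -/
lemma weight_sweepLeft (hp : ∀ i j, i ≠ j → 0 < p i j) (hb : b < n) (hσ : elt σ b = y)
    (hbig : ∀ c ∈ window a b σ, c ∉ S → c ≠ x → c ≠ y → p c y ≤ p y c) {w : ℝ}
    (h0 : w * potential p S y a b σ ≤ weight p σ) (hS : ∀ s ∈ S, p y s ≤ p s y) (hy : y ∉ S)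
    (ht : a + t ≤ b) (h : elt (sweepLeft x y b t σ) (b - t) = y) :
    w * potential p S y a (b - t) (sweepLeft x y b t σ) ≤ weight p (sweepLeft x y b t σ) := by
  induction t with
  | zero => exact h0
  | succ t ih =>
    obtain ⟨h1, h2, h3⟩ := sweepLeft_succ_of_elt_eq hb (by omega) hσ h
    have ih := ih (by omega) h1
    rw [h3]
    have hj : elt (sweepLeft x y b t σ) (b - t - 1) = elt σ (b - t - 1) :=
      elt_sweepLeft_of_lt hb (by omega)
    rw [← hj] at h2
    have hzw : elt (sweepLeft x y b t σ) (b - t - 1) ∈ window a b σ := by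
      rw [hj]
      exact mem_window.2 ⟨_, by omega, by omega, rfl⟩
    have hbt : b - t = b - t - 1 + 1 := by omega
    rw [hbt] at ih h1
    have hr : b - t - 1 + 1 < n := by omega
    rw [← Nat.sub_sub]
    set r := b - t - 1 with hrdef
    set υ := sweepLeft x y b t σ with hυ
    have hne : elt υ r ≠ y := h1 ▸ elt_ne_elt_succ hr υ
    rw [potential_succ (by omega)] at ih
    have hc : potential p S y a r (υ * adjSwap n r) = potential p S y a r υ :=
      potential_congr fun j _ hj =>
        elt_adjSwap_of_ne _ (by omega) (by omega) (by omega) (by omega)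
    rw [hc, weight_adjSwap_eq_div hp hr, h1]
    have hp1 := hp _ _ hne
    have hp2 := hp _ _ hne.symm
    rw [mul_div, le_div_iff₀ hp1]
    have hpot := (zero_le_one.trans (one_le_potential (σ := υ) hp hy hS a r))
    split_ifs at ih with hzS
    · rw [← mul_assoc, mul_div, div_le_iff₀ hp2] at ih
      exact ih
    · rw [mul_one] at ih
      have := hbig _ hzw hzS h2 hne
      exact mul_le_mul ih this hp1.le (weight_pos hp _).le

end Potential

end BiasedPerm

/-! ### Routing the exchange of two distant positions through adjacent exchanges -/

namespace BiasedPerm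

open Equiv

variable {n : ℕ}

/-- The properties of the sets `D x y` (the leaves below the lowest common ancestor of `x` and `y`)
and `S x y` (the leaves preceding them) that are used to route exchanges through adjacent
exchanges. -/
structure SweepData (p : Fin n → Fin n → ℝ) (D S : Fin n → Fin n → Finset (Fin n)) : Prop where
  pos : ∀ i j, i ≠ j → 0 < p i j
  total : ∀ i j, i ≠ j → p i j + p j i = 1
  D_comm : ∀ x y, D x y = D y x
  S_comm : ∀ x y, S x y = S y x
  left_mem : ∀ x y, x ≠ y → x ∈ D x y
  disj : ∀ x y, ∀ z ∈ S x y, z ∉ D x y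
  flat : ∀ x y, x ≠ y → ∀ z, z ∉ D x y → p x z = p y z ∧ p z x = p z y
  small : ∀ x y, x ≠ y → ∀ s ∈ S x y, p y s ≤ p s y
  big : ∀ x y, x ≠ y → ∀ z, z ∉ S x y → z ∉ D x y → p z y ≤ p y z
  mono : ∀ x y, x ≠ y → ∀ s ∈ S x y, ∀ c, c ∉ S x y → c ∉ D x y → p s y / p y s ≤ p s c / p c s
  recover : ∀ x x' y, x ≠ y → x' ≠ y → x ≠ x' → x' ∈ D x y ∨ x ∈ D x' y

namespace SweepData

variable {p : Fin n → Fin n → ℝ} {D S : Fin n → Fin n → Finset (Fin n)}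

lemma right_mem (H : SweepData p D S) {x y : Fin n} (h : x ≠ y) : y ∈ D x y := by
  rw [H.D_comm]; exact H.left_mem y x h.symm

lemma left_notMem (H : SweepData p D S) {x y : Fin n} (h : x ≠ y) : x ∉ S x y :=
  fun hx => H.disj x y x hx (H.left_mem x y h)

lemma right_notMem (H : SweepData p D S) {x y : Fin n} (h : x ≠ y) : y ∉ S x y :=
  fun hy => H.disj x y y hy (H.right_mem h)

end SweepData

variable [NeZero n]

/-- The Dirichlet form of the nearest neighbour dynamics, without normalisation. -/
noncomputable def nnForm (p : Fin n → Fin n → ℝ) (f : Perm (Fin n) → ℝ) : ℝ :=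
  ∑ σ, ∑ r ∈ Finset.range (n - 1),
    weight p σ * p (elt σ (r + 1)) (elt σ r) * (f (σ * adjSwap n r) - f σ) ^ 2

section Energy

variable {p : Fin n → Fin n → ℝ} {f : Perm (Fin n) → ℝ}

lemma nnForm_nonneg (hp : ∀ i j, i ≠ j → 0 < p i j) (f : Perm (Fin n) → ℝ) :
    0 ≤ nnForm p f :=
  Finset.sum_nonneg fun σ _ => Finset.sum_nonneg fun r hr => by
    have hr' : r + 1 < n := by have := Finset.mem_range.1 hr; omega
    exact mul_nonneg (mul_nonneg (weight_pos hp σ).le (hp _ _ (elt_ne_elt_succ hr' σ).symm).le)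
      (sq_nonneg _)

/-- The rates of an adjacent exchange and of its reverse add up to one, so one is at least `1 / 2`,
and by reversibility the conductance is at least half the weight of the corresponding end, hence
half of `m`. Injectivity lets every exchange be used at most once. -/
lemma sum_step_le (hp : ∀ i j, i ≠ j → 0 < p i j) (h1 : ∀ i j, i ≠ j → p i j + p j i = 1)
    {A : Finset (Perm (Fin n))} {φ : Perm (Fin n) → Perm (Fin n)} {m : Perm (Fin n) → ℝ} {r : ℕ}
    (hr : r + 1 < n) (hinj : Set.InjOn φ A) (hm : ∀ σ ∈ A, m σ ≤ weight p (φ σ))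
    (hm' : ∀ σ ∈ A, m σ ≤ weight p (φ σ * adjSwap n r)) :
    ∑ σ ∈ A, m σ * (f (φ σ * adjSwap n r) - f (φ σ)) ^ 2 ≤ 2 * nnForm p f := by
  have key : ∀ σ ∈ A, m σ ≤ 2 * (weight p (φ σ) * p (elt (φ σ) (r + 1)) (elt (φ σ) r)) := by
    intro σ hσ
    have hw := weight_adjSwap (p := p) hr (φ σ)
    have ht := h1 _ _ (elt_ne_elt_succ hr (φ σ))
    have hp1 := hp _ _ (elt_ne_elt_succ hr (φ σ))
    have hp2 := hp _ _ (elt_ne_elt_succ hr (φ σ)).symm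
    have hW := weight_pos hp (φ σ)
    have hW' := weight_pos hp (φ σ * adjSwap n r)
    rcases le_total (1 / 2) (p (elt (φ σ) (r + 1)) (elt (φ σ) r)) with h | h
    · have := hm σ hσ
      nlinarith
    · have := hm' σ hσ
      rw [← hw]
      nlinarith
  calc ∑ σ ∈ A, m σ * (f (φ σ * adjSwap n r) - f (φ σ)) ^ 2
      ≤ ∑ σ ∈ A, 2 * (weight p (φ σ) * p (elt (φ σ) (r + 1)) (elt (φ σ) r)) *
          (f (φ σ * adjSwap n r) - f (φ σ)) ^ 2 :=
        Finset.sum_le_sum fun σ hσ => mul_le_mul_of_nonneg_right (key σ hσ) (sq_nonneg _)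
    _ = 2 * ∑ τ ∈ A.image φ, weight p τ * p (elt τ (r + 1)) (elt τ r) *
          (f (τ * adjSwap n r) - f τ) ^ 2 := by
        rw [Finset.sum_image hinj, Finset.mul_sum]
        exact Finset.sum_congr rfl fun σ _ => by ring
    _ ≤ 2 * nnForm p f := by
        refine mul_le_mul_of_nonneg_left ?_ zero_le_two
        have hnn : ∀ (τ : Perm (Fin n)), ∀ s ∈ Finset.range (n - 1),
            0 ≤ weight p τ * p (elt τ (s + 1)) (elt τ s) * (f (τ * adjSwap n s) - f τ) ^ 2 := by
          intro τ s hs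
          have hs' : s + 1 < n := by have := Finset.mem_range.1 hs; omega
          exact mul_nonneg (mul_nonneg (weight_pos hp τ).le
            (hp _ _ (elt_ne_elt_succ hs' τ).symm).le) (sq_nonneg _)
        unfold nnForm
        refine (Finset.sum_le_sum fun τ _ => Finset.single_le_sum (hnn τ)
          (Finset.mem_range.2 (by omega : r < n - 1))).trans ?_
        exact Finset.sum_le_sum_of_subset_of_nonneg (Finset.subset_univ _) fun τ _ _ =>
          Finset.sum_nonneg (hnn τ)

lemma sq_sub_le_mul_sum (g : ℕ → ℝ) (T : ℕ) :
    (g 0 - g T) ^ 2 ≤ T * ∑ t ∈ Finset.range T, (g (t + 1) - g t) ^ 2 := by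
  rw [← neg_sq, neg_sub, ← Finset.sum_range_sub]
  simpa using sq_sum_le_card_mul_sum_sq (s := Finset.range T) (f := fun t => g (t + 1) - g t)

/-- Cauchy–Schwarz along at most `n` steps costs one factor `n`, the sum over the steps a second
one. `Q t` marks the arrangements that really move at time `t`: only these need to be decodable and
heavy enough. -/
lemma sum_chain_le (hp : ∀ i j, i ≠ j → 0 < p i j) (h1 : ∀ i j, i ≠ j → p i j + p j i = 1)
    {A : Finset (Perm (Fin n))} {φ : ℕ → Perm (Fin n) → Perm (Fin n)} {m : Perm (Fin n) → ℝ}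
    (hm0 : ∀ σ, 0 ≤ m σ) (r : ℕ → ℕ) (Q : ℕ → Perm (Fin n) → Prop) {T : ℕ} (hT : T ≤ n)
    (hr : ∀ t < T, r t + 1 < n)
    (hstep : ∀ t < T, ∀ σ ∈ A, φ (t + 1) σ = φ t σ ∨
      (φ (t + 1) σ = φ t σ * adjSwap n (r t) ∧ Q t σ))
    (hinj : ∀ t < T, ∀ σ ∈ A, ∀ σ' ∈ A, Q t σ → Q t σ' → φ t σ = φ t σ' → σ = σ')
    (hm : ∀ t < T, ∀ σ ∈ A, Q t σ → m σ ≤ weight p (φ t σ))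
    (hm' : ∀ t < T, ∀ σ ∈ A, Q t σ → m σ ≤ weight p (φ (t + 1) σ)) :
    ∑ σ ∈ A, m σ * (f (φ 0 σ) - f (φ T σ)) ^ 2 ≤ 2 * (n : ℝ) ^ 2 * nnForm p f := by
  classical
  have hE := nnForm_nonneg hp f
  have hone : ∀ t ∈ Finset.range T,
      ∑ σ ∈ A, m σ * (f (φ (t + 1) σ) - f (φ t σ)) ^ 2 ≤ 2 * nnForm p f := by
    intro t ht
    have ht := Finset.mem_range.1 ht
    set B := A.filter fun σ => φ (t + 1) σ = φ t σ * adjSwap n (r t) ∧ Q t σ with hB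
    have hsub : ∑ σ ∈ A, m σ * (f (φ (t + 1) σ) - f (φ t σ)) ^ 2
        = ∑ σ ∈ B, m σ * (f (φ t σ * adjSwap n (r t)) - f (φ t σ)) ^ 2 := by
      rw [hB, Finset.sum_filter]
      refine Finset.sum_congr rfl fun σ hσ => ?_
      split_ifs with h
      · rw [h.1]
      · rcases hstep t ht σ hσ with h' | h'
        · rw [h']; simp
        · exact absurd h' h
    rw [hsub]
    refine sum_step_le hp h1 (hr t ht) ?_ ?_ ?_
    · intro σ hσ σ' hσ' he
      have a1 := Finset.mem_filter.1 hσ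
      have a2 := Finset.mem_filter.1 hσ'
      exact hinj t ht σ a1.1 σ' a2.1 a1.2.2 a2.2.2 he
    · intro σ hσ
      have a1 := Finset.mem_filter.1 hσ
      exact hm t ht σ a1.1 a1.2.2
    · intro σ hσ
      have a1 := Finset.mem_filter.1 hσ
      rw [← a1.2.1]
      exact hm' t ht σ a1.1 a1.2.2
  have hTn : (T : ℝ) ≤ n := by exact_mod_cast hT
  calc ∑ σ ∈ A, m σ * (f (φ 0 σ) - f (φ T σ)) ^ 2
      ≤ ∑ σ ∈ A, m σ * (T * ∑ t ∈ Finset.range T, (f (φ (t + 1) σ) - f (φ t σ)) ^ 2) :=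
        Finset.sum_le_sum fun σ _ => mul_le_mul_of_nonneg_left
          (sq_sub_le_mul_sum (fun t => f (φ t σ)) T) (hm0 σ)
    _ = T * ∑ t ∈ Finset.range T, ∑ σ ∈ A, m σ * (f (φ (t + 1) σ) - f (φ t σ)) ^ 2 := by
        rw [Finset.sum_comm, Finset.mul_sum]
        refine Finset.sum_congr rfl fun σ _ => ?_
        rw [← Finset.mul_sum]
        ring
    _ ≤ T * ∑ t ∈ Finset.range T, 2 * nnForm p f :=
        mul_le_mul_of_nonneg_left (Finset.sum_le_sum hone) (Nat.cast_nonneg _)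
    _ = T * T * (2 * nnForm p f) := by
        rw [Finset.sum_const, Finset.card_range, nsmul_eq_mul]; ring
    _ ≤ n * n * (2 * nnForm p f) := by
        refine mul_le_mul_of_nonneg_right ?_ (by linarith)
        exact mul_le_mul hTn hTn (Nat.cast_nonneg _) (Nat.cast_nonneg _)
    _ = _ := by ring

end Energy

section Routes

variable {p : Fin n → Fin n → ℝ} {D S : Fin n → Fin n → Finset (Fin n)} {a b : ℕ}

/-- Nothing between the positions `a` and `b` lies in `D x y`, for `x` and `y` the elements
at these positions. -/
def RouteAdj (D : Fin n → Fin n → Finset (Fin n)) (a b : ℕ) (σ : Perm (Fin n)) : Prop :=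
  ∀ j, a < j → j < b → elt σ j ∉ D (elt σ a) (elt σ b)

/-- The exchange of the positions `a` and `b`. -/
def flipPos (n : ℕ) [NeZero n] (a b : ℕ) : Perm (Fin n) := swap (Fin.ofNat n a) (Fin.ofNat n b)

/-- The first part of the route. -/
def routeRight (S : Fin n → Fin n → Finset (Fin n)) (a b k : ℕ) (σ : Perm (Fin n)) :
    Perm (Fin n) := sweepRight (S (elt σ a) (elt σ b)) a k σ

/-- The second part of the route. -/
def routeLeft (S : Fin n → Fin n → Finset (Fin n)) (a b t : ℕ) (σ : Perm (Fin n)) :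
    Perm (Fin n) := sweepLeft (elt σ a) (elt σ b) b t (routeRight S a b (b - 1 - a) σ)

variable {σ : Perm (Fin n)}

lemma mul_flipPos (σ : Perm (Fin n)) (a b : ℕ) :
    σ * flipPos n a b = swap (elt σ a) (elt σ b) * σ := mul_swap_eq_swap_mul _ _ _

lemma elt_flipPos_left : elt (σ * flipPos n a b) a = elt σ b := by simp [elt, flipPos]

lemma elt_flipPos_right : elt (σ * flipPos n a b) b = elt σ a := by simp [elt, flipPos]

lemma elt_flipPos_of_ne {j : ℕ} (ha : a < n) (hb : b < n) (hj : j < n) (h1 : j ≠ a)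
    (h2 : j ≠ b) : elt (σ * flipPos n a b) j = elt σ j := by
  unfold elt flipPos
  rw [Perm.mul_apply, swap_apply_of_ne_of_ne]
  · exact fun h => h1 (ofNat_inj hj ha h)
  · exact fun h => h2 (ofNat_inj hj hb h)

lemma flipPos_flipPos : σ * flipPos n a b * flipPos n a b = σ := by
  rw [mul_assoc, flipPos, swap_mul_self, mul_one]

lemma elt_ne_elt (hab : a < b) (hb : b < n) : elt σ a ≠ elt σ b := fun h => by
  have := elt_inj (by omega) hb h
  omega

namespace SweepData

lemma routeAdj_flip (H : SweepData p D S) (hab : a < b) (hb : b < n) (h : RouteAdj D a b σ) :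
    RouteAdj D a b (σ * flipPos n a b) := by
  intro j h1 h2
  rw [elt_flipPos_left, elt_flipPos_right, H.D_comm,
    elt_flipPos_of_ne (by omega) hb (by omega) (by omega) (by omega)]
  exact h j h1 h2

lemma _root_.BiasedPerm.RouteAdj.notMem {c : Fin n} (h : RouteAdj D a b σ)
    (hc : c ∈ window a b σ) (h1 : c ≠ elt σ a) (h2 : c ≠ elt σ b) :
    c ∉ D (elt σ a) (elt σ b) := by
  obtain ⟨j, hj1, hj2, rfl⟩ := mem_window.1 hc
  refine h j (lt_of_le_of_ne hj1 ?_) (lt_of_le_of_ne hj2 ?_)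
  · rintro rfl; exact h1 rfl
  · rintro rfl; exact h2 rfl

/-- The last element and the set of elements in the window determine the first: of two candidates,
`recover` puts one into the set `D` of the other, where no element strictly inside the window may
lie. -/
lemma first_eq (H : SweepData p D S) (hab : a < b) (hb : b < n) {σ' : Perm (Fin n)}
    (h : RouteAdj D a b σ) (h' : RouteAdj D a b σ') (hw : window a b σ = window a b σ')
    (hy : elt σ b = elt σ' b) : elt σ a = elt σ' a := by
  by_contra hne
  have h1 : elt σ a ∈ window a b σ' := hw ▸ mem_window.2 ⟨a, le_rfl, hab.le, rfl⟩
  have h2 : elt σ' a ∈ window a b σ := hw ▸ mem_window.2 ⟨a, le_rfl, hab.le, rfl⟩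
  have n1 := elt_ne_elt (σ := σ) hab hb
  have n2 := elt_ne_elt (σ := σ') hab hb
  have k1 := h'.notMem h1 hne (hy ▸ n1)
  have k2 := h.notMem h2 (Ne.symm hne) (hy ▸ n2)
  rcases H.recover _ _ _ n1 (hy ▸ n2) hne with h3 | h3
  · exact k2 h3
  · exact k1 (hy ▸ h3)

lemma routeRight_flip (H : SweepData p D S) (hab : a < b) (hb : b < n) (k : ℕ) :
    routeRight S a b k (σ * flipPos n a b)
      = swap (elt σ a) (elt σ b) * routeRight S a b k σ := by
  have hne := elt_ne_elt (σ := σ) hab hb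
  unfold routeRight
  rw [elt_flipPos_left, elt_flipPos_right, H.S_comm, mul_flipPos]
  exact sweepRight_mul (swap_mem_iff (iff_of_false (H.left_notMem hne) (H.right_notMem hne)))

/-- Renaming `x` and `y` into each other alters no decision of the sweeps, since neither lies in
`S`. The routes from both ends of the exchange therefore run in parallel, and once `x` and `y` are
adjacent they are one adjacent exchange apart. -/
lemma routeLeft_flip (H : SweepData p D S) (hab : a < b) (hb : b < n) (t : ℕ) :
    routeLeft S a b t (σ * flipPos n a b)
      = swap (elt σ a) (elt σ b) * routeLeft S a b t σ := by
  unfold routeLeft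
  rw [elt_flipPos_left, elt_flipPos_right, H.routeRight_flip hab hb, ← sweepLeft_mul,
    swap_apply_left, swap_apply_right]

lemma weight_routeRight_potential (H : SweepData p D S) (hab : a < b) (hb : b < n)
    (h : RouteAdj D a b σ) {k : ℕ} (hk : a + k < b) :
    weight p σ * potential p (S (elt σ a) (elt σ b)) (elt σ b) a (a + k) (routeRight S a b k σ)
      ≤ weight p (routeRight S a b k σ) := by
  have hne := elt_ne_elt (σ := σ) hab hb
  refine weight_sweepRight H.pos hb (H.left_notMem hne) ?_ (H.right_notMem hne) hk
  intro s hs c hc hcS hcy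
  by_cases hcx : c = elt σ a
  · obtain ⟨e1, e2⟩ := H.flat _ _ hne s (H.disj _ _ s hs)
    rw [hcx, e1, e2]
  · exact H.mono _ _ hne s hs c hcS (h.notMem hc hcx hcy)

lemma weight_le_routeRight (H : SweepData p D S) (hab : a < b) (hb : b < n)
    (h : RouteAdj D a b σ) {k : ℕ} (hk : a + k < b) :
    weight p σ ≤ weight p (routeRight S a b k σ) := by
  have hne := elt_ne_elt (σ := σ) hab hb
  refine le_trans ?_ (H.weight_routeRight_potential hab hb h hk)
  exact le_mul_of_one_le_right (weight_pos H.pos σ).le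
    (one_le_potential H.pos (H.right_notMem hne) (H.small _ _ hne) _ _)

lemma elt_routeRight (hb : b < n) {k : ℕ} (hk : a + k < b) :
    elt (routeRight S a b k σ) b = elt σ b :=
  elt_sweepRight_of_gt (by omega) hb hk

lemma window_routeRight (hb : b < n) {k : ℕ} (hk : a + k < b) :
    window a b (routeRight S a b k σ) = window a b σ :=
  window_sweepRight le_rfl hk.le hb

lemma window_routeLeft (hab : a < b) (hb : b < n) {t : ℕ} (ht : a + t ≤ b) :
    window a b (routeLeft S a b t σ) = window a b σ := by
  rw [routeLeft, window_sweepLeft ht le_rfl hb, window_routeRight hb (by omega)]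

lemma weight_le_routeLeft (H : SweepData p D S) (hab : a < b) (hb : b < n)
    (h : RouteAdj D a b σ) {t : ℕ} (ht : a + t ≤ b)
    (hrun : elt (routeLeft S a b t σ) (b - t) = elt σ b) :
    weight p σ ≤ weight p (routeLeft S a b t σ) := by
  have hne := elt_ne_elt (σ := σ) hab hb
  have hpot : weight p σ * potential p (S (elt σ a) (elt σ b)) (elt σ b) a b
      (routeRight S a b (b - 1 - a) σ) ≤ weight p (routeRight S a b (b - 1 - a) σ) := by
    have h1 := H.weight_routeRight_potential hab hb h (k := b - 1 - a) (by omega)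
    -- The first sweep ends at `b - 1` with an element outside `S`, so extending the potential from
    -- `b - 1` to `b` adds no factor.
    have h2 : elt (routeRight S a b (b - 1 - a) σ) (a + (b - 1 - a)) ∉ S (elt σ a) (elt σ b) :=
      elt_sweepRight_notMem (H.left_notMem hne)
    have e : b = a + (b - 1 - a) + 1 := by omega
    have e' := congrArg (fun j => potential p (S (elt σ a) (elt σ b)) (elt σ b) a j
      (routeRight S a b (b - 1 - a) σ)) e
    rw [e', potential_succ (by omega), if_neg h2, mul_one]
    exact h1
  refine le_trans ?_ (weight_sweepLeft (S := S (elt σ a) (elt σ b)) H.pos hb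
    (elt_routeRight hb (by omega)) ?_ hpot (H.small _ _ hne) (H.right_notMem hne) ht hrun)
  · exact le_mul_of_one_le_right (weight_pos H.pos σ).le
      (one_le_potential H.pos (H.right_notMem hne) (H.small _ _ hne) _ _)
  · intro c hc hcS hcx hcy
    rw [window_routeRight hb (by omega)] at hc
    exact H.big _ _ hne c hcS (h.notMem hc hcx hcy)

lemma routeRight_inj (H : SweepData p D S) (hab : a < b) (hb : b < n) {σ' : Perm (Fin n)}
    (h : RouteAdj D a b σ) (h' : RouteAdj D a b σ') {k : ℕ} (hk : a + k < b)
    (he : routeRight S a b k σ = routeRight S a b k σ') : σ = σ' := by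
  have hy : elt σ b = elt σ' b := by
    rw [← elt_routeRight (S := S) (σ := σ) hb hk, he, elt_routeRight hb hk]
  have hw : window a b σ = window a b σ' := by
    rw [← window_routeRight (S := S) (σ := σ) hb hk, he, window_routeRight hb hk]
  have hx := H.first_eq hab hb h h' hw hy
  unfold routeRight at he
  rw [← hx, ← hy] at he
  exact sweepRight_injective (H.left_notMem (elt_ne_elt hab hb))
    (by rw [hx, hy]; exact H.left_notMem (elt_ne_elt hab hb)) he

lemma routeLeft_inj (H : SweepData p D S) (hab : a < b) (hb : b < n) {σ' : Perm (Fin n)}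
    (h : RouteAdj D a b σ) (h' : RouteAdj D a b σ') {t : ℕ} (ht : a + t ≤ b)
    (hr : elt (routeLeft S a b t σ) (b - t) = elt σ b)
    (hr' : elt (routeLeft S a b t σ') (b - t) = elt σ' b)
    (he : routeLeft S a b t σ = routeLeft S a b t σ') : σ = σ' := by
  have hy : elt σ b = elt σ' b := by rw [← hr, he, hr']
  have hw : window a b σ = window a b σ' := by
    rw [← window_routeLeft (S := S) (σ := σ) hab hb ht, he, window_routeLeft hab hb ht]
  have hx := H.first_eq hab hb h h' hw hy
  refine H.routeRight_inj hab hb h h' (k := b - 1 - a) (by omega) ?_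
  unfold routeLeft at he hr
  rw [← hx, ← hy] at he
  refine sweepLeft_injective hb (by omega) (elt_routeRight hb (by omega)) ?_ hr he
  rw [elt_routeRight hb (by omega), hy]

lemma exists_stopped (hab : a < b) (hb : b < n) (σ : Perm (Fin n)) : ∃ t < b - a,
    elt (routeLeft S a b t σ) (b - t) = elt σ b ∧
      elt (routeLeft S a b t σ) (b - t - 1) = elt σ a ∧
        routeLeft S a b (b - a) σ = routeLeft S a b t σ := by
  have hx : elt σ a ∈ window a b (routeRight S a b (b - 1 - a) σ) := by
    rw [window_routeRight hb (by omega)]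
    exact mem_window.2 ⟨a, le_rfl, hab.le, rfl⟩
  obtain ⟨k, hk1, hk2, hk⟩ := mem_window.1 hx
  have hy := elt_routeRight (S := S) (σ := σ) (a := a) hb (k := b - 1 - a) (by omega)
  refine exists_sweepLeft_stopped hb hy hk1 (lt_of_le_of_ne hk2 ?_) hk
  rintro rfl
  rw [hy] at hk
  exact elt_ne_elt hab hb hk.symm

/-- Each of the two sweeps costs `2 * n ^ 2`, and joining them by `(u + v) ^ 2 ≤ 2 * (u ^ 2 + v ^
2)` doubles the sum. -/
lemma route_energy_le (H : SweepData p D S) (hab : a < b) (hb : b < n)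
    (A : Finset (Perm (Fin n))) (hA : ∀ σ, σ ∈ A ↔ RouteAdj D a b σ) (f : Perm (Fin n) → ℝ) :
    ∑ σ ∈ A, min (weight p σ) (weight p (σ * flipPos n a b)) *
      (f σ - f (routeLeft S a b (b - a) σ)) ^ 2 ≤ 8 * (n : ℝ) ^ 2 * nnForm p f := by
  set m : Perm (Fin n) → ℝ := fun σ => min (weight p σ) (weight p (σ * flipPos n a b)) with hm
  have hm0 : ∀ σ, 0 ≤ m σ := fun σ => le_min (weight_pos H.pos _).le (weight_pos H.pos _).le
  have hmW : ∀ σ, m σ ≤ weight p σ := fun σ => min_le_left _ _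
  have h1 : ∑ σ ∈ A, m σ * (f (routeRight S a b 0 σ) - f (routeRight S a b (b - 1 - a) σ)) ^ 2
      ≤ 2 * (n : ℝ) ^ 2 * nnForm p f := by
    refine sum_chain_le (φ := fun k σ => routeRight S a b k σ) (T := b - 1 - a) H.pos H.total hm0 (fun k => a + k)
      (fun _ _ => True) (by omega) (fun k hk => by omega) ?_ ?_ ?_ ?_
    · intro k _ σ _
      unfold routeRight
      rw [sweepRight]
      split_ifs
      · exact Or.inr ⟨rfl, trivial⟩
      · exact Or.inl rfl
    · exact fun k hk σ hσ σ' hσ' _ _ he =>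
        H.routeRight_inj hab hb ((hA σ).1 hσ) ((hA σ').1 hσ') (k := k) (by omega) he
    · exact fun k hk σ hσ _ => (hmW σ).trans
        (H.weight_le_routeRight hab hb ((hA σ).1 hσ) (by omega))
    · exact fun k hk σ hσ _ => (hmW σ).trans
        (H.weight_le_routeRight hab hb ((hA σ).1 hσ) (by omega))
  have h2 : ∑ σ ∈ A, m σ * (f (routeLeft S a b 0 σ) - f (routeLeft S a b (b - a) σ)) ^ 2
      ≤ 2 * (n : ℝ) ^ 2 * nnForm p f := by
    refine sum_chain_le (φ := fun t σ => routeLeft S a b t σ) (T := b - a) H.pos H.total hm0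
      (fun t => b - t - 1)
      (fun t σ => elt (routeLeft S a b t σ) (b - t) = elt σ b ∧
        elt (routeLeft S a b (t + 1) σ) (b - (t + 1)) = elt σ b) (by omega)
      (fun t ht => by omega) ?_ ?_ ?_ ?_
    · intro t ht σ _
      unfold routeLeft
      rw [sweepLeft]
      split_ifs with hc
      · refine Or.inr ⟨rfl, hc.1, ?_⟩
        rw [← Nat.sub_sub, elt_adjSwap_left, Nat.sub_add_cancel (by omega), hc.1]
      · exact Or.inl rfl
    · exact fun t ht σ hσ σ' hσ' hQ hQ' he =>
        H.routeLeft_inj hab hb ((hA σ).1 hσ) ((hA σ').1 hσ') (by omega) hQ.1 hQ'.1 he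
    · exact fun t ht σ hσ hQ => (hmW σ).trans
        (H.weight_le_routeLeft hab hb ((hA σ).1 hσ) (by omega) hQ.1)
    · exact fun t ht σ hσ hQ => (hmW σ).trans
        (H.weight_le_routeLeft hab hb ((hA σ).1 hσ) (by omega) hQ.2)
  calc ∑ σ ∈ A, m σ * (f σ - f (routeLeft S a b (b - a) σ)) ^ 2
      ≤ ∑ σ ∈ A, 2 * (m σ * (f (routeRight S a b 0 σ) - f (routeRight S a b (b - 1 - a) σ)) ^ 2
          + m σ * (f (routeLeft S a b 0 σ) - f (routeLeft S a b (b - a) σ)) ^ 2) := by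
        refine Finset.sum_le_sum fun σ _ => ?_
        have e1 : routeRight S a b 0 σ = σ := rfl
        have e2 : routeLeft S a b 0 σ = routeRight S a b (b - 1 - a) σ := rfl
        rw [e1, e2, ← mul_add, mul_left_comm]
        refine mul_le_mul_of_nonneg_left ?_ (hm0 σ)
        nlinarith [sq_nonneg ((f σ - f (routeRight S a b (b - 1 - a) σ))
          - (f (routeRight S a b (b - 1 - a) σ) - f (routeLeft S a b (b - a) σ)))]
    _ ≤ _ := by
        rw [← Finset.mul_sum, Finset.sum_add_distrib]
        linarith

/-- The meeting time depends on `σ`, so the sum is split by its value `t`; for each `t` an exchange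
is used at most once, whence a single factor `n`. The weight beyond the exchange is bounded through
the route of the flipped arrangement, which is why the minimum of both weights is taken. -/
lemma meeting_energy_le (H : SweepData p D S) (hab : a < b) (hb : b < n)
    (A : Finset (Perm (Fin n))) (hA : ∀ σ, σ ∈ A ↔ RouteAdj D a b σ) (f : Perm (Fin n) → ℝ) :
    ∑ σ ∈ A, min (weight p σ) (weight p (σ * flipPos n a b)) *
      (f (routeLeft S a b (b - a) σ) - f (routeLeft S a b (b - a) (σ * flipPos n a b))) ^ 2
      ≤ 2 * n * nnForm p f := by
  set m : Perm (Fin n) → ℝ := fun σ => min (weight p σ) (weight p (σ * flipPos n a b)) with hm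
  have hm0 : ∀ σ, 0 ≤ m σ := fun σ => le_min (weight_pos H.pos _).le (weight_pos H.pos _).le
  set B : ℕ → Finset (Perm (Fin n)) := fun t => A.filter fun σ =>
    elt (routeLeft S a b t σ) (b - t) = elt σ b ∧
      elt (routeLeft S a b t σ) (b - t - 1) = elt σ a with hB
  set F : ℕ → Perm (Fin n) → ℝ := fun t σ => m σ *
    (f (routeLeft S a b t σ * adjSwap n (b - t - 1)) - f (routeLeft S a b t σ)) ^ 2 with hF
  have hF0 : ∀ t σ, 0 ≤ F t σ := fun t σ => mul_nonneg (hm0 σ) (sq_nonneg _)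
  have hadj : ∀ t < b - a, ∀ σ, elt (routeLeft S a b t σ) (b - t) = elt σ b →
      elt (routeLeft S a b t σ) (b - t - 1) = elt σ a →
      routeLeft S a b t (σ * flipPos n a b) = routeLeft S a b t σ * adjSwap n (b - t - 1) := by
    intro t ht σ e1 e2
    rw [H.routeLeft_flip hab hb, adjSwap, mul_swap_eq_swap_mul]
    congr 2
    · exact e2.symm
    · rw [Nat.sub_add_cancel (by omega)]; exact e1.symm
  have hpt : ∀ σ ∈ A, m σ * (f (routeLeft S a b (b - a) σ)
      - f (routeLeft S a b (b - a) (σ * flipPos n a b))) ^ 2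
      ≤ ∑ t ∈ Finset.range (b - a), if σ ∈ B t then F t σ else 0 := by
    intro σ hσ
    obtain ⟨t, ht, e1, e2, e3⟩ := exists_stopped (S := S) hab hb σ
    have hσB : σ ∈ B t := Finset.mem_filter.2 ⟨hσ, e1, e2⟩
    refine le_trans (le_of_eq ?_) (Finset.single_le_sum
      (f := fun t => if σ ∈ B t then F t σ else 0) (fun s _ => ?_) (Finset.mem_range.2 ht))
    · rw [if_pos hσB, hF]
      dsimp only
      rw [← hadj t ht σ e1 e2, H.routeLeft_flip hab hb, H.routeLeft_flip hab hb, e3]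
      ring
    · split_ifs
      · exact hF0 s σ
      · exact le_rfl
  have hone : ∀ t ∈ Finset.range (b - a), ∑ σ ∈ B t, F t σ ≤ 2 * nnForm p f := by
    intro t ht
    have ht := Finset.mem_range.1 ht
    refine sum_step_le (φ := fun σ => routeLeft S a b t σ) H.pos H.total (by omega) ?_ ?_ ?_
    · intro σ hσ σ' hσ' he
      have a1 := Finset.mem_filter.1 hσ
      have a2 := Finset.mem_filter.1 hσ'
      exact H.routeLeft_inj hab hb ((hA σ).1 a1.1) ((hA σ').1 a2.1) (by omega) a1.2.1 a2.2.1 he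
    · intro σ hσ
      have a1 := Finset.mem_filter.1 hσ
      exact (min_le_left _ _).trans
        (H.weight_le_routeLeft hab hb ((hA σ).1 a1.1) (by omega) a1.2.1)
    · intro σ hσ
      have a1 := Finset.mem_filter.1 hσ
      rw [← hadj t ht σ a1.2.1 a1.2.2]
      refine (min_le_right _ _).trans (H.weight_le_routeLeft hab hb
        (H.routeAdj_flip hab hb ((hA σ).1 a1.1)) (by omega) ?_)
      rw [H.routeLeft_flip hab hb, elt_mul, a1.2.1, swap_apply_right, elt_flipPos_right]
  calc ∑ σ ∈ A, m σ * _ ≤ ∑ σ ∈ A, ∑ t ∈ Finset.range (b - a), if σ ∈ B t then F t σ else 0 :=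
        Finset.sum_le_sum hpt
    _ = ∑ t ∈ Finset.range (b - a), ∑ σ ∈ B t, F t σ := by
        rw [Finset.sum_comm]
        refine Finset.sum_congr rfl fun t _ => ?_
        rw [← Finset.sum_filter, Finset.filter_mem_eq_inter,
          Finset.inter_eq_right.2 (Finset.filter_subset _ _)]
    _ ≤ ∑ t ∈ Finset.range (b - a), 2 * nnForm p f := Finset.sum_le_sum hone
    _ = (b - a : ℕ) * (2 * nnForm p f) := by
        rw [Finset.sum_const, Finset.card_range, nsmul_eq_mul]
    _ ≤ n * (2 * nnForm p f) := by
        have := nnForm_nonneg H.pos f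
        refine mul_le_mul_of_nonneg_right ?_ (by linarith)
        exact_mod_cast (by omega : b - a ≤ n)
    _ = _ := by ring

/-- The energy of the exchanges of the positions `a` and `b` is bounded by the energy of the
nearest neighbour dynamics. -/
lemma flip_energy_le (H : SweepData p D S) (hab : a < b) (hb : b < n)
    (A : Finset (Perm (Fin n))) (hA : ∀ σ, σ ∈ A ↔ RouteAdj D a b σ) (f : Perm (Fin n) → ℝ) :
    ∑ σ ∈ A, min (weight p σ) (weight p (σ * flipPos n a b)) *
      (f (σ * flipPos n a b) - f σ) ^ 2 ≤ 54 * (n : ℝ) ^ 2 * nnForm p f := by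
  set m : Perm (Fin n) → ℝ := fun σ => min (weight p σ) (weight p (σ * flipPos n a b)) with hm
  have hm0 : ∀ σ, 0 ≤ m σ := fun σ => le_min (weight_pos H.pos _).le (weight_pos H.pos _).le
  have h1 := H.route_energy_le hab hb A hA f
  have h2 := H.meeting_energy_le hab hb A hA f
  have h3 : ∑ σ ∈ A, m σ * (f (σ * flipPos n a b)
      - f (routeLeft S a b (b - a) (σ * flipPos n a b))) ^ 2
      = ∑ σ ∈ A, m σ * (f σ - f (routeLeft S a b (b - a) σ)) ^ 2 := by
    have hmem : ∀ σ ∈ A, σ * flipPos n a b ∈ A := fun σ hσ =>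
      (hA _).2 (H.routeAdj_flip hab hb ((hA σ).1 hσ))
    refine Finset.sum_nbij' (fun σ => σ * flipPos n a b) (fun σ => σ * flipPos n a b)
      hmem hmem (fun σ _ => flipPos_flipPos) (fun σ _ => flipPos_flipPos) fun σ _ => ?_
    simp only [hm, flipPos_flipPos]
    rw [min_comm]
  have hE := nnForm_nonneg H.pos f
  have hn : (1 : ℝ) ≤ n := by exact_mod_cast (by omega : 1 ≤ n)
  calc ∑ σ ∈ A, m σ * (f (σ * flipPos n a b) - f σ) ^ 2
      ≤ ∑ σ ∈ A, 3 * (m σ * (f σ - f (routeLeft S a b (b - a) σ)) ^ 2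
        + m σ * (f (routeLeft S a b (b - a) σ)
          - f (routeLeft S a b (b - a) (σ * flipPos n a b))) ^ 2
        + m σ * (f (σ * flipPos n a b)
          - f (routeLeft S a b (b - a) (σ * flipPos n a b))) ^ 2) := by
        refine Finset.sum_le_sum fun σ _ => ?_
        rw [← mul_add, ← mul_add, mul_left_comm]
        refine mul_le_mul_of_nonneg_left ?_ (hm0 σ)
        set u := f σ - f (routeLeft S a b (b - a) σ)
        set v := f (routeLeft S a b (b - a) σ) - f (routeLeft S a b (b - a) (σ * flipPos n a b))
        set w := f (σ * flipPos n a b) - f (routeLeft S a b (b - a) (σ * flipPos n a b))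
        have e : f (σ * flipPos n a b) - f σ = w - v - u := by ring
        rw [e]
        nlinarith [sq_nonneg (u - v), sq_nonneg (u + w), sq_nonneg (v + w)]
    _ ≤ 3 * (8 * (n : ℝ) ^ 2 * nnForm p f + 2 * n * nnForm p f
          + 8 * (n : ℝ) ^ 2 * nnForm p f) := by
        rw [← Finset.mul_sum, Finset.sum_add_distrib, Finset.sum_add_distrib, h3]
        linarith
    _ ≤ _ := by nlinarith [mul_nonneg (sub_nonneg.2 hn) hE]

end SweepData

end Routes

end BiasedPerm

/-! ### Lowest common ancestors, and the sweep data of a monotone league -/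

namespace BiasedPerm

variable {n : ℕ}

/-- `x` and `y` lie below different children of `v`. -/
def Separates (v : Finset (Fin n) × Finset (Fin n)) (x y : Fin n) : Prop :=
  (x ∈ v.1 ∧ y ∈ v.2) ∨ (y ∈ v.1 ∧ x ∈ v.2)

lemma Separates.symm {v : Finset (Fin n) × Finset (Fin n)} {x y : Fin n} (h : Separates v x y) :
    Separates v y x := Or.symm h

lemma separates_comm {v : Finset (Fin n) × Finset (Fin n)} {x y : Fin n} :
    Separates v x y ↔ Separates v y x := Or.comm

lemma Separates.mem_left {v : Finset (Fin n) × Finset (Fin n)} {x y : Fin n}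
    (h : Separates v x y) : x ∈ span v :=
  mem_span.2 (h.elim (fun h => Or.inl h.1) fun h => Or.inr h.2)

lemma Separates.mem_right {v : Finset (Fin n) × Finset (Fin n)} {x y : Fin n}
    (h : Separates v x y) : y ∈ span v := h.symm.mem_left

open Classical in
/-- The leaves below the lowest common ancestor of `x` and `y`. -/
noncomputable def lcaSet (N : Finset (Finset (Fin n) × Finset (Fin n))) (x y : Fin n) :
    Finset (Fin n) :=
  Finset.univ.filter fun z => ∃ v ∈ N, Separates v x y ∧ z ∈ span v

open Classical in
/-- The leaves to the left of the lowest common ancestor of `x` and `y`. -/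
noncomputable def lcaBefore (N : Finset (Finset (Fin n) × Finset (Fin n))) (x y : Fin n) :
    Finset (Fin n) :=
  Finset.univ.filter fun z => ∃ v ∈ N, Separates v x y ∧ ∀ w ∈ span v, z < w

open Classical in
/-- The leaves to the right of the lowest common ancestor of `x` and `y`. -/
noncomputable def lcaAfter (N : Finset (Finset (Fin n) × Finset (Fin n))) (x y : Fin n) :
    Finset (Fin n) :=
  Finset.univ.filter fun z => ∃ v ∈ N, Separates v x y ∧ ∀ w ∈ span v, w < z

lemma lcaSet_comm (N : Finset (Finset (Fin n) × Finset (Fin n))) (x y : Fin n) :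
    lcaSet N x y = lcaSet N y x := by
  classical
  unfold lcaSet
  exact Finset.filter_congr fun z _ => exists_congr fun v => and_congr_right fun _ =>
    and_congr_left fun _ => separates_comm

lemma lcaBefore_comm (N : Finset (Finset (Fin n) × Finset (Fin n))) (x y : Fin n) :
    lcaBefore N x y = lcaBefore N y x := by
  classical
  unfold lcaBefore
  exact Finset.filter_congr fun z _ => exists_congr fun v => and_congr_right fun _ =>
    and_congr_left fun _ => separates_comm

lemma lcaAfter_comm (N : Finset (Finset (Fin n) × Finset (Fin n))) (x y : Fin n) :
    lcaAfter N x y = lcaAfter N y x := by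
  classical
  unfold lcaAfter
  exact Finset.filter_congr fun z _ => exists_congr fun v => and_congr_right fun _ =>
    and_congr_left fun _ => separates_comm

namespace NodeFamily

variable {p : Fin n → Fin n → ℝ} {N : Finset (Finset (Fin n) × Finset (Fin n))}

lemma not_separates_of_below (hN : NodeFamily p N) {u v : Finset (Fin n) × Finset (Fin n)}
    (hv : v ∈ N) (h : Below u v) {x y : Fin n} (hx : x ∈ span u) (hy : y ∈ span u) :
    ¬Separates v x y := by
  intro hs
  rcases h with h | h | h
  · rcases hs with hs | hs
    · exact hN.disjoint hv (h hy) hs.2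
    · exact hN.disjoint hv (h hx) hs.2
  · rcases hs with hs | hs
    · exact hN.disjoint hv hs.1 (h hx)
    · exact hN.disjoint hv hs.1 (h hy)
  · exact Finset.disjoint_left.1 h hx hs.mem_left

lemma separates_unique (hN : NodeFamily p N) {u v : Finset (Fin n) × Finset (Fin n)}
    (hu : u ∈ N) (hv : v ∈ N) {x y : Fin n} (h : Separates u x y) (h' : Separates v x y) :
    u = v := by
  by_contra hne
  rcases hN.laminar u hu v hv hne with hb | hb
  · exact hN.not_separates_of_below hv hb h.mem_left h.mem_right h'
  · exact hN.not_separates_of_below hu hb h'.mem_left h'.mem_right h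

lemma exists_separates (hN : NodeFamily p N) {x y : Fin n} (h : x ≠ y) :
    ∃ v ∈ N, Separates v x y := by
  rcases lt_or_gt_of_ne h with h | h
  · obtain ⟨v, hv, h'⟩ := hN.sep x y h
    exact ⟨v, hv, Or.inl h'⟩
  · obtain ⟨v, hv, h'⟩ := hN.sep y x h
    exact ⟨v, hv, Or.inr h'⟩

lemma mem_lcaSet (hN : NodeFamily p N) {v : Finset (Fin n) × Finset (Fin n)} (hv : v ∈ N)
    {x y : Fin n} (h : Separates v x y) (z : Fin n) : z ∈ lcaSet N x y ↔ z ∈ span v := by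
  unfold lcaSet
  simp only [Finset.mem_filter, Finset.mem_univ, true_and]
  refine ⟨fun ⟨u, hu, hs, hz⟩ => ?_, fun hz => ⟨v, hv, h, hz⟩⟩
  rwa [hN.separates_unique hv hu h hs]

lemma mem_lcaBefore (hN : NodeFamily p N) {v : Finset (Fin n) × Finset (Fin n)} (hv : v ∈ N)
    {x y : Fin n} (h : Separates v x y) (z : Fin n) :
    z ∈ lcaBefore N x y ↔ ∀ w ∈ span v, z < w := by
  unfold lcaBefore
  simp only [Finset.mem_filter, Finset.mem_univ, true_and]
  refine ⟨fun ⟨u, hu, hs, hz⟩ => ?_, fun hz => ⟨v, hv, h, hz⟩⟩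
  rwa [hN.separates_unique hv hu h hs]

lemma mem_lcaAfter (hN : NodeFamily p N) {v : Finset (Fin n) × Finset (Fin n)} (hv : v ∈ N)
    {x y : Fin n} (h : Separates v x y) (z : Fin n) :
    z ∈ lcaAfter N x y ↔ ∀ w ∈ span v, w < z := by
  unfold lcaAfter
  simp only [Finset.mem_filter, Finset.mem_univ, true_and]
  refine ⟨fun ⟨u, hu, hs, hz⟩ => ?_, fun hz => ⟨v, hv, h, hz⟩⟩
  rwa [hN.separates_unique hv hu h hs]

lemma before_or_after (hN : NodeFamily p N) {v : Finset (Fin n) × Finset (Fin n)} (hv : v ∈ N)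
    {z : Fin n} (hz : z ∉ span v) : (∀ w ∈ span v, z < w) ∨ ∀ w ∈ span v, w < z := by
  by_contra! h
  obtain ⟨⟨w, hw, hwz⟩, w', hw', hwz'⟩ := h
  have h1 : w ≠ z := fun e => hz (e ▸ hw)
  have h2 : w' ≠ z := fun e => hz (e ▸ hw')
  exact hz (hN.convex v hv w hw w' hw' z (lt_of_le_of_ne hwz h1) (lt_of_le_of_ne hwz' h2.symm))

/-- The node separating `z` from `x` is not `v`, so by laminarity all of `v` lies below one of its
children, and `y` meets `z` at the same node as `x`. -/
lemma label_eq_of_notMem (hN : NodeFamily p N) {v : Finset (Fin n) × Finset (Fin n)}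
    (hv : v ∈ N) {x y z : Fin n} (hx : x ∈ span v) (hy : y ∈ span v) (hz : z ∉ span v)
    (hzx : z < x) : p z x = p z y := by
  obtain ⟨u, hu, h1, h2⟩ := hN.sep z x hzx
  have hzu : z ∈ span u := mem_span.2 (Or.inl h1)
  have huv : v ≠ u := fun e => hz (e ▸ hzu)
  obtain ⟨q, hq⟩ := hN.label u hu
  rcases hN.laminar v hv u hu huv with h | h
  · rcases h with h | h | h
    · exact (hN.disjoint hu (h hx) h2).elim
    · rw [hq z h1 x h2, hq z h1 y (h hy)]
    · exact (Finset.disjoint_left.1 h hx (mem_span.2 (Or.inr h2))).elim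
  · rcases h with h | h | h
    · exact absurd (mem_span.2 (Or.inl (h hzu))) hz
    · exact absurd (mem_span.2 (Or.inr (h hzu))) hz
    · exact (Finset.disjoint_left.1 h (mem_span.2 (Or.inr h2)) hx).elim

lemma label_eq_of_notMem' (hN : NodeFamily p N) {v : Finset (Fin n) × Finset (Fin n)}
    (hv : v ∈ N) {x y z : Fin n} (hx : x ∈ span v) (hy : y ∈ span v) (hz : z ∉ span v)
    (hzx : x < z) : p x z = p y z := by
  obtain ⟨u, hu, h1, h2⟩ := hN.sep x z hzx
  have hzu : z ∈ span u := mem_span.2 (Or.inr h2)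
  have huv : v ≠ u := fun e => hz (e ▸ hzu)
  obtain ⟨q, hq⟩ := hN.label u hu
  rcases hN.laminar v hv u hu huv with h | h
  · rcases h with h | h | h
    · rw [hq x h1 z h2, hq y (h hy) z h2]
    · exact (hN.disjoint hu h1 (h hx)).elim
    · exact (Finset.disjoint_left.1 h hx (mem_span.2 (Or.inl h1))).elim
  · rcases h with h | h | h
    · exact absurd (mem_span.2 (Or.inl (h hzu))) hz
    · exact absurd (mem_span.2 (Or.inr (h hzu))) hz
    · exact (Finset.disjoint_left.1 h (mem_span.2 (Or.inl h1)) hx).elim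

lemma flat (hN : NodeFamily p N) (htot : ∀ i j, i ≠ j → p i j + p j i = 1)
    {v : Finset (Fin n) × Finset (Fin n)} (hv : v ∈ N) {x y z : Fin n} (hx : x ∈ span v)
    (hy : y ∈ span v) (hz : z ∉ span v) : p x z = p y z ∧ p z x = p z y := by
  have hxz : x ≠ z := fun e => hz (e ▸ hx)
  have hyz : y ≠ z := fun e => hz (e ▸ hy)
  have h1 := htot x z hxz
  have h2 := htot y z hyz
  rcases lt_or_gt_of_ne hxz with h | h
  · have := hN.label_eq_of_notMem' hv hx hy hz h
    exact ⟨this, by linarith⟩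
  · have := hN.label_eq_of_notMem hv hx hy hz h
    exact ⟨by linarith, this⟩

/-- Both ancestors have `y` below them, so laminarity nests one in the other. -/
lemma lcaSet_recover (hN : NodeFamily p N) {x x' y : Fin n} (hx : x ≠ y) (hx' : x' ≠ y) :
    x' ∈ lcaSet N x y ∨ x ∈ lcaSet N x' y := by
  obtain ⟨u, hu, hs⟩ := hN.exists_separates hx
  obtain ⟨v, hv, hs'⟩ := hN.exists_separates hx'
  rw [hN.mem_lcaSet hu hs, hN.mem_lcaSet hv hs']
  by_cases huv : u = v
  · subst huv
    exact Or.inl hs'.mem_left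
  have aux : ∀ {u v : Finset (Fin n) × Finset (Fin n)}, Below u v → y ∈ span u → y ∈ span v →
      span u ⊆ span v := by
    intro u v h h1 h2
    rcases h with h | h | h
    · exact h.trans Finset.subset_union_left
    · exact h.trans Finset.subset_union_right
    · exact (Finset.disjoint_left.1 h h1 h2).elim
  rcases hN.laminar u hu v hv huv with h | h
  · exact Or.inr (aux h hs.mem_right hs'.mem_right hs.mem_left)
  · exact Or.inl (aux h hs'.mem_right hs.mem_right hs'.mem_left)

lemma lcaSet_disjoint_of_lt (hN : NodeFamily p N) {x y z : Fin n}
    (h : z ∈ lcaBefore N x y ∨ z ∈ lcaAfter N x y) : z ∉ lcaSet N x y := by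
  classical
  intro hz
  obtain ⟨v, hv, hs, hz⟩ := (Finset.mem_filter.1 hz).2
  rw [hN.mem_lcaBefore hv hs, hN.mem_lcaAfter hv hs] at h
  rcases h with h | h
  · exact lt_irrefl _ (h z hz)
  · exact lt_irrefl _ (h z hz)

lemma div_le_div_of_total (hpos : ∀ i j, i ≠ j → 0 < p i j)
    (htot : ∀ i j, i ≠ j → p i j + p j i = 1) {s y c : Fin n} (hy : s ≠ y) (hc : s ≠ c)
    (h : p s y ≤ p s c) : p s y / p y s ≤ p s c / p c s := by
  have h1 := htot s y hy
  have h2 := htot s c hc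
  exact div_le_div₀ (hpos s c hc).le h (hpos c s hc.symm) (by linarith)

/-- The data for the routes if the rows are monotone. -/
lemma sweepData (hN : NodeFamily p N) (hpos : ∀ i j, i ≠ j → 0 < p i j)
    (htot : ∀ i j, i ≠ j → p i j + p j i = 1) (hhalf : ∀ i j, i < j → 1 / 2 ≤ p i j)
    (hmono : ∀ i j k, i < j → j < k → p i j ≤ p i k) :
    SweepData p (lcaSet N) (lcaBefore N) where
  pos := hpos
  total := htot
  D_comm := lcaSet_comm N
  S_comm := lcaBefore_comm N
  left_mem x y h := by
    obtain ⟨v, hv, hs⟩ := hN.exists_separates h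
    exact (hN.mem_lcaSet hv hs x).2 hs.mem_left
  disj x y z hz := hN.lcaSet_disjoint_of_lt (Or.inl hz)
  flat x y h z hz := by
    obtain ⟨v, hv, hs⟩ := hN.exists_separates h
    rw [hN.mem_lcaSet hv hs] at hz
    exact hN.flat htot hv hs.mem_left hs.mem_right hz
  small x y h s hs' := by
    obtain ⟨v, hv, hs⟩ := hN.exists_separates h
    rw [hN.mem_lcaBefore hv hs] at hs'
    have h1 := hs' y hs.mem_right
    have h2 := hhalf s y h1
    have h3 := htot s y h1.ne
    linarith
  big x y h z hz hz' := by
    obtain ⟨v, hv, hs⟩ := hN.exists_separates h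
    rw [hN.mem_lcaBefore hv hs] at hz
    rw [hN.mem_lcaSet hv hs] at hz'
    have h1 := (hN.before_or_after hv hz').resolve_left hz y hs.mem_right
    have h2 := hhalf y z h1
    have h3 := htot y z h1.ne
    linarith
  -- The one use of row monotonicity: `c` is neither before nor below the ancestor, hence after it,
  -- and `s < y < c`.
  mono x y h s hs' c hc hc' := by
    obtain ⟨v, hv, hs⟩ := hN.exists_separates h
    rw [hN.mem_lcaBefore hv hs] at hc hs'
    rw [hN.mem_lcaSet hv hs] at hc'
    have h1 := (hN.before_or_after hv hc').resolve_left hc y hs.mem_right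
    have h2 := hs' y hs.mem_right
    exact div_le_div_of_total hpos htot h2.ne (h2.trans h1).ne (hmono s y c h2 h1)
  recover x x' y h h' _ := hN.lcaSet_recover h h'

/-- The preimage of a family of sets under reversal. -/
def revSets (D : Fin n → Fin n → Finset (Fin n)) (x y : Fin n) : Finset (Fin n) :=
  Finset.univ.filter fun z => z.rev ∈ D x.rev y.rev

lemma mem_revSets {D : Fin n → Fin n → Finset (Fin n)} {x y z : Fin n} :
    z ∈ revSets D x y ↔ z.rev ∈ D x.rev y.rev := by simp [revSets]

/-- The data for the routes of the reversed family if the columns are monotone. -/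
lemma sweepData_rev (hN : NodeFamily p N) (hpos : ∀ i j, i ≠ j → 0 < p i j)
    (htot : ∀ i j, i ≠ j → p i j + p j i = 1) (hhalf : ∀ i j, i < j → 1 / 2 ≤ p i j)
    (hmono : ∀ i j k, i < j → j < k → p j k ≤ p i k) :
    SweepData (fun i j => p j.rev i.rev) (revSets (lcaSet N)) (revSets (lcaAfter N)) := by
  have hpos' : ∀ i j : Fin n, i ≠ j → 0 < p j.rev i.rev := fun i j h =>
    hpos _ _ fun e => h (Fin.rev_injective e).symm
  have htot' : ∀ i j : Fin n, i ≠ j → p j.rev i.rev + p i.rev j.rev = 1 := fun i j h =>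
    htot _ _ fun e => h (Fin.rev_injective e).symm
  have hne : ∀ {x y : Fin n}, x ≠ y → x.rev ≠ y.rev := fun h e => h (Fin.rev_injective e)
  refine ⟨hpos', htot', fun x y => ?_, fun x y => ?_, fun x y h => ?_, fun x y z hz => ?_,
    fun x y h z hz => ?_, fun x y h s hs' => ?_, fun x y h z hz hz' => ?_,
    fun x y h s hs' c hc hc' => ?_, fun x x' y h h' _ => ?_⟩
  · unfold revSets; rw [lcaSet_comm]
  · unfold revSets; rw [lcaAfter_comm]
  · obtain ⟨v, hv, hs⟩ := hN.exists_separates (hne h)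
    exact mem_revSets.2 ((hN.mem_lcaSet hv hs _).2 hs.mem_left)
  · rw [mem_revSets] at hz ⊢
    exact hN.lcaSet_disjoint_of_lt (Or.inr hz)
  · obtain ⟨v, hv, hs⟩ := hN.exists_separates (hne h)
    rw [mem_revSets, hN.mem_lcaSet hv hs] at hz
    exact (hN.flat htot hv hs.mem_left hs.mem_right hz).symm
  · obtain ⟨v, hv, hs⟩ := hN.exists_separates (hne h)
    rw [mem_revSets, hN.mem_lcaAfter hv hs] at hs'
    have h1 := hs' _ hs.mem_right
    have h2 := hhalf _ _ h1
    have h3 := htot _ _ h1.ne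
    linarith
  · obtain ⟨v, hv, hs⟩ := hN.exists_separates (hne h)
    rw [mem_revSets, hN.mem_lcaAfter hv hs] at hz
    rw [mem_revSets, hN.mem_lcaSet hv hs] at hz'
    have h1 := (hN.before_or_after hv hz').resolve_right hz _ hs.mem_right
    have h2 := hhalf _ _ h1
    have h3 := htot _ _ h1.ne
    linarith
  · obtain ⟨v, hv, hs⟩ := hN.exists_separates (hne h)
    rw [mem_revSets, hN.mem_lcaAfter hv hs] at hc hs'
    rw [mem_revSets, hN.mem_lcaSet hv hs] at hc'
    have h1 := (hN.before_or_after hv hc').resolve_right hc _ hs.mem_right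
    have h2 := hs' _ hs.mem_right
    refine div_le_div_of_total (p := fun i j => p j.rev i.rev) hpos' htot' ?_ ?_
      (hmono _ _ _ h1 h2)
    · rintro rfl; exact lt_irrefl _ h2
    · rintro rfl; exact lt_irrefl _ (h1.trans h2)
  · simp only [mem_revSets]
    exact hN.lcaSet_recover (hne h) (hne h')

end NodeFamily

end BiasedPerm

/-! ### Reversal of positions and elements -/

namespace BiasedPerm

open Equiv

variable {n : ℕ}

/-- Reversing both the positions and the elements of an arrangement. -/
def reflect (σ : Perm (Fin n)) : Perm (Fin n) := Fin.revPerm * σ * Fin.revPerm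

lemma revPerm_mul_self : (Fin.revPerm : Perm (Fin n)) * Fin.revPerm = 1 := by
  ext i; simp

lemma reflect_reflect (σ : Perm (Fin n)) : reflect (reflect σ) = σ := by
  unfold reflect
  calc Fin.revPerm * (Fin.revPerm * σ * Fin.revPerm) * Fin.revPerm
      = (Fin.revPerm * Fin.revPerm) * σ * (Fin.revPerm * Fin.revPerm) := by
        simp only [mul_assoc]
    _ = σ := by rw [revPerm_mul_self, one_mul, mul_one]

/-- Reflection as a permutation of the arrangements. -/
def reflectEquiv (n : ℕ) : Perm (Perm (Fin n)) where
  toFun := reflect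
  invFun := reflect
  left_inv := reflect_reflect
  right_inv := reflect_reflect

lemma weight_reflect (p : Fin n → Fin n → ℝ) (σ : Perm (Fin n)) :
    weight p (reflect σ) = weight (fun i j => p j.rev i.rev) σ := by
  rw [weight_eq_prod_filter, weight_eq_prod_filter]
  refine Finset.prod_nbij' (fun z => (z.2.rev, z.1.rev)) (fun z => (z.2.rev, z.1.rev))
    ?_ ?_ ?_ ?_ ?_ <;> simp [reflect]

variable [NeZero n]

lemma rev_ofNat {r : ℕ} (h : r < n) : (Fin.ofNat n r).rev = Fin.ofNat n (n - 1 - r) := by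
  apply Fin.ext
  rw [Fin.val_rev, ofNat_val h, ofNat_val (by omega)]
  omega

lemma elt_reflect (σ : Perm (Fin n)) {r : ℕ} (h : r < n) :
    elt (reflect σ) r = (elt σ (n - 1 - r)).rev := by
  unfold elt reflect
  rw [Perm.mul_apply, Perm.mul_apply, Fin.revPerm_apply, Fin.revPerm_apply, rev_ofNat h]

lemma reflect_mul_swap (σ : Perm (Fin n)) {a b : ℕ} (ha : a < n) (hb : b < n) :
    reflect σ * flipPos n a b = reflect (σ * flipPos n (n - 1 - b) (n - 1 - a)) := by
  have h : Fin.revPerm * flipPos n a b = flipPos n (n - 1 - b) (n - 1 - a) * Fin.revPerm := by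
    unfold flipPos
    rw [mul_swap_eq_swap_mul, Fin.revPerm_apply, Fin.revPerm_apply, rev_ofNat ha, rev_ofNat hb,
      swap_comm]
  unfold reflect
  rw [mul_assoc, h]
  simp only [mul_assoc]

/-- The exchange of `r` and `r + 1` becomes that of `n - 2 - r` and `n - 1 - r`, with the same
weight and rate. Together with `flipEnergy_reflect` this reduces monotone columns to monotone rows.
-/
lemma nnForm_reflect (p : Fin n → Fin n → ℝ) (f : Perm (Fin n) → ℝ) :
    nnForm (fun i j => p j.rev i.rev) (f ∘ reflect) = nnForm p f := by
  unfold nnForm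
  rw [← Equiv.sum_comp (reflectEquiv n)]
  refine Finset.sum_congr rfl fun σ _ => ?_
  rw [← Finset.sum_range_reflect]
  refine Finset.sum_congr rfl fun r hr => ?_
  have hr := Finset.mem_range.1 hr
  have e1 : reflectEquiv n σ = reflect σ := rfl
  have e2 : reflect (reflect σ * adjSwap n (n - 1 - 1 - r)) = σ * adjSwap n r := by
    have := reflect_mul_swap σ (a := n - 1 - 1 - r) (b := n - 1 - 1 - r + 1) (by omega)
      (by omega)
    rw [show n - 1 - (n - 1 - 1 - r + 1) = r by omega,
      show n - 1 - (n - 1 - 1 - r) = r + 1 by omega] at this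
    unfold adjSwap
    unfold flipPos at this
    rw [this, reflect_reflect]
  rw [e1, Function.comp_apply, Function.comp_apply, e2, reflect_reflect, ← weight_reflect,
    reflect_reflect, elt_reflect σ (by omega), elt_reflect σ (by omega),
    show n - 1 - (n - 1 - 1 - r + 1) = r by omega,
    show n - 1 - (n - 1 - 1 - r) = r + 1 by omega]
  simp only [Fin.rev_rev]

open Classical in
/-- The energy of the exchanges of the positions `a` and `b`. -/
noncomputable def flipEnergy (p : Fin n → Fin n → ℝ) (D : Fin n → Fin n → Finset (Fin n))
    (f : Perm (Fin n) → ℝ) (a b : ℕ) : ℝ :=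
  ∑ σ, if RouteAdj D a b σ then min (weight p σ) (weight p (σ * flipPos n a b)) *
    (f (σ * flipPos n a b) - f σ) ^ 2 else 0

lemma SweepData.flipEnergy_le {p : Fin n → Fin n → ℝ} {D S : Fin n → Fin n → Finset (Fin n)}
    (H : SweepData p D S) {a b : ℕ} (hab : a < b) (hb : b < n) (f : Perm (Fin n) → ℝ) :
    flipEnergy p D f a b ≤ 54 * (n : ℝ) ^ 2 * nnForm p f := by
  classical
  unfold flipEnergy
  rw [← Finset.sum_filter]
  exact H.flip_energy_le hab hb _ (fun σ => by simp) f

lemma routeAdj_reflect {D : Fin n → Fin n → Finset (Fin n)} (hD : ∀ x y, D x y = D y x) {a b : ℕ} (hab : a < b) (hb : b < n)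
    (σ : Perm (Fin n)) : RouteAdj D a b (reflect σ) ↔
      RouteAdj (NodeFamily.revSets D) (n - 1 - b) (n - 1 - a) σ := by
  unfold RouteAdj
  simp only [NodeFamily.mem_revSets]
  rw [elt_reflect σ (by omega), elt_reflect σ hb, hD]
  constructor
  · intro h j h1 h2
    have := h (n - 1 - j) (by omega) (by omega)
    rw [elt_reflect σ (by omega), show n - 1 - (n - 1 - j) = j by omega] at this
    exact this
  · intro h j h1 h2
    rw [elt_reflect σ (by omega)]
    exact h (n - 1 - j) (by omega) (by omega)

lemma flipEnergy_reflect (p : Fin n → Fin n → ℝ) {D : Fin n → Fin n → Finset (Fin n)}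
    (hD : ∀ x y, D x y = D y x) (f : Perm (Fin n) → ℝ) {a b : ℕ} (hab : a < b) (hb : b < n) :
    flipEnergy p D f a b = flipEnergy (fun i j => p j.rev i.rev) (NodeFamily.revSets D)
      (f ∘ reflect) (n - 1 - b) (n - 1 - a) := by
  classical
  unfold flipEnergy
  rw [← Equiv.sum_comp (reflectEquiv n)]
  refine Finset.sum_congr rfl fun σ _ => ?_
  have e1 : reflectEquiv n σ = reflect σ := rfl
  rw [e1, Function.comp_apply, Function.comp_apply, reflect_mul_swap σ (by omega) hb,
    weight_reflect, weight_reflect]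
  simp only [routeAdj_reflect hD hab hb]

end BiasedPerm

/-! ### Comparison of the two Dirichlet forms -/

namespace BiasedPerm

open Equiv

variable {n : ℕ} {p : Fin n → Fin n → ℝ} {N : Finset (Finset (Fin n) × Finset (Fin n))}
  {q : Finset (Fin n) × Finset (Fin n) → ℝ}

/-- Whatever stands between `x` and `y` is not below `v`, so it compares alike with both and only
the factor of the pair itself changes. -/
lemma weight_mul_swap_of_consec (hN : NodeFamily p N) (hpos : ∀ i j, i ≠ j → 0 < p i j)
    (htot : ∀ i j, i ≠ j → p i j + p j i = 1) {v : Finset (Fin n) × Finset (Fin n)} (hv : v ∈ N)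
    {x y : Fin n} (hx : x ∈ span v) (hy : y ∈ span v) {σ : Perm (Fin n)}
    (hc : Consec (span v) σ x y) (hxy : σ⁻¹ x < σ⁻¹ y) :
    weight p (swap x y * σ) * p x y = weight p σ * p y x := by
  have h := weight_mul_swap_of_flat hpos (σ⁻¹ y - σ⁻¹ x - 1 : ℕ) (σ⁻¹ x) (σ⁻¹ y)
    (by have : (σ⁻¹ x : ℕ) < σ⁻¹ y := hxy
        omega) σ
    (fun c h1 h2 => by
      have hn : σ c ∉ span v := fun hm => (hc _ hm).1 (by simpa using ⟨h1, h2⟩)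
      simpa using hN.flat htot hv hx hy hn)
  rw [mul_swap_eq_swap_mul] at h
  simpa using h

lemma NodeFamily.exists_label (hN : NodeFamily p N) {pmax : ℝ} (hpmax : pmax < 1)
    (hmax : ∀ i j, i ≠ j → p i j ≤ pmax) (hhalf : ∀ i j, i < j → 1 / 2 ≤ p i j)
    (htot : ∀ i j, i ≠ j → p i j + p j i = 1) :
    ∃ q : Finset (Fin n) × Finset (Fin n) → ℝ, (∀ v ∈ N, 1 / 2 ≤ q v) ∧ (∀ v ∈ N, q v < 1) ∧
      ∀ v ∈ N, ∀ x ∈ v.1, ∀ y ∈ v.2, p x y = q v ∧ p y x = 1 - q v := by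
  have h : ∀ v ∈ N, ∃ q : ℝ, 1 / 2 ≤ q ∧ q < 1 ∧
      ∀ x ∈ v.1, ∀ y ∈ v.2, p x y = q ∧ p y x = 1 - q := by
    intro v hv
    by_cases hne : ∃ x ∈ v.1, ∃ y ∈ v.2, True
    · obtain ⟨x, hx, y, hy, -⟩ := hne
      obtain ⟨q, hq⟩ := hN.label v hv
      have hlt := hN.lt v hv x hx y hy
      have hqe := hq x hx y hy
      refine ⟨q, hqe ▸ hhalf x y hlt, hqe ▸ (hmax x y hlt.ne).trans_lt hpmax,
        fun x' hx' y' hy' => ?_⟩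
      have h1 := hq x' hx' y' hy'
      have h2 := htot x' y' (hN.lt v hv x' hx' y' hy').ne
      exact ⟨h1, by linarith⟩
    -- A node with an empty side separates nothing; `1 / 2` is a dummy label.
    · exact ⟨1 / 2, le_rfl, by norm_num, fun x hx y hy => (hne ⟨x, hx, y, hy, trivial⟩).elim⟩
  choose! q h1 h2 h3 using h
  exact ⟨q, h1, h2, h3⟩

lemma NodeFamily.nodeReversible (hN : NodeFamily p N) (hpos : ∀ i j, i ≠ j → 0 < p i j)
    (htot : ∀ i j, i ≠ j → p i j + p j i = 1)
    (hq : ∀ v ∈ N, ∀ x ∈ v.1, ∀ y ∈ v.2, p x y = q v ∧ p y x = 1 - q v) :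
    NodeReversible q N (weight p) := by
  intro v hv x hx y hy σ hc
  obtain ⟨e1, e2⟩ := hq v hv x hx y hy
  have hxv : x ∈ span v := mem_span.2 (Or.inl hx)
  have hyv : y ∈ span v := mem_span.2 (Or.inr hy)
  unfold nodeRate
  rw [inv_swap_mul_left, inv_swap_mul_right, ← e2, ← e1]
  have hne : x ≠ y := (hN.lt v hv x hx y hy).ne
  rcases lt_or_gt_of_ne (fun h => hne (σ⁻¹.injective h) : σ⁻¹ x ≠ σ⁻¹ y) with h | h
  · rw [if_neg h.not_gt, if_pos h]
    exact weight_mul_swap_of_consec hN hpos htot hv hxv hyv hc h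
  · rw [if_pos h, if_neg h.not_gt, swap_comm]
    exact weight_mul_swap_of_consec hN hpos htot hv hyv hxv hc.symm h

/-- By reversibility the conductance is weight times rate at either end, and rates are at most one.
-/
lemma conductance_le (hpos : ∀ i j, i ≠ j → 0 < p i j)
    (hq0 : ∀ v ∈ N, 1 / 2 ≤ q v) (hq1 : ∀ v ∈ N, q v < 1)
    (hW : NodeReversible q N (weight p)) {v : Finset (Fin n) × Finset (Fin n)} (hv : v ∈ N)
    {z : Fin n × Fin n} (hz : z ∈ v.1 ×ˢ v.2) (σ : Perm (Fin n)) :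
    conductance q (weight p) v z σ ≤ if Consec (span v) σ z.1 z.2 then
      min (weight p σ) (weight p (swap z.1 z.2 * σ)) else 0 := by
  obtain ⟨hx, hy⟩ := Finset.mem_product.1 hz
  unfold conductance
  split_ifs with hc
  · refine le_min ?_ ?_
    · exact mul_le_of_le_one_right (weight_pos hpos σ).le
        (nodeRate_mem (hq0 v hv) (hq1 v hv) σ z.1 z.2).2
    · rw [← hW v hv z.1 hx z.2 hy σ hc]
      exact mul_le_of_le_one_right (weight_pos hpos _).le
        (nodeRate_mem (hq0 v hv) (hq1 v hv) _ z.1 z.2).2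
  · exact le_rfl

variable [NeZero n]

lemma elt_val (σ : Perm (Fin n)) (k : Fin n) : elt σ k = σ k := by
  unfold elt
  congr 1
  exact Fin.ext (ofNat_val k.2)

lemma routeAdj_of_consec (hN : NodeFamily p N) {v : Finset (Fin n) × Finset (Fin n)} (hv : v ∈ N)
    {x y : Fin n} (hs : Separates v x y) {σ : Perm (Fin n)} (hc : Consec (span v) σ x y) :
    RouteAdj (lcaSet N) (σ⁻¹ x : Fin n) (σ⁻¹ y : Fin n) σ := by
  intro j h1 h2
  have hj : j < n := h2.trans (σ⁻¹ y).2
  have hx : σ (σ⁻¹ x) = x := by simp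
  have hy : σ (σ⁻¹ y) = y := by simp
  rw [elt_val, elt_val, hx, hy, hN.mem_lcaSet hv hs]
  intro hm
  have := (hc _ hm).1
  have e : elt σ j = σ ⟨j, hj⟩ := elt_val σ ⟨j, hj⟩
  rw [e] at this
  exact this (by simpa using ⟨h1, h2⟩)

lemma mul_flipPos_inv (σ : Perm (Fin n)) (x y : Fin n) :
    σ * flipPos n (σ⁻¹ x : Fin n) (σ⁻¹ y : Fin n) = swap x y * σ := by
  have hx : σ (σ⁻¹ x) = x := by simp
  have hy : σ (σ⁻¹ y) = y := by simp
  rw [mul_flipPos, elt_val, elt_val, hx, hy]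

/-- Every exchange at a node is an exchange of two positions, and different exchanges belong to
different pairs of positions. -/
lemma sum_consec_le (hN : NodeFamily p N) (hpos : ∀ i j, i ≠ j → 0 < p i j)
    (f : Perm (Fin n) → ℝ) (σ : Perm (Fin n)) [DecidablePred fun z : ℕ × ℕ =>
      RouteAdj (lcaSet N) z.1 z.2 σ] :
    ∑ v ∈ N, ∑ z ∈ v.1 ×ˢ v.2, (if Consec (span v) σ z.1 z.2 then
      min (weight p σ) (weight p (swap z.1 z.2 * σ)) * (f (swap z.1 z.2 * σ) - f σ) ^ 2 else 0)
    ≤ ∑ z ∈ (Finset.range n ×ˢ Finset.range n).filter (fun z => z.1 < z.2),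
      (if RouteAdj (lcaSet N) z.1 z.2 σ then min (weight p σ) (weight p (σ * flipPos n z.1 z.2)) *
        (f (σ * flipPos n z.1 z.2) - f σ) ^ 2 else 0) := by
  classical
  rw [Finset.sum_sigma']
  set G : ℕ × ℕ → ℝ := fun z => if RouteAdj (lcaSet N) z.1 z.2 σ then
    min (weight p σ) (weight p (σ * flipPos n z.1 z.2)) *
        (f (σ * flipPos n z.1 z.2) - f σ) ^ 2 else 0 with hG
  have hG0 : ∀ z, 0 ≤ G z := by
    intro z
    rw [hG]
    dsimp only
    split_ifs
    · exact mul_nonneg (le_min (weight_pos hpos _).le (weight_pos hpos _).le) (sq_nonneg _)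
    · exact le_rfl
  set e : (Σ _ : Finset (Fin n) × Finset (Fin n), Fin n × Fin n) → ℕ × ℕ := fun i =>
    if σ⁻¹ i.2.1 < σ⁻¹ i.2.2 then ((σ⁻¹ i.2.1 : Fin n), (σ⁻¹ i.2.2 : Fin n))
    else ((σ⁻¹ i.2.2 : Fin n), (σ⁻¹ i.2.1 : Fin n)) with he
  have hmem : ∀ i ∈ N.sigma fun v => v.1 ×ˢ v.2,
      i.1 ∈ N ∧ i.2.1 ∈ i.1.1 ∧ i.2.2 ∈ i.1.2 ∧ σ⁻¹ i.2.1 ≠ σ⁻¹ i.2.2 := by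
    intro i hi
    obtain ⟨h1, h2⟩ := Finset.mem_sigma.1 hi
    obtain ⟨h3, h4⟩ := Finset.mem_product.1 h2
    exact ⟨h1, h3, h4, fun h => (hN.lt _ h1 _ h3 _ h4).ne (σ⁻¹.injective h)⟩
  have hle : ∀ i ∈ N.sigma fun v => v.1 ×ˢ v.2, (if Consec (span i.1) σ i.2.1 i.2.2 then
      min (weight p σ) (weight p (swap i.2.1 i.2.2 * σ)) *
        (f (swap i.2.1 i.2.2 * σ) - f σ) ^ 2 else 0) ≤ G (e i) := by
    intro i hi
    obtain ⟨h1, h2, h3, -⟩ := hmem i hi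
    by_cases hc : Consec (span i.1) σ i.2.1 i.2.2
    · rw [if_pos hc, hG, he]
      dsimp only
      split_ifs with hlt hr hr
      · rw [mul_flipPos_inv]
      · exact absurd (routeAdj_of_consec hN h1 (Or.inl ⟨h2, h3⟩) hc) hr
      · rw [mul_flipPos_inv, swap_comm i.2.2]
      · exact absurd (routeAdj_of_consec hN h1 (Or.inr ⟨h2, h3⟩) hc.symm) hr
    · rw [if_neg hc]
      exact hG0 _
  -- For fixed `σ` the two positions give the unordered pair of elements, the pair gives the node
  -- that separates it, and the sides of the node give the order of the pair.
  have hinj : Set.InjOn e (N.sigma fun v => v.1 ×ˢ v.2 : Finset _) := by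
    rintro ⟨v, x, y⟩ hi ⟨v', x', y'⟩ hi' hee
    obtain ⟨h1, h2, h3, -⟩ := hmem _ hi
    obtain ⟨h1', h2', h3', -⟩ := hmem _ hi'
    have hcase : (x = x' ∧ y = y') ∨ (x = y' ∧ y = x') := by
      rw [he] at hee
      dsimp only at hee
      split_ifs at hee <;>
        simp only [Prod.mk.injEq, Fin.val_inj, EmbeddingLike.apply_eq_iff_eq] at hee <;> tauto
    dsimp only at h1 h2 h3 h1' h2' h3'
    rcases hcase with ⟨rfl, rfl⟩ | ⟨rfl, rfl⟩
    · obtain rfl := hN.separates_unique h1 h1' (Or.inl ⟨h2, h3⟩) (Or.inl ⟨h2', h3'⟩)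
      rfl
    · obtain rfl := hN.separates_unique h1 h1' (Or.inl ⟨h2, h3⟩) (Or.inr ⟨h2', h3'⟩)
      exact (hN.disjoint h1 h2 h3').elim
  refine (Finset.sum_le_sum hle).trans ?_
  rw [← Finset.sum_image (f := G) hinj]
  refine Finset.sum_le_sum_of_subset_of_nonneg ?_ fun z _ _ => hG0 z
  intro z hz
  obtain ⟨i, hi, rfl⟩ := Finset.mem_image.1 hz
  obtain ⟨-, -, -, hne⟩ := hmem i hi
  rw [he]
  dsimp only
  rw [Finset.mem_filter, Finset.mem_product, Finset.mem_range, Finset.mem_range]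
  split_ifs with hlt
  · exact ⟨⟨(σ⁻¹ i.2.1).2, (σ⁻¹ i.2.2).2⟩, hlt⟩
  · exact ⟨⟨(σ⁻¹ i.2.2).2, (σ⁻¹ i.2.1).2⟩, (lt_of_le_of_ne (not_lt.1 hlt) hne.symm : σ⁻¹ i.2.2 < σ⁻¹ i.2.1)⟩

/-- At most `n ^ 2` pairs of positions contribute `54 * n ^ 2` each, and the form carries the factor
`1 / 2`. -/
lemma treeForm_le (hN : NodeFamily p N) (hpos : ∀ i j, i ≠ j → 0 < p i j)
    (hq0 : ∀ v ∈ N, 1 / 2 ≤ q v) (hq1 : ∀ v ∈ N, q v < 1)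
    (hW : NodeReversible q N (weight p)) (f : Perm (Fin n) → ℝ)
    (hflip : ∀ a b, a < b → b < n →
      flipEnergy p (lcaSet N) f a b ≤ 54 * (n : ℝ) ^ 2 * nnForm p f) :
    treeForm q N (weight p) f f ≤ 27 * (n : ℝ) ^ 4 * nnForm p f := by
  classical
  have hE := nnForm_nonneg hpos f
  have h1 : ∑ v ∈ N, ∑ z ∈ v.1 ×ˢ v.2, ∑ σ, conductance q (weight p) v z σ *
      ((f (swap z.1 z.2 * σ) - f σ) * (f (swap z.1 z.2 * σ) - f σ))
      ≤ ∑ v ∈ N, ∑ z ∈ v.1 ×ˢ v.2, ∑ σ, (if Consec (span v) σ z.1 z.2 then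
      min (weight p σ) (weight p (swap z.1 z.2 * σ)) *
        (f (swap z.1 z.2 * σ) - f σ) ^ 2 else 0) := by
    refine Finset.sum_le_sum fun v hv => Finset.sum_le_sum fun z hz =>
      Finset.sum_le_sum fun σ _ => ?_
    rw [← sq, ← ite_zero_mul]
    exact mul_le_mul_of_nonneg_right (conductance_le hpos hq0 hq1 hW hv hz σ) (sq_nonneg _)
  have h2 : ∑ v ∈ N, ∑ z ∈ v.1 ×ˢ v.2, ∑ σ, (if Consec (span v) σ z.1 z.2 then
      min (weight p σ) (weight p (swap z.1 z.2 * σ)) *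
        (f (swap z.1 z.2 * σ) - f σ) ^ 2 else 0)
      ≤ ∑ z ∈ (Finset.range n ×ˢ Finset.range n).filter (fun z => z.1 < z.2),
        flipEnergy p (lcaSet N) f z.1 z.2 := by
    have hcomm : ∀ v ∈ N, ∑ z ∈ v.1 ×ˢ v.2, ∑ σ, (if Consec (span v) σ z.1 z.2 then
        min (weight p σ) (weight p (swap z.1 z.2 * σ)) *
          (f (swap z.1 z.2 * σ) - f σ) ^ 2 else 0)
        = ∑ σ, ∑ z ∈ v.1 ×ˢ v.2, (if Consec (span v) σ z.1 z.2 then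
        min (weight p σ) (weight p (swap z.1 z.2 * σ)) *
          (f (swap z.1 z.2 * σ) - f σ) ^ 2 else 0) := fun v _ => Finset.sum_comm
    rw [Finset.sum_congr rfl hcomm, Finset.sum_comm]
    unfold flipEnergy
    rw [Finset.sum_comm (s := (Finset.range n ×ˢ Finset.range n).filter fun z => z.1 < z.2)]
    exact Finset.sum_le_sum fun σ _ => sum_consec_le hN hpos f σ
  have h3 : ∑ z ∈ (Finset.range n ×ˢ Finset.range n).filter (fun z => z.1 < z.2),
      flipEnergy p (lcaSet N) f z.1 z.2
      ≤ (n : ℝ) ^ 2 * (54 * (n : ℝ) ^ 2 * nnForm p f) := by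
    refine (Finset.sum_le_sum (g := fun _ => 54 * (n : ℝ) ^ 2 * nnForm p f)
      fun z hz => ?_).trans ?_
    · obtain ⟨hz1, hz2⟩ := Finset.mem_filter.1 hz
      exact hflip _ _ hz2 (Finset.mem_range.1 (Finset.mem_product.1 hz1).2)
    · rw [Finset.sum_const, nsmul_eq_mul]
      refine mul_le_mul_of_nonneg_right ?_ (by positivity)
      have := Finset.card_filter_le (Finset.range n ×ˢ Finset.range n) fun z => z.1 < z.2
      rw [Finset.card_product, Finset.card_range] at this
      rw [sq]
      exact_mod_cast this
  unfold treeForm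
  linarith

/-- The Poincaré inequality for the nearest neighbour dynamics. -/
lemma nn_poincare (hn : 2 ≤ n) (hN : NodeFamily p N) (hpos : ∀ i j, i ≠ j → 0 < p i j)
    (htot : ∀ i j, i ≠ j → p i j + p j i = 1) (hmono : WeaklyMonotone p) {pmax : ℝ}
    (hpmax : pmax < 1) (hmax : ∀ i j, i ≠ j → p i j ≤ pmax) (f : Perm (Fin n) → ℝ)
    (hf : ∑ σ, weight p σ * f σ = 0) :
    ∑ σ, weight p σ * f σ ^ 2 ≤ 27 * (n : ℝ) ^ 6 * nnForm p f := by
  obtain ⟨hhalf, hmono⟩ := hmono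
  obtain ⟨q, hq0, hq1, hq⟩ := hN.exists_label hpmax hmax hhalf htot
  have hW := hN.nodeReversible hpos htot hq
  have h1 := hN.poincare hn hq0 hq1 (weight_pos hpos) hW f hf
  have hflip : ∀ a b, a < b → b < n →
      flipEnergy p (lcaSet N) f a b ≤ 54 * (n : ℝ) ^ 2 * nnForm p f := by
    intro a b hab hb
    rcases hmono with hm | hm
    · have hm' : ∀ (d : ℕ) (i j k : Fin n), i < j → (k : ℕ) = j + d → p i j ≤ p i k := by
        intro d
        induction d with
        | zero =>
          intro i j k _ hk
          rw [Fin.ext (by simpa using hk : (k : ℕ) = j)]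
        | succ d ih =>
          intro i j k hij hk
          have hlt : (j : ℕ) + d < n := by omega
          refine (ih i j ⟨j + d, hlt⟩ hij rfl).trans (hm i _ k ?_ (by dsimp only; omega))
          rw [Fin.lt_def] at hij ⊢
          dsimp only
          omega
      exact (hN.sweepData hpos htot hhalf fun i j k hij hjk =>
        hm' (k - j) i j k hij (by rw [Fin.lt_def] at hjk; omega)).flipEnergy_le hab hb f
    · have hm' : ∀ (d : ℕ) (i j k : Fin n), j < k → (j : ℕ) = i + d → p j k ≤ p i k := by
        intro d
        induction d with
        | zero =>
          intro i j k _ hj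
          rw [Fin.ext (by simpa using hj : (j : ℕ) = i)]
        | succ d ih =>
          intro i j k hjk hj
          have hlt : (i : ℕ) + d < n := by omega
          refine (hm j ⟨i + d, hlt⟩ k hjk (by dsimp only; omega)).trans
            (ih i ⟨i + d, hlt⟩ k ?_ rfl)
          rw [Fin.lt_def] at hjk ⊢
          dsimp only
          omega
      rw [flipEnergy_reflect p (lcaSet_comm N) f hab hb, ← nnForm_reflect]
      exact (hN.sweepData_rev hpos htot hhalf fun i j k hij hjk =>
        hm' (j - i) i j k hjk (by rw [Fin.lt_def] at hij; omega)).flipEnergy_le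
          (by omega) (by omega) _
  have h2 := treeForm_le hN hpos hq0 hq1 hW f hflip
  calc ∑ σ, weight p σ * f σ ^ 2 ≤ (n : ℝ) ^ 2 * treeForm q N (weight p) f f := h1
    _ ≤ (n : ℝ) ^ 2 * (27 * (n : ℝ) ^ 4 * nnForm p f) :=
        mul_le_mul_of_nonneg_left h2 (by positivity)
    _ = _ := by ring

end BiasedPerm

/-! ### From mean square contraction to the mixing time -/

namespace BiasedPerm

section Reversible

variable {Ω : Type} [Fintype Ω] {P : Matrix Ω Ω ℝ} {w : Ω → ℝ}

lemma sum_mul_mulVec (hrow : ∀ x, ∑ y, P x y = 1) (hrev : ∀ x y, w x * P x y = w y * P y x)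
    (f : Ω → ℝ) : ∑ x, w x * P.mulVec f x = ∑ x, w x * f x := by
  simp only [Matrix.mulVec, dotProduct, Finset.mul_sum]
  rw [Finset.sum_comm]
  refine Finset.sum_congr rfl fun y _ => ?_
  simp only [← mul_assoc, hrev _ y]
  rw [← Finset.sum_mul, ← Finset.mul_sum, hrow, mul_one]

variable [DecidableEq Ω]

lemma pow_detailed_balance (hrev : ∀ x y, w x * P x y = w y * P y x) (t : ℕ) (x y : Ω) :
    w x * (P ^ t) x y = w y * (P ^ t) y x := by
  induction t generalizing x y with
  | zero =>
    by_cases h : x = y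
    · rw [h]
    · simp [Matrix.one_apply_ne h, Matrix.one_apply_ne (Ne.symm h)]
  | succ t ih =>
    rw [pow_succ, Matrix.mul_apply, ← pow_succ, pow_succ', Matrix.mul_apply, Finset.mul_sum,
      Finset.mul_sum]
    refine Finset.sum_congr rfl fun z _ => ?_
    rw [← mul_assoc, ih, mul_right_comm, hrev, mul_right_comm, mul_assoc]
    ring

lemma pow_row_sum (hrow : ∀ x, ∑ y, P x y = 1) (t : ℕ) (x : Ω) : ∑ y, (P ^ t) x y = 1 := by
  induction t generalizing x with
  | zero => simp [Matrix.one_apply]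
  | succ t ih =>
    rw [pow_succ']
    simp only [Matrix.mul_apply]
    rw [Finset.sum_comm]
    simp only [← Finset.mul_sum, ih, mul_one, hrow]

lemma sum_sq_pow_mulVec_le (hrow : ∀ x, ∑ y, P x y = 1)
    (hrev : ∀ x y, w x * P x y = w y * P y x) {c : ℝ} (hc : 0 ≤ c)
    (hgap : ∀ f : Ω → ℝ, ∑ x, w x * f x = 0 →
      ∑ x, w x * P.mulVec f x ^ 2 ≤ c * ∑ x, w x * f x ^ 2)
    (f : Ω → ℝ) (hf : ∑ x, w x * f x = 0) (t : ℕ) :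
    ∑ x, w x * (P ^ t).mulVec f x = 0 ∧
      ∑ x, w x * (P ^ t).mulVec f x ^ 2 ≤ c ^ t * ∑ x, w x * f x ^ 2 := by
  induction t with
  | zero => simpa using hf
  | succ t ih =>
    rw [pow_succ' P, ← Matrix.mulVec_mulVec]
    refine ⟨by rw [sum_mul_mulVec hrow hrev]; exact ih.1, (hgap _ ih.1).trans ?_⟩
    rw [pow_succ', mul_assoc]
    exact mul_le_mul_of_nonneg_left ih.2 hc

/-- A contraction in the mean square gives exponential convergence in total variation. -/
lemma sq_sum_abs_pow_sub_le (hw : ∀ x, 0 < w x) (hw1 : ∑ x, w x = 1)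
    (hrow : ∀ x, ∑ y, P x y = 1) (hrev : ∀ x y, w x * P x y = w y * P y x) {c : ℝ} (hc : 0 ≤ c)
    (hgap : ∀ f : Ω → ℝ, ∑ x, w x * f x = 0 →
      ∑ x, w x * P.mulVec f x ^ 2 ≤ c * ∑ x, w x * f x ^ 2) (t : ℕ) (x : Ω) :
    (∑ y, |(P ^ t) x y - w y|) ^ 2 ≤ c ^ t / w x := by
  -- This is the density of the point mass at `x`, minus one. By reversibility its image under `P ^
  -- t` is the density of the law after `t` steps, minus one.
  set f : Ω → ℝ := fun y => (if y = x then (w x)⁻¹ else 0) - 1 with hf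
  have hx := (hw x).ne'
  have hf0 : ∑ y, w y * f y = 0 := by
    simp [hf, mul_sub, Finset.sum_sub_distrib, hw1, hx]
  have hf2 : ∑ y, w y * f y ^ 2 ≤ (w x)⁻¹ := by
    have h1 : ∀ y, w y * f y ^ 2 = (if y = x then (w x)⁻¹ - 1 else 0) - w y * f y := by
      intro y
      rw [hf]
      dsimp only
      split_ifs with h
      · rw [h]
        field_simp
      · ring
    rw [Finset.sum_congr rfl fun y _ => h1 y, Finset.sum_sub_distrib, hf0]
    simp
  have hval : ∀ y, (P ^ t) x y - w y = w y * (P ^ t).mulVec f y := by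
    intro y
    have h2 : (P ^ t).mulVec f y = (P ^ t) y x * (w x)⁻¹ - 1 := by
      simp [Matrix.mulVec, dotProduct, hf, mul_sub, Finset.sum_sub_distrib, pow_row_sum hrow]
    rw [h2, mul_sub, ← mul_assoc, ← pow_detailed_balance hrev t x y]
    field_simp
  have h3 := (sum_sq_pow_mulVec_le hrow hrev hc hgap f hf0 t).2
  calc (∑ y, |(P ^ t) x y - w y|) ^ 2 = (∑ y, w y * |(P ^ t).mulVec f y|) ^ 2 := by
        congr 1
        exact Finset.sum_congr rfl fun y _ => by rw [hval, abs_mul, abs_of_pos (hw y)]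
    _ ≤ (∑ y, w y) * ∑ y, w y * (P ^ t).mulVec f y ^ 2 := by
        refine Finset.sum_sq_le_sum_mul_sum_of_sq_le_mul _ (fun y _ => (hw y).le)
          (fun y _ => mul_nonneg (hw y).le (sq_nonneg _)) fun y _ => ?_
        rw [mul_pow, sq_abs]
        exact le_of_eq (by ring)
    _ ≤ c ^ t * ∑ y, w y * f y ^ 2 := by rwa [hw1, one_mul]
    _ ≤ c ^ t / w x := by
        rw [div_eq_mul_inv]
        exact mul_le_mul_of_nonneg_left hf2 (pow_nonneg hc t)

lemma exists_isMixingTime_le [Nonempty Ω] (hw : ∀ x, 0 < w x) (hw1 : ∑ x, w x = 1)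
    (hrow : ∀ x, ∑ y, P x y = 1) (hrev : ∀ x y, w x * P x y = w y * P y x) {K B : ℝ}
    (hK : 1 ≤ K)
    (hgap : ∀ f : Ω → ℝ, ∑ x, w x * f x = 0 →
      ∑ x, w x * P.mulVec f x ^ 2 ≤ (1 - 1 / K) * ∑ x, w x * f x ^ 2)
    (hB : ∀ x, (w x)⁻¹ ≤ Real.exp B) (hB0 : 0 ≤ B) {ε : ℝ} (hε : 0 < ε) (hε1 : ε < 1) :
    ∃ τ : ℕ, IsMixingTime P w ε τ ∧ (τ : ℝ) ≤ K * (B + 2 * Real.log (1 / ε)) + 1 := by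
  classical
  have hK0 : 0 < K := by linarith
  have hc : 0 ≤ 1 - 1 / K := by
    rw [sub_nonneg, div_le_one hK0]
    exact hK
  have hlog : 0 ≤ Real.log (1 / ε) := Real.log_nonneg (by rw [le_div_iff₀ hε]; linarith)
  -- Chosen to make `exp (B - s / K) = ε ^ 2`.
  set s := K * (B + 2 * Real.log (1 / ε)) with hs
  have hs0 : 0 ≤ s := by positivity
  have hmem : ⌈s⌉₊ ∈ {t : ℕ | ∀ t' : ℕ, t ≤ t' → tvDist P w t' ≤ ε} := by
    intro t ht
    have hst : s ≤ t := (Nat.le_ceil s).trans (by exact_mod_cast ht)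
    refine ciSup_le fun x => ?_
    have h1 := sq_sum_abs_pow_sub_le hw hw1 hrow hrev hc hgap t x
    have h2 : (1 - 1 / K) ^ t ≤ Real.exp (-(t / K)) := by
      calc (1 - 1 / K) ^ t ≤ Real.exp (-(1 / K)) ^ t :=
            pow_le_pow_left₀ hc (Real.one_sub_le_exp_neg _) t
        _ = Real.exp (-(t / K)) := by
            rw [← Real.exp_nat_mul]
            congr 1
            ring
    have h3 : B + 2 * Real.log (1 / ε) ≤ t / K := by
      rw [le_div_iff₀ hK0, mul_comm]
      exact hst
    have h4 : (1 - 1 / K) ^ t / w x ≤ ε ^ 2 := by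
      calc (1 - 1 / K) ^ t / w x = (1 - 1 / K) ^ t * (w x)⁻¹ := div_eq_mul_inv _ _
        _ ≤ Real.exp (-(t / K)) * Real.exp B :=
            mul_le_mul h2 (hB x) (inv_nonneg.2 (hw x).le) (Real.exp_pos _).le
        _ = Real.exp (B - t / K) := by
            rw [← Real.exp_add]
            congr 1
            ring
        _ ≤ Real.exp (Real.log ε + Real.log ε) := by
            rw [Real.exp_le_exp]
            rw [one_div, Real.log_inv] at h3
            linarith
        _ = ε ^ 2 := by rw [Real.exp_add, Real.exp_log hε, sq]
    have h5 : ∑ y, |(P ^ t) x y - w y| ≤ ε := abs_le_of_sq_le_sq' (h1.trans h4) hε.le |>.2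
    have h6 : 0 ≤ ∑ y, |(P ^ t) x y - w y| := Finset.sum_nonneg fun y _ => abs_nonneg _
    linarith
  have hne : ∃ t, t ∈ {t : ℕ | ∀ t' : ℕ, t ≤ t' → tvDist P w t' ≤ ε} := ⟨_, hmem⟩
  refine ⟨Nat.find hne, ⟨Nat.find_spec hne, fun t ht => Nat.find_min' hne ht⟩, ?_⟩
  have h7 : (Nat.find hne : ℝ) ≤ ⌈s⌉₊ := by exact_mod_cast Nat.find_min' hne hmem
  exact h7.trans (Nat.ceil_lt_add_one hs0).le

end Reversible

open Equiv

/-! ### Size of the weights, and the transition matrix as an average of heat baths -/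

section Chain

variable {n : ℕ} {p : Fin n → Fin n → ℝ}

lemma exp_neg_le_weight {A : ℝ} (hA : 0 ≤ A) (hp : ∀ i j, i ≠ j → Real.exp (-A) ≤ p i j)
    (σ : Perm (Fin n)) : Real.exp (-(A * (n : ℝ) ^ 2)) ≤ weight p σ := by
  rw [weight_eq_prod_filter]
  set s := (Finset.univ : Finset (Fin n × Fin n)).filter fun z => z.1 < z.2
  have hs : (s.card : ℝ) ≤ (n : ℝ) ^ 2 := by
    have := Finset.card_le_univ s
    rw [Fintype.card_prod, Fintype.card_fin] at this
    rw [sq]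
    exact_mod_cast this
  calc Real.exp (-(A * (n : ℝ) ^ 2)) ≤ Real.exp (s.card * -A) := by
        rw [Real.exp_le_exp]
        nlinarith
    _ = ∏ _z ∈ s, Real.exp (-A) := by rw [Finset.prod_const, Real.exp_nat_mul]
    _ ≤ ∏ z ∈ s, p (σ z.1) (σ z.2) :=
        Finset.prod_le_prod (fun _ _ => (Real.exp_pos _).le) fun z hz =>
          hp _ _ fun h => (Finset.mem_filter.1 hz).2.ne (σ.injective h)

lemma weight_le_one (hpos : ∀ i j, i ≠ j → 0 < p i j) (htot : ∀ i j, i ≠ j → p i j + p j i = 1)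
    (σ : Perm (Fin n)) : weight p σ ≤ 1 := by
  rw [weight_eq_prod_filter]
  have hne : ∀ z ∈ (Finset.univ : Finset (Fin n × Fin n)).filter (fun z => z.1 < z.2),
      σ z.1 ≠ σ z.2 := fun z hz h => (Finset.mem_filter.1 hz).2.ne (σ.injective h)
  refine Finset.prod_le_one (fun z hz => (hpos _ _ (hne z hz)).le) fun z hz => ?_
  have h1 := htot _ _ (hne z hz)
  have h2 := hpos _ _ (hne z hz).symm
  linarith

lemma sum_weight_le (hpos : ∀ i j, i ≠ j → 0 < p i j)
    (htot : ∀ i j, i ≠ j → p i j + p j i = 1) : ∑ σ, weight p σ ≤ Real.exp ((n : ℝ) ^ 2) := by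
  calc ∑ σ, weight p σ ≤ ∑ _σ : Perm (Fin n), (1 : ℝ) :=
        Finset.sum_le_sum fun σ _ => weight_le_one hpos htot σ
    _ = (n.factorial : ℝ) := by simp [Fintype.card_perm]
    _ ≤ (n : ℝ) ^ n := by exact_mod_cast Nat.factorial_le_pow n
    _ ≤ Real.exp n ^ n := by
        refine pow_le_pow_left₀ (Nat.cast_nonneg n) ?_ n
        have := Real.add_one_le_exp (n : ℝ)
        linarith
    _ = Real.exp ((n : ℝ) ^ 2) := by rw [← Real.exp_nat_mul, sq]

variable [NeZero n]

/-- The heat bath update at the positions `r` and `r + 1`. -/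
noncomputable def heatBath (p : Fin n → Fin n → ℝ) (r : ℕ) (f : Perm (Fin n) → ℝ)
    (σ : Perm (Fin n)) : ℝ :=
  p (elt σ (r + 1)) (elt σ r) * f (σ * adjSwap n r) + p (elt σ r) (elt σ (r + 1)) * f σ

lemma sum_comp_adjSwap (r : ℕ) (g : Perm (Fin n) → ℝ) :
    ∑ σ, g (σ * adjSwap n r) = ∑ σ, g σ :=
  Fintype.sum_equiv (Equiv.mulRight (adjSwap n r)) _ _ fun _ => rfl

/-- Pythagoras: the update averages `f` over `σ` and `σ * adjSwap n r` with their conditional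
weights. In the proof, the defect `g` of the identity at `σ` changes sign under the exchange by
detailed balance, so it sums to zero. -/
lemma sum_heatBath_sq (htot : ∀ i j, i ≠ j → p i j + p j i = 1) {r : ℕ} (hr : r + 1 < n)
    (f : Perm (Fin n) → ℝ) :
    ∑ σ, weight p σ * heatBath p r f σ ^ 2 = ∑ σ, weight p σ * f σ ^ 2 -
      1 / 2 * ∑ σ, weight p σ * p (elt σ (r + 1)) (elt σ r) * (f (σ * adjSwap n r) - f σ) ^ 2 := by
  set g : Perm (Fin n) → ℝ := fun σ =>
    weight p σ * heatBath p r f σ ^ 2 - weight p σ * f σ ^ 2 +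
      1 / 2 * (weight p σ * p (elt σ (r + 1)) (elt σ r) * (f (σ * adjSwap n r) - f σ) ^ 2) with hg
  have hanti : ∀ σ, g (σ * adjSwap n r) = -g σ := by
    intro σ
    have h1 := weight_adjSwap (p := p) hr σ
    have h2 := htot _ _ (elt_ne_elt_succ hr σ)
    rw [hg]
    dsimp only [heatBath]
    rw [elt_adjSwap_left, elt_adjSwap_right, mul_adjSwap_cancel]
    generalize weight p (σ * adjSwap n r) = W' at *
    generalize weight p σ = W at *
    generalize p (elt σ r) (elt σ (r + 1)) = a at *
    have h3 : p (elt σ (r + 1)) (elt σ r) = 1 - a := by linarith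
    rw [h3] at h1 ⊢
    generalize f (σ * adjSwap n r) = u
    generalize f σ = v
    linear_combination (v ^ 2 - u ^ 2 - (1 - a) * (u - v) ^ 2 + 1 / 2 * (u - v) ^ 2) * h1
  have h0 : ∑ σ, g σ = 0 := by
    have h := sum_comp_adjSwap r g
    rw [Finset.sum_congr rfl fun σ _ => hanti σ, Finset.sum_neg_distrib] at h
    linarith
  rw [hg, Finset.sum_add_distrib, Finset.sum_sub_distrib, ← Finset.mul_sum] at h0
  linarith

lemma swapAt_eq (σ : Perm (Fin n)) (i : Fin (n - 1)) : swapAt σ i = σ * adjSwap n i := by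
  unfold swapAt adjSwap
  congr 2 <;> exact Fin.ext (ofNat_val (by omega)).symm

lemma apply_pos (σ : Perm (Fin n)) (i : Fin (n - 1)) : σ (pos i) = elt σ i := by
  unfold elt
  congr 1
  exact Fin.ext (ofNat_val (by omega)).symm

lemma apply_posSucc (σ : Perm (Fin n)) (i : Fin (n - 1)) : σ (posSucc i) = elt σ (i + 1) := by
  unfold elt
  congr 1
  exact Fin.ext (ofNat_val (by omega)).symm

lemma nnMatrix_apply (σ τ : Perm (Fin n)) :
    nnMatrix p σ τ = ∑ r ∈ Finset.range (n - 1), 1 / ((n : ℝ) - 1) *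
      ((if τ = σ * adjSwap n r then p (elt σ (r + 1)) (elt σ r) else 0) +
        (if τ = σ then p (elt σ r) (elt σ (r + 1)) else 0)) := by
  rw [Finset.sum_range]
  simp only [nnMatrix, Matrix.of_apply, swapAt_eq, apply_pos, apply_posSucc]

lemma nnMatrix_mulVec (f : Perm (Fin n) → ℝ) (σ : Perm (Fin n)) :
    (nnMatrix p).mulVec f σ
      = 1 / ((n : ℝ) - 1) * ∑ r ∈ Finset.range (n - 1), heatBath p r f σ := by
  simp only [Matrix.mulVec, dotProduct, nnMatrix_apply, Finset.sum_mul]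
  rw [Finset.sum_comm, Finset.mul_sum]
  refine Finset.sum_congr rfl fun r _ => ?_
  simp only [mul_assoc, ← Finset.mul_sum, add_mul, ite_mul, zero_mul, Finset.sum_add_distrib,
    Finset.sum_ite_eq', Finset.mem_univ, if_true, heatBath]

lemma nnMatrix_row_sum (hn : 2 ≤ n) (htot : ∀ i j, i ≠ j → p i j + p j i = 1)
    (σ : Perm (Fin n)) : ∑ τ, nnMatrix p σ τ = 1 := by
  have h := nnMatrix_mulVec (p := p) (fun _ => 1) σ
  have h1 : ∀ r ∈ Finset.range (n - 1), heatBath p r (fun _ => 1) σ = 1 := by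
    intro r hr
    have hr' : r + 1 < n := by have := Finset.mem_range.1 hr; omega
    unfold heatBath
    rw [mul_one, mul_one, add_comm]
    exact htot _ _ (elt_ne_elt_succ hr' σ)
  have h2 : ((n - 1 : ℕ) : ℝ) = n - 1 := by
    rw [Nat.cast_sub (by omega), Nat.cast_one]
  have h3 : (n : ℝ) - 1 ≠ 0 := by
    have : (2 : ℝ) ≤ n := by exact_mod_cast hn
    linarith
  rw [Finset.sum_congr rfl h1, Finset.sum_const, Finset.card_range, nsmul_eq_mul, h2, mul_one,
    one_div, inv_mul_cancel₀ h3] at h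
  simpa [Matrix.mulVec, dotProduct] using h

lemma weight_mul_nnMatrix (σ τ : Perm (Fin n)) :
    weight p σ * nnMatrix p σ τ = weight p τ * nnMatrix p τ σ := by
  rw [nnMatrix_apply, nnMatrix_apply, Finset.mul_sum, Finset.mul_sum]
  refine Finset.sum_congr rfl fun r hr => ?_
  have hr' : r + 1 < n := by have := Finset.mem_range.1 hr; omega
  have h1 : weight p σ * (if τ = σ * adjSwap n r then p (elt σ (r + 1)) (elt σ r) else 0)
      = weight p τ * (if σ = τ * adjSwap n r then p (elt τ (r + 1)) (elt τ r) else 0) := by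
    by_cases h : τ = σ * adjSwap n r
    · rw [if_pos h, if_pos (by rw [h, mul_adjSwap_cancel]), h, elt_adjSwap_left,
        elt_adjSwap_right, weight_adjSwap hr']
    · rw [if_neg h, if_neg fun h' => h (by rw [h', mul_adjSwap_cancel]), mul_zero, mul_zero]
  have h2 : weight p σ * (if τ = σ then p (elt σ r) (elt σ (r + 1)) else 0)
      = weight p τ * (if σ = τ then p (elt τ r) (elt τ (r + 1)) else 0) := by
    by_cases h : τ = σ
    · rw [h]
    · rw [if_neg h, if_neg (Ne.symm h), mul_zero, mul_zero]
  linear_combination 1 / ((n : ℝ) - 1) * (h1 + h2)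

/-- Convexity of the square passes the loss of each of the `n - 1` heat baths on to their mean.
Bounding the norm of the image itself also takes care of negative eigenvalues, so no lazy version of
the chain is needed. -/
lemma nnMatrix_contraction (hn : 2 ≤ n) (hpos : ∀ i j, i ≠ j → 0 < p i j)
    (htot : ∀ i j, i ≠ j → p i j + p j i = 1) (f : Perm (Fin n) → ℝ) :
    ∑ σ, weight p σ * (nnMatrix p).mulVec f σ ^ 2
      ≤ ∑ σ, weight p σ * f σ ^ 2 - 1 / (2 * ((n : ℝ) - 1)) * nnForm p f := by
  have hn1 : (0 : ℝ) < (n : ℝ) - 1 := by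
    have : (2 : ℝ) ≤ n := by exact_mod_cast hn
    linarith
  have h2 : ((n - 1 : ℕ) : ℝ) = n - 1 := by
    rw [Nat.cast_sub (by omega), Nat.cast_one]
  have h3 : ∀ σ, weight p σ * (nnMatrix p).mulVec f σ ^ 2
      ≤ 1 / ((n : ℝ) - 1) * ∑ r ∈ Finset.range (n - 1), weight p σ * heatBath p r f σ ^ 2 := by
    intro σ
    have h4 := sq_sum_le_card_mul_sum_sq (s := Finset.range (n - 1))
      (f := fun r => heatBath p r f σ)
    rw [Finset.card_range, h2] at h4
    rw [nnMatrix_mulVec, ← Finset.mul_sum, mul_left_comm]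
    refine mul_le_mul_of_nonneg_left ?_ (weight_pos hpos σ).le
    rw [mul_pow, sq (1 / _), mul_assoc]
    refine mul_le_mul_of_nonneg_left ?_ (by positivity)
    rw [one_div, inv_mul_le_iff₀ hn1]
    exact h4
  refine (Finset.sum_le_sum fun σ _ => h3 σ).trans (le_of_eq ?_)
  rw [← Finset.mul_sum, Finset.sum_comm, Finset.sum_congr rfl fun r hr => sum_heatBath_sq htot
    (by have := Finset.mem_range.1 hr; omega) f, Finset.sum_sub_distrib, Finset.sum_const,
    Finset.card_range, nsmul_eq_mul, h2, ← Finset.mul_sum, Finset.sum_comm]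
  unfold nnForm
  field_simp

lemma nnDist_mul_nnMatrix (σ τ : Perm (Fin n)) :
    nnDist p σ * nnMatrix p σ τ = nnDist p τ * nnMatrix p τ σ := by
  unfold nnDist
  rw [div_mul_eq_mul_div, weight_mul_nnMatrix, div_mul_eq_mul_div]

end Chain
end BiasedPerm

/-! ### The theorem: collecting the constants -/

theorem mainTheorem3 (pmax : ℝ) (hpmax : pmax < 1) :
    ∃ C : ℝ, 0 < C ∧ ∀ n : ℕ, 2 ≤ n → ∀ p : Fin n → Fin n → ℝ,
      (∃ T : BiasedPerm.LeagueTree (Fin n), BiasedPerm.HasLeagueStructure p T) →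
      BiasedPerm.WeaklyMonotone p →
      (∀ i j : Fin n, i ≠ j → p i j ≤ pmax) →
      BiasedPerm.IsStationary (BiasedPerm.nnMatrix p) (BiasedPerm.nnDist p) ∧
        ∀ ε : ℝ, 0 < ε → ε < 1 →
          ∃ τ : ℕ, BiasedPerm.IsMixingTime (BiasedPerm.nnMatrix p) (BiasedPerm.nnDist p) ε τ ∧
            (τ : ℝ) ≤ C * (n : ℝ) ^ 9 * Real.log ((n : ℝ) / ε) := by
  open BiasedPerm in
  set A : ℝ := |Real.log (1 - pmax)| with hAdef
  have hA : 0 ≤ A := abs_nonneg _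
  have hexp : Real.exp (-A) ≤ 1 - pmax := by
    calc Real.exp (-A) ≤ Real.exp (Real.log (1 - pmax)) :=
          Real.exp_le_exp.2 (neg_abs_le _)
      _ = 1 - pmax := Real.exp_log (by linarith)
  -- With `ℓ = log (n / ε)`, the bracket multiplying `54 * n ^ 7` is at most `((1 + A) * 2 + 2) * n
  -- ^ 2 * ℓ`; the last `2` absorbs the rounding up to an integer.
  refine ⟨54 * (4 + 2 * A) + 2, by positivity, fun n hn p hT hmono hmax => ?_⟩
  obtain ⟨T, hT⟩ := hT
  have : NeZero n := ⟨by omega⟩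
  have hn2 : (2 : ℝ) ≤ n := by exact_mod_cast hn
  have htot : ∀ i j, i ≠ j → p i j + p j i = 1 := by
    intro i j hij
    rcases lt_or_gt_of_ne hij with h | h
    · linarith [(hT.2.2 i j h).2]
    · linarith [(hT.2.2 j i h).2]
  have hlow : ∀ i j, i ≠ j → Real.exp (-A) ≤ p i j := fun i j hij => by
    linarith [htot i j hij, hmax j i hij.symm]
  have hpos : ∀ i j, i ≠ j → 0 < p i j := fun i j hij => (Real.exp_pos _).trans_le (hlow i j hij)
  set Z := ∑ σ, weight p σ with hZdef
  have hZ : 0 < Z := Finset.sum_pos (fun σ _ => weight_pos hpos σ) Finset.univ_nonempty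
  have hw : ∀ σ, 0 < nnDist p σ := fun σ => div_pos (weight_pos hpos σ) hZ
  have hw1 : ∑ σ, nnDist p σ = 1 := by
    unfold nnDist
    rw [← Finset.sum_div]
    exact div_self hZ.ne'
  have hrow := nnMatrix_row_sum hn htot
  have hrev := nnDist_mul_nnMatrix (p := p)
  refine ⟨⟨fun σ => (hw σ).le, hw1, fun τ => ?_⟩, fun ε hε hε1 => ?_⟩
  · simp only [hrev _ τ]
    rw [← Finset.mul_sum, hrow, mul_one]
  have hdist : ∀ g : Equiv.Perm (Fin n) → ℝ,
      ∑ σ, nnDist p σ * g σ = (∑ σ, weight p σ * g σ) / Z := by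
    intro g
    rw [Finset.sum_div]
    exact Finset.sum_congr rfl fun σ _ => div_mul_eq_mul_div _ _ _
  have hgap : ∀ f : Equiv.Perm (Fin n) → ℝ, ∑ σ, nnDist p σ * f σ = 0 →
      ∑ σ, nnDist p σ * (nnMatrix p).mulVec f σ ^ 2
        ≤ (1 - 1 / (54 * (n : ℝ) ^ 7)) * ∑ σ, nnDist p σ * f σ ^ 2 := by
    intro f hf
    rw [hdist, div_eq_zero_iff, or_iff_left hZ.ne'] at hf
    rw [hdist, hdist fun σ => f σ ^ 2, ← mul_div_assoc]
    refine div_le_div_of_nonneg_right ?_ hZ.le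
    refine (nnMatrix_contraction hn hpos htot f).trans ?_
    rw [sub_mul, one_mul]
    refine sub_le_sub_left ?_ _
    have h1 := nn_poincare hn hT.nodeFamily hpos htot hmono hpmax hmax f hf
    have h2 := nnForm_nonneg hpos f
    calc 1 / (54 * (n : ℝ) ^ 7) * ∑ σ, weight p σ * f σ ^ 2
        ≤ 1 / (54 * (n : ℝ) ^ 7) * (27 * (n : ℝ) ^ 6 * nnForm p f) :=
          mul_le_mul_of_nonneg_left h1 (by positivity)
      _ = 1 / (2 * (n : ℝ)) * nnForm p f := by field_simp; ring
      _ ≤ 1 / (2 * ((n : ℝ) - 1)) * nnForm p f := by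
          refine mul_le_mul_of_nonneg_right ?_ h2
          exact one_div_le_one_div_of_le (by linarith) (by linarith)
  -- The weight is a product of at most `n ^ 2` factors, each at least `exp (-A)`, and the
  -- normalising sum is at most `n! ≤ exp (n ^ 2)`.
  have hB : ∀ σ, (nnDist p σ)⁻¹ ≤ Real.exp ((1 + A) * (n : ℝ) ^ 2) := by
    intro σ
    have h1 := exp_neg_le_weight hA hlow σ
    have h2 := sum_weight_le hpos htot
    unfold nnDist
    rw [inv_div, div_le_iff₀ (weight_pos hpos σ)]
    calc Z ≤ Real.exp ((n : ℝ) ^ 2) := h2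
      _ = Real.exp ((1 + A) * (n : ℝ) ^ 2) * Real.exp (-(A * (n : ℝ) ^ 2)) := by
          rw [← Real.exp_add]
          congr 1
          ring
      _ ≤ _ := mul_le_mul_of_nonneg_left h1 (Real.exp_pos _).le
  have hn1 : 1 ≤ (n : ℝ) := by linarith
  have hn7 : 1 ≤ (n : ℝ) ^ 7 := one_le_pow₀ hn1
  obtain ⟨τ, hτ, hle⟩ := exists_isMixingTime_le hw hw1 hrow hrev
    (K := 54 * (n : ℝ) ^ 7) (by linarith) hgap hB (by positivity) hε hε1
  refine ⟨τ, hτ, hle.trans ?_⟩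
  have hl : Real.log (n / ε) = Real.log n + Real.log (1 / ε) := by
    rw [← Real.log_mul (by positivity) (by positivity)]
    congr 1
    ring
  -- From `n ≥ 2`; it gives `2 * ℓ ≥ 1`, so that terms without a logarithm can be multiplied by `2 *
  -- ℓ`.
  have hl2 : 1 / 2 ≤ Real.log n := by
    have := Real.log_le_log (by norm_num) hn2
    linarith [Real.log_two_gt_d9]
  have hl3 : 0 ≤ Real.log (1 / ε) := Real.log_nonneg (by rw [le_div_iff₀ hε]; linarith)
  set ℓ := Real.log (n / ε)
  have hl4 : 1 ≤ 2 * ℓ := by linarith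
  have hn9 : 1 ≤ (n : ℝ) ^ 9 := one_le_pow₀ hn1
  have h1 : (1 + A) * (n : ℝ) ^ 2 ≤ (1 + A) * (n : ℝ) ^ 2 * (2 * ℓ) :=
    le_mul_of_one_le_right (by positivity) hl4
  have h2 : 2 * Real.log (1 / ε) ≤ (n : ℝ) ^ 2 * (2 * ℓ) :=
    (by linarith : 2 * Real.log (1 / ε) ≤ 2 * ℓ).trans
      (le_mul_of_one_le_left (by linarith) (one_le_pow₀ hn1))
  have h3 : 1 ≤ (n : ℝ) ^ 9 * (2 * ℓ) := one_le_mul_of_one_le_of_one_le hn9 hl4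
  calc 54 * (n : ℝ) ^ 7 * ((1 + A) * (n : ℝ) ^ 2 + 2 * Real.log (1 / ε)) + 1
      ≤ 54 * (n : ℝ) ^ 7 * ((1 + A) * (n : ℝ) ^ 2 * (2 * ℓ) + (n : ℝ) ^ 2 * (2 * ℓ))
        + (n : ℝ) ^ 9 * (2 * ℓ) :=
        add_le_add (mul_le_mul_of_nonneg_left (add_le_add h1 h2) (by positivity)) h3
    _ = (54 * (4 + 2 * A) + 2) * (n : ℝ) ^ 9 * ℓ := by ring
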